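/- Let $n\ge 2$ and $\theta\in[\frac{\pi}{2},\pi)$. Write $\overline{\mathbb H^{n+1}}=\{x\in\mathbb R^{n+1}: x_1\ge 0\}$ and let $e_1,\dots,e_{n+1}$ be the standard basis of $\mathbb R^{n+1}$. There is a constant $C=C(n,\theta)>0$, depending only on $n$ and $\theta$, with the following property. Let $U$ be a relatively open subset of $\overline{\mathbb H^{n+1}}$, let $M$ be an $n$-dimensional $C^2$ manifold with (possibly empty) boundary, and let $\iota:M\to\overline{\mathbb H^{n+1}}$ be a $C^2$ immersion with $\iota(\partial M)\subset\{x_1=0\}$ which is proper over $U$ (that is, $\iota^{-1}(K)$ is compact for every compact $K\subset U$) and two-sided, with unit normal field $\nu$. Equip $M$ with the induced metric; let $\mathcal H^n$ and $\mathcal H^{n-1}$ be the induced area measures on $M$ and $\partial M$, let $\nabla$ be the gradient on $M$, let $A(\tau,\xi)=\langle D_\tau\xi,\nu\rangle$ be the second fundamental form, $H$ its trace, and $\eta$ the outer unit conormal of $\partial M$ in $M$. A function on $M$ is said to have compact support in $U$ if it vanishes outside $\iota^{-1}(K)$ for some compact $K\subset U$. Suppose that $M$ is a stable capillary minimal hypersurface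 in $U$ with contact angle $\theta$, that is, $H=0$ on $\iota^{-1}(U)$, $\langle\nu,e_1\rangle=\cos\theta$ on $\partial M\cap\iota^{-1}(U)$, and $$\int_M|A|^2\psi^2\,d\mathcal H^n\le\int_M|\nabla\psi|^2\,d\mathcal H^n+\cot\theta\int_{\partial M}A(\eta,\eta)\,\psi^2\,d\mathcal H^{n-1}$$ for every $\psi\in C^1(M)$ with compact support in $U$. Then for every locally Lipschitz function $\varphi$ on $M$ with compact support in $U$, both integrals below are finite and $$\int_M|A|^2\varphi^2\,d\mathcal H^n\le C\int_M|\nabla\varphi|^2\,g_\theta^2\,d\mathcal H^n ,$$ where, with $\nu_i=\langle\nu,e_i\rangle$, $$g_\theta=\sqrt{1-\nu_1^2-\nu_{n+1}^2+k(\cos\theta-\nu_1)^2},\qquad k=1\text{ if }n=2,\quad k=\tfrac1{n-2}\text{ if }n\ge3 .$$ -/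

import Mathlib

open scoped Manifold ContDiff Topology InnerProductSpace
open MeasureTheory Set

noncomputable section

namespace Capillary

/-- Euclidean space of dimension `d`. -/
abbrev E (d : ℕ) : Type := EuclideanSpace ℝ (Fin d)

/-- The closed half-space `x₁ ≥ 0` of `ℝ^{n+1}`; the coordinates `x₁, …, x_{n+1}` have the indices
`0, …, n`. -/
def closedHalfSpace (n : ℕ) : Set (E (n + 1)) := {x | 0 ≤ x 0}

/-- The bounding hyperplane `x₁ = 0` of the half-space. -/
def wall (n : ℕ) : Set (E (n + 1)) := {x | x 0 = 0}

/-- The Jacobian `√det(Lᵀ L)` of a linear map of Euclidean spaces: the factor by which an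
injective `L` multiplies volume of the dimension of its domain. -/
def jacobian {V W : Type*} [NormedAddCommGroup V] [InnerProductSpace ℝ V] [FiniteDimensional ℝ V]
    [NormedAddCommGroup W] [InnerProductSpace ℝ W] [FiniteDimensional ℝ W] (L : V →L[ℝ] W) : ℝ :=
  haveI := FiniteDimensional.complete ℝ V
  haveI := FiniteDimensional.complete ℝ W
  Real.sqrt (ContinuousLinearMap.det (ContinuousLinearMap.adjoint L ∘L L))

/-- The left inverse `(Lᵀ L)⁻¹ Lᵀ` of an injective linear map `L`: it inverts `L` on the range of
`L` and vanishes on the orthogonal complement of the range. -/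
def leftInv {a b : ℕ} (L : E a →L[ℝ] E b) : E b →L[ℝ] E a :=
  ContinuousLinearMap.inverse (ContinuousLinearMap.adjoint L ∘L L) ∘L ContinuousLinearMap.adjoint L

/-- The inclusion of the hyperplane of vectors of `ℝⁿ` whose coordinate of index `0` vanishes; it
contains the boundary of the model half-space `EuclideanHalfSpace n`. -/
def faceIncl (n : ℕ) [NeZero n] : EuclideanSpace ℝ {i : Fin n // i ≠ 0} →L[ℝ] E n :=
  ∑ i : {i : Fin n // i ≠ 0},
    (EuclideanSpace.proj i : EuclideanSpace ℝ {i : Fin n // i ≠ 0} →L[ℝ] ℝ).smulRight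
      (EuclideanSpace.single i.1 (1 : ℝ))

section Hypersurface

variable {n : ℕ} [NeZero n] {M : Type*} [TopologicalSpace M] [ChartedSpace (EuclideanHalfSpace n) M]

/-- The differential at `p` of a map from `M` to a Euclidean space. -/
def diff (n : ℕ) [NeZero n] {M : Type*} [TopologicalSpace M]
    [ChartedSpace (EuclideanHalfSpace n) M] {d : ℕ} (f : M → E d) (p : M) : E n →L[ℝ] E d :=
  mfderiv (𝓡∂ n) 𝓘(ℝ, E d) f p

/-- The differential at `p` of a real function on `M`. -/
def diffReal (n : ℕ) [NeZero n] {M : Type*} [TopologicalSpace M]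
    [ChartedSpace (EuclideanHalfSpace n) M] (φ : M → ℝ) (p : M) : E n →L[ℝ] ℝ :=
  mfderiv (𝓡∂ n) 𝓘(ℝ, ℝ) φ p

/-- The derivative at the point `x` of the half-space of `ι` read in the chart at `p`. -/
def chartDeriv (ι : M → E (n + 1)) (p : M) (x : E n) : E n →L[ℝ] E (n + 1) :=
  fderivWithin ℝ (ι ∘ (extChartAt (𝓡∂ n) p).symm) (range (𝓡∂ n)) x

/-- The area measure induced by `ι` on the domain of the chart at `p`: Lebesgue measure on the
image of the chart with density the Jacobian `√det(g_{ij})`, carried back to `M`. -/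
def chartArea [MeasurableSpace M] (ι : M → E (n + 1)) (p : M) : Measure M :=
  ((volume.restrict (extChartAt (𝓡∂ n) p).target).withDensity
    fun x => ENNReal.ofReal (jacobian (chartDeriv ι p x))).map (extChartAt (𝓡∂ n) p).symm

/-- The `n`-dimensional area measure on `M` of the immersion `ι` (`n`-dimensional Hausdorff measure
counted with multiplicity). By the change of variables formula the measures `chartArea ι p` agree
on overlaps of charts, so their supremum is the measure that restricts to each of them. -/
def area [MeasurableSpace M] (ι : M → E (n + 1)) : Measure M :=
  ⨆ p : M, chartArea ι p

/-- The `(n-1)`-dimensional area measure induced by `ι` on the part of `∂M` in the domain of the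
chart at `p`, as a measure on `M`. -/
def chartBoundaryArea [MeasurableSpace M] (ι : M → E (n + 1)) (p : M) : Measure M :=
  ((volume.restrict (faceIncl n ⁻¹' (extChartAt (𝓡∂ n) p).target)).withDensity
    fun y => ENNReal.ofReal (jacobian (chartDeriv ι p (faceIncl n y) ∘L faceIncl n))).map
      ((extChartAt (𝓡∂ n) p).symm ∘ faceIncl n)

/-- The `(n-1)`-dimensional area measure of `∂M`, as a measure on `M` that is carried by `∂M`. -/
def boundaryArea [MeasurableSpace M] (ι : M → E (n + 1)) : Measure M :=
  ⨆ p : M, chartBoundaryArea ι p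

/-- `|∇φ|²`, where `∇φ` is the gradient on `M` for the metric induced by `ι`. The vector `∇φ` of
the tangent hyperplane has the components `⟨∇φ, eᵢ⟩ = dφ((dι)⁻¹ eᵢᵀ)`, where `eᵢᵀ` is the
tangential part of `eᵢ`. -/
def gradSq (ι : M → E (n + 1)) (φ : M → ℝ) (p : M) : ℝ :=
  ∑ i, diffReal n φ p (leftInv (diff n ι p) (EuclideanSpace.single i 1)) ^ 2

/-- The second fundamental form `A(v, w) = ⟨D_v w, ν⟩ = -⟨D_v ν, w⟩` at `p` on tangent vectors `v`,
`w` in `ℝ^{n+1}`, extended to `ℝ^{n+1}` so that it vanishes if `v` or `w` is normal. -/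
def secondFF (ι ν : M → E (n + 1)) (p : M) (v w : E (n + 1)) : ℝ :=
  -⟪diff n ν p (leftInv (diff n ι p) v), w⟫_ℝ

/-- `|A|²`. Since `A` vanishes on normal vectors, any orthonormal basis of `ℝ^{n+1}` gives the same
sum as an orthonormal basis of the tangent hyperplane. -/
def secondFFSq (ι ν : M → E (n + 1)) (p : M) : ℝ :=
  ∑ i, ∑ j, secondFF ι ν p (EuclideanSpace.single i 1) (EuclideanSpace.single j 1) ^ 2

/-- The mean curvature `H`, the trace of `A`. -/
def meanCurvature (ι ν : M → E (n + 1)) (p : M) : ℝ :=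
  ∑ i, secondFF ι ν p (EuclideanSpace.single i 1) (EuclideanSpace.single i 1)

/-- The gradient in `M` at `p` of the coordinate of index `0` of the chart at `p`. If `p ∈ ∂M`, this
coordinate vanishes on `∂M` and is positive in the interior, so the gradient is an inward normal
of `∂M` in `M`. -/
def inwardConormal (ι : M → E (n + 1)) (p : M) : E (n + 1) :=
  ContinuousLinearMap.adjoint (leftInv (diff n ι p)) (EuclideanSpace.single (0 : Fin n) 1)

/-- The outer unit conormal `η` of `∂M` in `M` at a point `p ∈ ∂M`. -/
def outerConormal (ι : M → E (n + 1)) (p : M) : E (n + 1) :=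
  -(‖inwardConormal ι p‖⁻¹ • inwardConormal ι p)

/-- `φ` has compact support in `U` (as a function along `ι`). -/
def CompactlySupportedIn (ι : M → E (n + 1)) (U : Set (E (n + 1))) (φ : M → ℝ) : Prop :=
  ∃ K ⊆ U, IsCompact K ∧ Function.support φ ⊆ ι ⁻¹' K

/-- `φ` is locally Lipschitz on `M`. Since an immersion `ι` is locally bi-Lipschitz onto its image,
distances may be measured in `ℝ^{n+1}`. -/
def LocallyLipschitzOnImmersed (ι : M → E (n + 1)) (φ : M → ℝ) : Prop :=
  ∀ p : M, ∃ K : ℝ, ∃ V ∈ 𝓝 p, ∀ x ∈ V, ∀ y ∈ V, |φ x - φ y| ≤ K * ‖ι x - ι y‖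

/-- `ι` is a `C²` immersion of `M` into the closed half-space, proper over `U`, which maps `∂M` to
the bounding hyperplane, and `ν` is a global unit normal field (so that `M` is two-sided). -/
structure IsProperTwoSidedImmersion (U : Set (E (n + 1))) (ι ν : M → E (n + 1)) : Prop where
  contMDiff : ContMDiff (𝓡∂ n) 𝓘(ℝ, E (n + 1)) 2 ι
  injective_diff : ∀ p, Function.Injective (diff n ι p)
  mem_halfSpace : ∀ p, ι p ∈ closedHalfSpace n
  boundary_mem_wall : ∀ p ∈ (𝓡∂ n).boundary M, ι p ∈ wall n
  proper : ∀ K ⊆ U, IsCompact K → IsCompact (ι ⁻¹' K)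
  contMDiff_normal : ContMDiff (𝓡∂ n) 𝓘(ℝ, E (n + 1)) 1 ν
  norm_normal : ∀ p, ‖ν p‖ = 1
  normal : ∀ p v, ⟪ν p, diff n ι p v⟫_ℝ = 0

/-- `M` is a capillary minimal hypersurface in `U` with contact angle `θ`. -/
structure IsCapillaryMinimal (θ : ℝ) (U : Set (E (n + 1))) (ι ν : M → E (n + 1)) : Prop
    extends IsProperTwoSidedImmersion U ι ν where
  minimal : ∀ p, ι p ∈ U → meanCurvature ι ν p = 0
  contact_angle : ∀ p ∈ (𝓡∂ n).boundary M, ι p ∈ U → ν p 0 = Real.cos θ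

/-- `M` is a stable capillary minimal hypersurface in `U` with contact angle `θ`. -/
structure IsStableCapillaryMinimal [MeasurableSpace M] (θ : ℝ) (U : Set (E (n + 1)))
    (ι ν : M → E (n + 1)) : Prop extends IsCapillaryMinimal θ U ι ν where
  stable : ∀ φ : M → ℝ, ContMDiff (𝓡∂ n) 𝓘(ℝ, ℝ) 1 φ → CompactlySupportedIn ι U φ →
    ∫ p, secondFFSq ι ν p * φ p ^ 2 ∂(area ι) ≤
      ∫ p, gradSq ι φ p ∂(area ι) +
        Real.cot θ * ∫ p, secondFF ι ν p (outerConormal ι p) (outerConormal ι p) * φ p ^ 2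
          ∂(boundaryArea ι)

/-- The function `g_{θ,k} = √(1 - ν₁² - ν_{n+1}² + k (cos θ - ν₁)²)`. -/
def tiltFun (θ k : ℝ) (ν : M → E (n + 1)) (p : M) : ℝ :=
  Real.sqrt (1 - ν p 0 ^ 2 - ν p (Fin.last n) ^ 2 + k * (Real.cos θ - ν p 0) ^ 2)

/-- The capillary tilt function `g_θ`: `k = 1` for `n = 2` and `k = 1/(n-2)` for `n ≥ 3`. -/
def capillaryTilt (θ : ℝ) (ν : M → E (n + 1)) (p : M) : ℝ :=
  tiltFun θ (if n = 2 then 1 else 1 / ((n : ℝ) - 2)) ν p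

end Hypersurface

end Capillary

end

/-! Write `t = cos θ`, `x = ν₁`, `y = ν_{n+1}` and `G = g_θ² = 1 - x² - y² + k (t - x)²`. The
stability inequality is applied to `ψ = φ √(G + ε)`; the `ε` is needed because `G` may vanish, and
then `√G` need not be `C¹`. Expanding `|∇ψ|²` gives `(G + ε)|∇φ|²`, the cross term `φ ⟨∇φ, ∇G⟩` and
`φ² |∇G|² / (4 (G + ε))`. Since `½ ∇G = -(x + k (t - x)) ∇x - y ∇y`, the cross term is removed by
the Jacobi equations `Δν_c + |A|² ν_c = 0` for `x` and `y`, tested with `-φ² (x + k (t - x))` and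
`-φ² y`. Up to a nonnegative multiple of `ε`, what is left in the interior besides `(G + ε)|∇φ|²` is
`φ²` times `λ |A|² - |∇y|² - (1 - k) |∇x|² - |∇G|² / (4 (G + ε))`, with `λ = 1 + k t (t - x)`, and
`exists_tilt_bound` shows that this is at least `c |A|²` with `c > 0` depending on `k` and `t` only.

On the boundary `x = t` is constant, so the conormal `η` is a principal direction. Hence `A(e₁, η) =
-sin θ A(η, η)` and `A(e_{n+1}, η) = cot θ y A(η, η)`, and the boundary term of stability cancels
those of the two Jacobi equations except for a multiple of `ε` (`boundary_terms`). Letting `ε → 0`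
proves the estimate for `C¹` functions (`tilt_inequality_of_contMDiff`).

The pointwise estimate is linear algebra. The subtracted terms form a quadratic form in the shape
operator with eigenvalues `1` and `D = tiltEigenvalue` on the tangent space (`exists_tilt_frame`).
As the shape operator has trace zero, its entries outside the plane of the two eigenvectors control
`k (X + Y)²`, where `X`, `Y` are the diagonal entries in that plane (`tilt_operator_bound`). It
remains to see that `(λ - 1) X² + (λ - D) Y² + λ k (X + Y)²` is uniformly positive, which is
`tilt_discriminant`; this is where `-1 < cos θ ≤ 0` enters.

Since `ι` is only `C²`, the normal is only `C¹` and the Jacobi equation has to be weak. It comes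
from `d(dν) = 0` in weak form, tested with the antisymmetric field `ζ √det g (cⁱ eʲ - cʲ eⁱ)`; the
Christoffel symbols drop out of its divergence (`sum_christoffel_cancel`, `integral_local_jacobi`).
A partition of unity makes it global (`integral_jacobi`). Locally Lipschitz functions are reached by
mollification in charts, Rademacher's theorem and dominated convergence. -/

noncomputable section

namespace Capillary

set_option linter.unusedSectionVars false

/-! ### The pointwise estimate: algebra of the tilt form. -/

/-- The second nonzero eigenvalue of the quadratic form that is subtracted from `|A|²`. -/
def tiltEigenvalue (k t x y : ℝ) : ℝ :=
  (1 - x ^ 2 - y ^ 2) * (1 - k * (1 - t ^ 2)) / (1 - x ^ 2 - y ^ 2 + k * (t - x) ^ 2)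

lemma tiltEigenvalue_nonneg {k t x y : ℝ} (hk0 : 0 < k) (hk1 : k ≤ 1)
    (hxy : x ^ 2 + y ^ 2 ≤ 1) : 0 ≤ tiltEigenvalue k t x y := by
  have hq : k * (1 - t ^ 2) ≤ 1 := by nlinarith [sq_nonneg t]
  unfold tiltEigenvalue
  apply div_nonneg
  · exact mul_nonneg (by linarith) (by linarith)
  · have := mul_nonneg hk0.le (sq_nonneg (t - x)); linarith

/-- The eigenvalue is `1 - k (1 - t²)` times a fraction `s / (s + k (t - x)²) ≤ 1`. The resulting
gap below `1` settles the easy half of `tilt_discriminant`. -/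
lemma tiltEigenvalue_le {k t x y : ℝ} (hk0 : 0 < k) (hk1 : k ≤ 1)
    (hxy : x ^ 2 + y ^ 2 ≤ 1) : tiltEigenvalue k t x y ≤ 1 - k * (1 - t ^ 2) := by
  have hq : k * (1 - t ^ 2) ≤ 1 := by nlinarith [sq_nonneg t]
  have h2 := mul_nonneg hk0.le (sq_nonneg (t - x))
  unfold tiltEigenvalue
  apply div_le_of_le_mul₀ (by linarith) (by linarith)
  nlinarith [mul_nonneg (sub_nonneg.2 hq) h2]

/-- The bound that makes the tilt form coercive, in the case where `ν₁ < cos θ`. -/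
lemma tilt_discriminant_neg {k t x y : ℝ} (hk0 : 0 < k) (hk1 : k ≤ 1) (ht : -1 < t) (ht0 : t ≤ 0)
    (hxy : x ^ 2 + y ^ 2 ≤ 1) (hd : t * (t - x) < 0) :
    3 / 40 * k ^ 2 * (1 - t ^ 2) ^ 2 ≤
      (1 + k * t * (t - x)) ^ 2 * (1 + 2 * k)
        - (1 + k * t * (t - x)) * (1 + k) * (1 + tiltEigenvalue k t x y)
        + tiltEigenvalue k t x y := by
  obtain ⟨d, rfl⟩ : ∃ d, x = t - d := ⟨t - x, by ring⟩
  have hsub : t - (t - d) = d := by ring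
  rw [hsub] at hd ⊢
  have hd0 : 0 < d := by
    by_contra h
    exact absurd hd (not_lt.2 (mul_nonneg_of_nonpos_of_nonpos ht0 (not_lt.1 h)))
  have hx1 : d ≤ 1 + t := by nlinarith [sq_nonneg y]
  obtain ⟨e, he⟩ : ∃ e, e = -(t * d) := ⟨_, rfl⟩
  have he0 : 0 < e := by rw [he]; linarith
  -- Here `e = -t d ≤ -t (1 + t)`, whose maximum is `1/4`, at `t = -1/2`.
  have he4 : e ≤ 1 / 4 := by
    rw [he]; nlinarith [mul_nonneg (neg_nonneg.2 ht0) (sub_nonneg.2 hx1), sq_nonneg (t + 1 / 2)]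
  set q := 1 - t ^ 2 with hq
  have hq0 : 0 < q := by rw [hq]; nlinarith
  have hq1 : q ≤ 1 := by rw [hq]; nlinarith [sq_nonneg t]
  have hkq : k * q ≤ 1 := by nlinarith
  obtain ⟨r, hr⟩ : ∃ r, r = q - 2 * e := ⟨_, rfl⟩
  -- With `d ≤ 1 + t` and `t ≤ 0` one gets `r = 1 - t² + 2 t d ≥ (1 + t)²`.
  have hr0 : 0 ≤ r := by rw [hr, he, hq]; nlinarith [mul_nonneg (neg_nonneg.2 ht0) (sub_nonneg.2 hx1)]
  have hr1 : r ≤ 1 := by linarith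
  -- `m` is the largest value of `1 - x² - y²` for the given `x`
  obtain ⟨m, hm⟩ : ∃ m, m = r - d ^ 2 := ⟨_, rfl⟩
  have hmx : m = 1 - (t - d) ^ 2 := by rw [hm, hr, he, hq]; ring
  have hm0 : 0 ≤ m := by rw [hmx]; nlinarith [sq_nonneg y]
  have hkd : 0 < k * d ^ 2 := by positivity
  have hmk1 : m + k * d ^ 2 ≤ 1 := by
    rw [hm]; nlinarith [sq_nonneg d, mul_nonneg (sub_nonneg.2 hk1) (sq_nonneg d)]
  set D := tiltEigenvalue k t (t - d) y with hD
  -- The eigenvalue increases with `1 - x² - y²`, so for fixed `x` the worst case is `y = 0`, where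
  -- this quantity equals `m`.
  have hDle : D * (m + k * d ^ 2) ≤ m * (1 - k * q) := by
    have hs0 : 0 ≤ 1 - (t - d) ^ 2 - y ^ 2 := by linarith
    have hsm : 1 - (t - d) ^ 2 - y ^ 2 ≤ m := by rw [hmx]; nlinarith [sq_nonneg y]
    rw [hD, tiltEigenvalue, hsub, div_mul_eq_mul_div, div_le_iff₀ (by positivity), ← hq]
    nlinarith [mul_nonneg (mul_nonneg (sub_nonneg.2 hkq) hkd.le) (sub_nonneg.2 hsm)]
  have hY : 1 / 2 ≤ 1 - e - k * e := by nlinarith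
  have hlam : 1 + k * t * d = 1 - k * e := by rw [he]; ring
  rw [hlam]
  -- The determinant contains the factor `k`; the other factor is linear in `D`, so the bound on `D`
  -- can be inserted after multiplication by its denominator.
  have hF : (1 - k * e) ^ 2 * (1 + 2 * k) - (1 - k * e) * (1 + k) * (1 + D) + D
      = k * ((1 - k * e) * (1 - e - 2 * k * e) - D * (1 - e - k * e)) := by ring
  rw [hF]
  -- The constant is `3/8 = 1/2 - 1/8`: the coefficient `1 - e - k e` is at least `1/2`, and `r e²`
  -- costs at most `(r² + e²)/8` because `e ≤ 1/4`. The remaining term is nonnegative as `k ≤ 1`.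
  have hP : k * (3 / 8 * (r ^ 2 + e ^ 2)) ≤
      (m + k * d ^ 2) * ((1 - k * e) * (1 - e - 2 * k * e)) - m * (1 - k * q) * (1 - e - k * e) := by
    have hid : (m + k * d ^ 2) * ((1 - k * e) * (1 - e - 2 * k * e))
        - m * (1 - k * q) * (1 - e - k * e)
        = k * ((1 - e - k * e) * (r ^ 2 + e ^ 2) - r * e ^ 2
          + (1 - k) * d ^ 2 * e * (2 - e - 2 * k * e)) := by
      have h1 : q = r + 2 * e := by linarith
      have h2 : e ^ 2 = d ^ 2 * (1 - q) := by rw [he, hq]; ring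
      rw [hm]
      linear_combination (-(k * (1 - e - k * e))) * h2
        - (k * (1 - e - k * e)) * (-r) * h1
    rw [hid]
    apply mul_le_mul_of_nonneg_left _ hk0.le
    have hke : k * e ≤ e := mul_le_of_le_one_left he0.le hk1
    have h3 : 0 ≤ (1 - k) * d ^ 2 * e * (2 - e - 2 * k * e) :=
      mul_nonneg (mul_nonneg (mul_nonneg (by linarith) (sq_nonneg d)) he0.le) (by linarith)
    have h4 : r * e ^ 2 ≤ 1 / 8 * (r ^ 2 + e ^ 2) := by
      have h6 := mul_nonneg (mul_nonneg hr0 he0.le) (sub_nonneg.2 he4)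
      have h7 := sq_nonneg (r - e)
      linarith
    have h5 : 1 / 2 * (r ^ 2 + e ^ 2) ≤ (1 - e - k * e) * (r ^ 2 + e ^ 2) :=
      mul_le_mul_of_nonneg_right hY (by positivity)
    linarith
  -- Cauchy–Schwarz for `q = r + 2 e`; together with `3/8` this produces `3/40`.
  have hqr : 1 / 5 * q ^ 2 ≤ r ^ 2 + e ^ 2 := by
    have h1 : q = r + 2 * e := by linarith
    rw [h1]; nlinarith [sq_nonneg (2 * r - e)]
  set Φ := (1 - k * e) * (1 - e - 2 * k * e) - D * (1 - e - k * e) with hΦ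
  have h6 : k * (3 / 40 * q ^ 2) ≤ (m + k * d ^ 2) * Φ := by
    have h7 : k * (3 / 40 * q ^ 2) ≤ k * (3 / 8 * (r ^ 2 + e ^ 2)) :=
      mul_le_mul_of_nonneg_left (by linarith) hk0.le
    have h8 : (m + k * d ^ 2) * Φ = (m + k * d ^ 2) * ((1 - k * e) * (1 - e - 2 * k * e))
        - D * (m + k * d ^ 2) * (1 - e - k * e) := by rw [hΦ]; ring
    have h9 := mul_le_mul_of_nonneg_right hDle (by linarith : 0 ≤ 1 - e - k * e)
    linarith
  have h10 : 0 ≤ Φ := by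
    by_contra h
    have : (m + k * d ^ 2) * Φ ≤ 0 :=
      mul_nonpos_of_nonneg_of_nonpos (by positivity) (not_le.1 h).le
    have : 0 < k * (3 / 40 * q ^ 2) := by positivity
    linarith
  -- The multiplied denominator `m + k d²` is at most `1`, so it may be dropped.
  have h11 : k * (3 / 40 * q ^ 2) ≤ Φ := by
    have := mul_nonneg h10 (sub_nonneg.2 hmk1)
    linarith
  calc 3 / 40 * k ^ 2 * q ^ 2 = k * (k * (3 / 40 * q ^ 2)) := by ring
    _ ≤ k * Φ := mul_le_mul_of_nonneg_left h11 hk0.le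

/-- The right side is the determinant of the form `(λ - 1) X² + (λ - D) Y² + λ k (X + Y)²` with `λ =
1 + k t (t - x)`. If `t (t - x) ≥ 0`, then `λ ≥ 1` and the crude bound `D ≤ 1 - k (1 - t²)` is
enough. If `λ < 1`, the loss has to be balanced by the precise form of `D`. -/
lemma tilt_discriminant {k t x y : ℝ} (hk0 : 0 < k) (hk1 : k ≤ 1) (ht : -1 < t) (ht0 : t ≤ 0)
    (hxy : x ^ 2 + y ^ 2 ≤ 1) :
    3 / 40 * k ^ 2 * (1 - t ^ 2) ^ 2 ≤
      (1 + k * t * (t - x)) ^ 2 * (1 + 2 * k)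
        - (1 + k * t * (t - x)) * (1 + k) * (1 + tiltEigenvalue k t x y)
        + tiltEigenvalue k t x y := by
  rcases lt_or_ge (t * (t - x)) 0 with hd | hd
  · exact tilt_discriminant_neg hk0 hk1 ht ht0 hxy hd
  have hD0 := tiltEigenvalue_nonneg (t := t) hk0 hk1 hxy
  have hD1 := tiltEigenvalue_le (t := t) hk0 hk1 hxy
  set D := tiltEigenvalue k t x y
  obtain ⟨a, ha⟩ : ∃ a, a = k * t * (t - x) := ⟨_, rfl⟩
  have ha0 : 0 ≤ a := by rw [ha, mul_assoc]; exact mul_nonneg hk0.le hd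
  rw [← ha]
  have hq0 : 0 < 1 - t ^ 2 := by nlinarith
  have hq1 : 1 - t ^ 2 ≤ 1 := by nlinarith [sq_nonneg t]
  have h1 : (1 + a) ^ 2 * (1 + 2 * k) - (1 + a) * (1 + k) * (1 + D) + D
      = k * (1 - D) + a * (2 * (1 + 2 * k) - (1 + k) * (1 + D)) + a ^ 2 * (1 + 2 * k) := by ring
  have hDk : D ≤ 1 := by nlinarith [mul_pos hk0 hq0]
  have h2 : 0 ≤ a * (2 * (1 + 2 * k) - (1 + k) * (1 + D)) :=
    mul_nonneg ha0 (by nlinarith)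
  have h3 : 0 ≤ a ^ 2 * (1 + 2 * k) := by positivity
  have h4 : k * (k * (1 - t ^ 2)) ≤ k * (1 - D) := mul_le_mul_of_nonneg_left (by linarith) hk0.le
  have h5 : (1 - t ^ 2) ^ 2 ≤ 1 - t ^ 2 := by nlinarith
  have h6 : 0 < k ^ 2 := by positivity
  rw [h1]
  nlinarith [mul_le_mul_of_nonneg_left h5 h6.le, mul_pos h6 hq0]

/-- Coercivity of the tilt form on pairs of diagonal entries. -/
lemma exists_tilt_form_nonneg {k t : ℝ} (hk0 : 0 < k) (hk1 : k ≤ 1) (ht : -1 < t) (ht0 : t ≤ 0) :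
    ∃ c : ℝ, 0 < c ∧ ∀ x y : ℝ, x ^ 2 + y ^ 2 ≤ 1 →
      1 / 2 ≤ 1 + k * t * (t - x) - c ∧
      ∀ X Y : ℝ, 0 ≤ (1 + k * t * (t - x) - c - 1) * X ^ 2
        + (1 + k * t * (t - x) - c - tiltEigenvalue k t x y) * Y ^ 2
        + (1 + k * t * (t - x) - c) * (k * (X + Y) ^ 2) := by
  have hq0 : 0 < 1 - t ^ 2 := by nlinarith
  have hq1 : 1 - t ^ 2 ≤ 1 := by nlinarith [sq_nonneg t]
  -- The constant is the lower bound `3/40` of the determinant divided by `50`, and `50` bounds the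
  -- rate at which the determinant decreases when `λ` is replaced by `λ - c`.
  refine ⟨3 / 2000 * k ^ 2 * (1 - t ^ 2) ^ 2, by positivity, fun x y hxy => ?_⟩
  obtain ⟨c, hc⟩ : ∃ c, c = 3 / 2000 * k ^ 2 * (1 - t ^ 2) ^ 2 := ⟨_, rfl⟩
  have hc0 : 0 < c := by rw [hc]; positivity
  have hck : c ≤ 3 / 2000 * k := by
    rw [hc]
    have h1 : (1 - t ^ 2) ^ 2 ≤ 1 := by nlinarith
    have h2 : k ^ 2 * (1 - t ^ 2) ^ 2 ≤ k * 1 :=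
      mul_le_mul (by nlinarith) h1 (by positivity) hk0.le
    linarith
  have hF := tilt_discriminant hk0 hk1 ht ht0 hxy
  have hF' : 50 * c ≤ 3 / 40 * k ^ 2 * (1 - t ^ 2) ^ 2 := by
    rw [hc]; linarith
  have hD0 := tiltEigenvalue_nonneg (t := t) hk0 hk1 hxy
  have hD1 : tiltEigenvalue k t x y ≤ 1 := by
    have := tiltEigenvalue_le (t := t) hk0 hk1 hxy
    nlinarith [mul_pos hk0 hq0]
  rw [← hc]
  set D := tiltEigenvalue k t x y
  have hx : x ^ 2 ≤ 1 := by nlinarith [sq_nonneg y]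
  have hx1 : -1 ≤ x := by nlinarith
  have hx2 : x ≤ 1 := by nlinarith
  have htd1 : -(1 / 4) ≤ t * (t - x) := by
    nlinarith [mul_nonneg (neg_nonneg.2 ht0) (by linarith : 0 ≤ 1 + x), sq_nonneg (t + 1 / 2)]
  have htd2 : t * (t - x) ≤ 2 := by nlinarith
  obtain ⟨l, hl⟩ : ∃ l, l = 1 + k * t * (t - x) := ⟨_, rfl⟩
  rw [← hl] at hF ⊢
  have hl1 : 1 - k / 4 ≤ l := by
    rw [hl, mul_assoc]; nlinarith
  have hl2 : l ≤ 3 := by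
    rw [hl, mul_assoc]; nlinarith
  refine ⟨by linarith, fun X Y => ?_⟩
  have ha : 0 < (l - c) * (1 + k) - 1 := by nlinarith
  have hF2 : 0 ≤ ((l - c) * (1 + k) - 1) * ((l - c) * (1 + k) - D) - ((l - c) * k) ^ 2 := by
    have h1 : ((l - c) * (1 + k) - 1) * ((l - c) * (1 + k) - D) - ((l - c) * k) ^ 2
        = (l ^ 2 * (1 + 2 * k) - l * (1 + k) * (1 + D) + D)
          - c * ((2 * l - c) * (1 + 2 * k) - (1 + k) * (1 + D)) := by ring
    have h2 : (2 * l - c) * (1 + 2 * k) - (1 + k) * (1 + D) ≤ 50 := by nlinarith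
    rw [h1]
    nlinarith [mul_le_mul_of_nonneg_left h2 hc0.le]
  -- Completing the square: a binary form with positive leading coefficient and nonnegative
  -- determinant is nonnegative.
  have h3 : ((l - c) * (1 + k) - 1) * ((l - c - 1) * X ^ 2 + (l - c - D) * Y ^ 2
      + (l - c) * (k * (X + Y) ^ 2))
      = (((l - c) * (1 + k) - 1) * X + (l - c) * k * Y) ^ 2
        + (((l - c) * (1 + k) - 1) * ((l - c) * (1 + k) - D) - ((l - c) * k) ^ 2) * Y ^ 2 := by
    ring
  have h4 : 0 ≤ ((l - c) * (1 + k) - 1) * ((l - c - 1) * X ^ 2 + (l - c - D) * Y ^ 2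
      + (l - c) * (k * (X + Y) ^ 2)) := by
    rw [h3]; positivity
  exact nonneg_of_mul_nonneg_right h4 ha

lemma inner_single_one_left {d : ℕ} (i : Fin d) (v : E d) :
    ⟪(EuclideanSpace.single i 1 : E d), v⟫_ℝ = v i := by
  rw [EuclideanSpace.inner_single_left]; simp

/-- This diagonalizes the tilt form. With `a`, `b` the first and last coordinates of a tangent
vector, the two squares on the right are its products with orthogonal eigenvectors of square length
`w = (t - x)² + s (1 - t²)` and `s w`, where `s = 1 - x² - y²`. The eigenvector with eigenvalue `1`
does not depend on `k`. -/
lemma tilt_form_identity {k t x y : ℝ} (a b : ℝ) (hs : 0 < 1 - x ^ 2 - y ^ 2)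
    (hw : 0 < (t - x) ^ 2 + (1 - x ^ 2 - y ^ 2) * (1 - t ^ 2))
    (hg : 0 < 1 - x ^ 2 - y ^ 2 + k * (t - x) ^ 2) :
    b ^ 2 + (1 - k) * a ^ 2
        + ((x + k * (t - x)) * a + y * b) ^ 2 / (1 - x ^ 2 - y ^ 2 + k * (t - x) ^ 2)
      = ((t - x) ^ 2 + (1 - x ^ 2 - y ^ 2) * (1 - t ^ 2))⁻¹
          * (-(y * t * a + (1 - t * x) * b)) ^ 2
        + tiltEigenvalue k t x y
          * (((1 - x ^ 2 - y ^ 2) * ((t - x) ^ 2 + (1 - x ^ 2 - y ^ 2) * (1 - t ^ 2)))⁻¹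
            * ((1 - t * x - y ^ 2) * a - y * (t - x) * b) ^ 2) := by
  rw [tiltEigenvalue]
  obtain ⟨s, hsd⟩ : ∃ s, s = 1 - x ^ 2 - y ^ 2 := ⟨_, rfl⟩
  obtain ⟨w, hwd⟩ : ∃ w, w = (t - x) ^ 2 + s * (1 - t ^ 2) := ⟨_, rfl⟩
  obtain ⟨g, hgd⟩ : ∃ g, g = s + k * (t - x) ^ 2 := ⟨_, rfl⟩
  rw [← hsd] at hs hw hg ⊢
  rw [← hwd] at hw ⊢
  rw [← hgd] at hg ⊢
  field_simp
  rw [hgd, hwd, hsd]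
  ring

set_option maxHeartbeats 1000000 in
/-- In a half-space-adapted frame, the gradient terms of the tilt function form a quadratic form
with eigenvalues `1` and `tiltEigenvalue` on the tangent hyperplane. -/
lemma exists_tilt_frame {n : ℕ} (hn : 2 ≤ n) {k t : ℝ} (hk0 : 0 < k) (hk1 : k ≤ 1) (ht : -1 < t)
    (ht0 : t ≤ 0) (N : E (n + 1)) (hN : ‖N‖ = 1) :
    ∃ f₁ f₂ : E (n + 1), Orthonormal ℝ ![f₁, f₂, N] ∧ ∀ v : E (n + 1), ⟪N, v⟫_ℝ = 0 →
      ∀ ε : ℝ, 0 < ε →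
      v (Fin.last n) ^ 2 + (1 - k) * v 0 ^ 2
        + ((N 0 + k * (t - N 0)) * v 0 + N (Fin.last n) * v (Fin.last n)) ^ 2
          / (1 - N 0 ^ 2 - N (Fin.last n) ^ 2 + k * (t - N 0) ^ 2 + ε) ≤
      ⟪f₁, v⟫_ℝ ^ 2 + tiltEigenvalue k t (N 0) (N (Fin.last n)) * ⟪f₂, v⟫_ℝ ^ 2 := by
  set x := N 0 with hx
  set y := N (Fin.last n) with hy
  have hlast : (0 : Fin (n + 1)) ≠ Fin.last n := by
    intro h; have := congrArg Fin.val h; simp at this; omega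
  set e₀ : E (n + 1) := EuclideanSpace.single 0 1
  set e₁ : E (n + 1) := EuclideanSpace.single (Fin.last n) 1
  have h0 : ∀ v : E (n + 1), ⟪e₀, v⟫_ℝ = v 0 := inner_single_one_left 0
  have h1 : ∀ v : E (n + 1), ⟪e₁, v⟫_ℝ = v (Fin.last n) := inner_single_one_left _
  have h01 : e₀ (Fin.last n) = 0 := by simp [e₀, hlast.symm]
  have h10 : e₁ 0 = 0 := by simp [e₁, hlast]
  have h00 : e₀ 0 = 1 := by simp [e₀]
  have h11 : e₁ (Fin.last n) = 1 := by simp [e₁]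
  have hNN : ⟪N, N⟫_ℝ = 1 := by rw [real_inner_self_eq_norm_sq, hN, one_pow]
  have hN0 : ⟪N, e₀⟫_ℝ = x := by rw [real_inner_comm, h0]
  have hN1 : ⟪N, e₁⟫_ℝ = y := by rw [real_inner_comm, h1]
  have hs : 0 ≤ 1 - x ^ 2 - y ^ 2 := by
    have h2 := real_inner_self_nonneg (x := N - x • e₀ - y • e₁)
    simp only [inner_sub_left, inner_sub_right, inner_smul_left, inner_smul_right, hNN, hN0, hN1,
      h0, h1, h01, h10, h00, h11, ← hx, ← hy, RCLike.conj_to_real] at h2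
    nlinarith
  have hon : ∀ f₁ f₂ : E (n + 1), ⟪f₁, f₁⟫_ℝ = 1 → ⟪f₂, f₂⟫_ℝ = 1 → ⟪f₁, f₂⟫_ℝ = 0 →
      ⟪f₁, N⟫_ℝ = 0 → ⟪f₂, N⟫_ℝ = 0 → Orthonormal ℝ ![f₁, f₂, N] := by
    intro f₁ f₂ a1 a2 a3 a4 a5
    rw [orthonormal_iff_ite]
    intro i j
    have a3' : ⟪f₂, f₁⟫_ℝ = 0 := by rw [real_inner_comm, a3]
    have a4' : ⟪N, f₁⟫_ℝ = 0 := by rw [real_inner_comm, a4]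
    have a5' : ⟪N, f₂⟫_ℝ = 0 := by rw [real_inner_comm, a5]
    have b1 : ‖f₁‖ = 1 := by rw [norm_eq_sqrt_real_inner, a1, Real.sqrt_one]
    have b2 : ‖f₂‖ = 1 := by rw [norm_eq_sqrt_real_inner, a2, Real.sqrt_one]
    fin_cases i <;> fin_cases j <;>
      simp [b1, b2, a3, a4, a5, a3', a4', a5', hN]
  set d := t - x with hd
  have hkd : 0 ≤ k * d ^ 2 := by positivity
  have hq : 0 < 1 - t ^ 2 := by nlinarith
  have hkq : k * (1 - t ^ 2) ≤ 1 := by nlinarith [sq_nonneg t]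
  -- If `1 - x² - y² = 0`, the tangential parts of the two coordinate vectors are linearly dependent
  -- and the eigenvectors of the generic case degenerate. Then `D = 0`, so `f₂` may be any unit
  -- vector orthogonal to the plane.
  rcases hs.eq_or_lt with hs0 | hs0
  · -- `N` lies in the span of the two coordinate vectors
    have hNe : N = x • e₀ + y • e₁ := by
      have h2 : ‖N - (x • e₀ + y • e₁)‖ ^ 2 = 0 := by
        rw [← real_inner_self_eq_norm_sq]
        simp only [inner_sub_left, inner_sub_right, inner_add_left, inner_add_right,
          inner_smul_left, inner_smul_right, hNN, hN0, hN1,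
          h0, h1, h01, h10, h00, h11, ← hx, ← hy, RCLike.conj_to_real]
        nlinarith
      exact sub_eq_zero.1 (norm_eq_zero.1 (pow_eq_zero_iff two_ne_zero |>.1 h2))
    -- The index `1` differs from both `0` and `n` because `n ≥ 2`.
    set j : Fin (n + 1) := ⟨1, by omega⟩
    have hj0 : j ≠ 0 := by intro h; have := congrArg Fin.val h; simp [j] at this
    have hj1 : j ≠ Fin.last n := by intro h; have := congrArg Fin.val h; simp [j] at this; omega
    set f₂ : E (n + 1) := EuclideanSpace.single j 1
    have hf20 : f₂ 0 = 0 := by simp [f₂, hj0.symm]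
    have hf21 : f₂ (Fin.last n) = 0 := by simp [f₂, hj1.symm]
    have hxy : x ^ 2 + y ^ 2 = 1 := by linarith
    refine ⟨y • e₀ - x • e₁, f₂, hon _ _ ?_ ?_ ?_ ?_ ?_, fun v hv ε hε => ?_⟩
    · simp only [inner_sub_left, inner_sub_right, inner_smul_left, inner_smul_right,
        h0, h1, h01, h10, h00, h11, RCLike.conj_to_real]
      linarith
    · simp [f₂]
    · simp only [inner_sub_left, inner_smul_left, h0, h1, hf20, hf21]; simp
    · simp only [inner_sub_left, inner_smul_left, h0, h1, ← hx, ← hy, RCLike.conj_to_real]; ring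
    · rw [hNe, real_inner_comm]
      simp only [inner_add_left, inner_smul_left, h0, h1, hf20, hf21]; simp
    · have hv' : x * v 0 + y * v (Fin.last n) = 0 := by
        have h2 := hv
        rw [hNe] at h2
        simpa only [inner_add_left, inner_smul_left, h0, h1, RCLike.conj_to_real] using h2
      have hD : tiltEigenvalue k t x y = 0 := by simp [tiltEigenvalue, ← hs0]
      rw [hD, zero_mul, add_zero, ← hs0, zero_add]
      simp only [inner_sub_left, inner_smul_left, h0, h1, RCLike.conj_to_real]
      have h2 : (x + k * d) * v 0 + y * v (Fin.last n) = k * d * v 0 := by linarith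
      rw [h2]
      have h3 : (k * d * v 0) ^ 2 / (k * d ^ 2 + ε) ≤ k * v 0 ^ 2 := by
        rw [div_le_iff₀ (by positivity)]
        have : 0 ≤ k * v 0 ^ 2 * ε := by positivity
        nlinarith
      have h4 : (y * v 0 - x * v (Fin.last n)) ^ 2 = v 0 ^ 2 + v (Fin.last n) ^ 2 := by
        have : (y * v 0 - x * v (Fin.last n)) ^ 2 = (x ^ 2 + y ^ 2) * (v 0 ^ 2 + v (Fin.last n) ^ 2)
          - (x * v 0 + y * v (Fin.last n)) ^ 2 := by ring
        rw [this, hxy, hv']; ring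
      rw [h4]; linarith
  · set s := 1 - x ^ 2 - y ^ 2 with hsdef
    set w := d ^ 2 + s * (1 - t ^ 2) with hw
    have hw0 : 0 < w := by positivity
    -- `F₁` is minus the tangential part of `y t e₀ + (1 - t x) e₁`, and `F₂` is the orthogonal
    -- direction in the span of the tangential parts of `e₀` and `e₁`.
    set F₁ : E (n + 1) := y • N - (y * t) • e₀ - (1 - t * x) • e₁
    set F₂ : E (n + 1) := (1 - t * x - y ^ 2) • (e₀ - x • N) - (y * d) • (e₁ - y • N)
    have hF11 : ⟪F₁, F₁⟫_ℝ = w := by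
      simp only [F₁, inner_sub_left, inner_sub_right, inner_smul_left, inner_smul_right, hNN, hN0,
        hN1, h0, h1, h01, h10, h00, h11, ← hx, ← hy, RCLike.conj_to_real, hw, hd, hsdef]
      ring
    have hF22 : ⟪F₂, F₂⟫_ℝ = s * w := by
      simp only [F₂, inner_sub_left, inner_sub_right, inner_smul_left, inner_smul_right, hNN, hN0,
        hN1, h0, h1, h01, h10, h00, h11, ← hx, ← hy, RCLike.conj_to_real, hw, hd, hsdef]
      ring
    have hF12 : ⟪F₁, F₂⟫_ℝ = 0 := by
      simp only [F₁, F₂, inner_sub_left, inner_sub_right, inner_smul_left, inner_smul_right, hNN,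
        hN0, hN1, h0, h1, h01, h10, h00, h11, ← hx, ← hy, RCLike.conj_to_real, hd]
      ring
    have hF1N : ⟪F₁, N⟫_ℝ = 0 := by
      simp only [F₁, inner_sub_left, inner_smul_left, hNN, h0, h1, ← hx, ← hy,
        RCLike.conj_to_real]
      ring
    have hF2N : ⟪F₂, N⟫_ℝ = 0 := by
      simp only [F₂, inner_sub_left, inner_smul_left, hNN, h0, h1, ← hx, ← hy,
        RCLike.conj_to_real]
      ring
    have hsw : Real.sqrt w ^ 2 = w := Real.sq_sqrt hw0.le
    have hssw : Real.sqrt (s * w) ^ 2 = s * w := Real.sq_sqrt (by positivity)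
    have hr1 : Real.sqrt w ≠ 0 := (Real.sqrt_pos.2 hw0).ne'
    have hr2 : Real.sqrt (s * w) ≠ 0 := (Real.sqrt_pos.2 (by positivity)).ne'
    refine ⟨(Real.sqrt w)⁻¹ • F₁, (Real.sqrt (s * w))⁻¹ • F₂, hon _ _ ?_ ?_ ?_ ?_ ?_,
      fun v hv ε hε => ?_⟩
    · rw [inner_smul_left, inner_smul_right, hF11, RCLike.conj_to_real]
      field_simp; exact hsw.symm
    · rw [inner_smul_left, inner_smul_right, hF22, RCLike.conj_to_real]
      field_simp; exact hssw.symm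
    · rw [inner_smul_left, inner_smul_right, hF12]; simp
    · rw [inner_smul_left, hF1N]; simp
    · rw [inner_smul_left, hF2N]; simp
    · have hg : 0 < s + k * d ^ 2 := by positivity
      have hv1 : ⟪F₁, v⟫_ℝ = -(y * t * v 0 + (1 - t * x) * v (Fin.last n)) := by
        simp only [F₁, inner_sub_left, inner_smul_left, hv, h0, h1, RCLike.conj_to_real]
        ring
      have hv2 : ⟪F₂, v⟫_ℝ = (1 - t * x - y ^ 2) * v 0 - y * d * v (Fin.last n) := by
        simp only [F₂, inner_sub_left, inner_smul_left, hv, h0, h1, RCLike.conj_to_real]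
        ring
      rw [inner_smul_left, inner_smul_left, hv1, hv2, RCLike.conj_to_real, RCLike.conj_to_real,
        mul_pow, mul_pow, inv_pow, inv_pow, hsw, hssw]
      have hε' : ((x + k * d) * v 0 + y * v (Fin.last n)) ^ 2 / (s + k * d ^ 2 + ε)
          ≤ ((x + k * d) * v 0 + y * v (Fin.last n)) ^ 2 / (s + k * d ^ 2) :=
        div_le_div_of_nonneg_left (sq_nonneg _) hg (by linarith)
      have hid : v (Fin.last n) ^ 2 + (1 - k) * v 0 ^ 2
          + ((x + k * d) * v 0 + y * v (Fin.last n)) ^ 2 / (s + k * d ^ 2)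
          = w⁻¹ * (-(y * t * v 0 + (1 - t * x) * v (Fin.last n))) ^ 2
            + tiltEigenvalue k t x y
              * ((s * w)⁻¹ * ((1 - t * x - y ^ 2) * v 0 - y * d * v (Fin.last n)) ^ 2) := by
        exact tilt_form_identity _ _ hs0 hw0 hg
      linarith

/-- A trace-free symmetric operator with kernel containing `N` satisfies the estimate that is
encoded in the two-dimensional form `hform`. -/
lemma tilt_operator_bound {n : ℕ} (hn : 2 ≤ n) {l D : ℝ} (hl : 1 / 2 ≤ l)
    (hform : ∀ X Y : ℝ, 0 ≤ (l - 1) * X ^ 2 + (l - D) * Y ^ 2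
      + l * ((if n = 2 then 1 else 1 / ((n : ℝ) - 2)) * (X + Y) ^ 2))
    (B : E (n + 1) →ₗ[ℝ] E (n + 1)) (hB : ∀ v w, ⟪B v, w⟫_ℝ = ⟪v, B w⟫_ℝ)
    {f₁ f₂ N : E (n + 1)} (hf : Orthonormal ℝ ![f₁, f₂, N]) (hBN : B N = 0)
    (htr : ∑ i, ⟪B (EuclideanSpace.single i 1), EuclideanSpace.single i 1⟫_ℝ = 0) :
    ‖B f₁‖ ^ 2 + D * ‖B f₂‖ ^ 2 ≤ l * ∑ i, ‖B (EuclideanSpace.single i 1)‖ ^ 2 := by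
  classical
  obtain ⟨m, rfl⟩ : ∃ m, n = m + 2 := ⟨n - 2, by omega⟩
  set κ : ℝ := if m + 2 = 2 then 1 else 1 / (((m + 2 : ℕ) : ℝ) - 2) with hκ
  obtain ⟨b, hb⟩ : ∃ b : OrthonormalBasis (Fin 3 ⊕ Fin m) ℝ (E (m + 2 + 1)),
      ∀ i, b (Sum.inl i) = ![f₁, f₂, N] i := by
    have hcard : Module.finrank ℝ (E (m + 2 + 1)) = Fintype.card (Fin 3 ⊕ Fin m) := by
      simp; omega
    have hs : ∀ i : range (Sum.inl : Fin 3 → Fin 3 ⊕ Fin m), ∃ j, Sum.inl j = i.1 := fun i => i.2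
    choose g hg using hs
    have hinj : Function.Injective g := fun i j hij => by
      apply Subtype.ext; rw [← hg i, ← hg j, hij]
    have ho : Orthonormal ℝ ((range (Sum.inl : Fin 3 → Fin 3 ⊕ Fin m)).domRestrict
        (Sum.elim ![f₁, f₂, N] (fun _ => 0))) := by
      have h1 := hf.comp g hinj
      convert h1 using 1
      funext i
      simp [Set.domRestrict, ← hg i]
    obtain ⟨b, hb⟩ := Orthonormal.exists_orthonormalBasis_extension_of_card_eq hcard ho
    exact ⟨b, fun i => by rw [hb _ ⟨i, rfl⟩]; rfl⟩
  have hsum : ∀ v : E (m + 2 + 1), ‖v‖ ^ 2 = ∑ i, ⟪b i, v⟫_ℝ ^ 2 := fun v => by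
    rw [← b.sum_sq_norm_inner_right v]; simp
  -- The Hilbert–Schmidt norm does not depend on the orthonormal basis; symmetry of `B` exchanges
  -- the two bases.
  have hsq : ∑ i, ‖B (EuclideanSpace.single i 1)‖ ^ 2 = ∑ i, ‖B (b i)‖ ^ 2 := by
    have h1 : ∀ i, ‖B (EuclideanSpace.single i 1)‖ ^ 2
        = ∑ j, ⟪EuclideanSpace.single i (1 : ℝ), B (b j)⟫_ℝ ^ 2 := fun i => by
      rw [hsum]
      refine Finset.sum_congr rfl fun j _ => ?_
      rw [← hB, real_inner_comm]
    simp_rw [h1]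
    rw [Finset.sum_comm]
    refine Finset.sum_congr rfl fun j _ => ?_
    rw [← (EuclideanSpace.basisFun (Fin (m + 2 + 1)) ℝ).sum_sq_norm_inner_right (B (b j))]
    simp
  have htr' : ∑ i, ⟪b i, B (b i)⟫_ℝ = 0 := by
    rw [← LinearMap.trace_eq_sum_inner,
      LinearMap.trace_eq_sum_inner B (EuclideanSpace.basisFun (Fin (m + 2 + 1)) ℝ), ← htr]
    refine Finset.sum_congr rfl fun i _ => ?_
    rw [real_inner_comm]; simp
  have hsymm : ∀ i j, ⟪b i, B (b j)⟫_ℝ = ⟪b j, B (b i)⟫_ℝ := fun i j => by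
    rw [← hB, real_inner_comm]
  have hb2 : b (Sum.inl 2) = N := by rw [hb]; rfl
  have hb0 : b (Sum.inl 0) = f₁ := by rw [hb]; rfl
  have hb1 : b (Sum.inl 1) = f₂ := by rw [hb]; rfl
  have hz : ∀ i, ⟪b i, B (b (Sum.inl 2))⟫_ℝ = 0 := fun i => by rw [hb2, hBN, inner_zero_right]
  have hz' : ∀ i, ⟪b (Sum.inl 2), B (b i)⟫_ℝ = 0 := fun i => by rw [hsymm, hz]
  rw [hsq, ← hb0, ← hb1]
  simp_rw [hsum (B _)]
  simp only [Fintype.sum_sum_type, Fin.sum_univ_three, hz, hz'] at htr' ⊢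
  rw [hsymm (Sum.inl 1) (Sum.inl 0)]
  simp_rw [hsymm (Sum.inl 0) (Sum.inr _), hsymm (Sum.inl 1) (Sum.inr _)]
  rw [Finset.sum_add_distrib, Finset.sum_add_distrib, Finset.sum_add_distrib]
  set X := ⟪b (Sum.inl 0), B (b (Sum.inl 0))⟫_ℝ
  set Y := ⟪b (Sum.inl 1), B (b (Sum.inl 1))⟫_ℝ
  set Z := ⟪b (Sum.inl 0), B (b (Sum.inl 1))⟫_ℝ
  set o₁ := ∑ j, ⟪b (Sum.inr j), B (b (Sum.inl 0))⟫_ℝ ^ 2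
  set o₂ := ∑ j, ⟪b (Sum.inr j), B (b (Sum.inl 1))⟫_ℝ ^ 2
  set R := ∑ i, ∑ j, ⟪b (Sum.inr j), B (b (Sum.inr i))⟫_ℝ ^ 2 with hR
  have ho₁ : 0 ≤ o₁ := Finset.sum_nonneg fun _ _ => sq_nonneg _
  have ho₂ : 0 ≤ o₂ := Finset.sum_nonneg fun _ _ => sq_nonneg _
  -- The trace vanishes, so `-(X + Y)` is the sum of the `m = n - 2` remaining diagonal entries, and
  -- Cauchy–Schwarz gives the factor `1/(n - 2)`. For `n = 2` no entries remain and `X + Y = 0`, so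
  -- the value of `κ` is immaterial.
  have hRle : κ * (X + Y) ^ 2 ≤ R := by
    have hXY : X + Y = -∑ i, ⟪b (Sum.inr i), B (b (Sum.inr i))⟫_ℝ := by linarith
    have hdiag : ∑ i, ⟪b (Sum.inr i), B (b (Sum.inr i))⟫_ℝ ^ 2 ≤ R :=
      Finset.sum_le_sum fun i _ => Finset.single_le_sum
        (f := fun j => ⟪b (Sum.inr j), B (b (Sum.inr i))⟫_ℝ ^ 2)
        (fun _ _ => sq_nonneg _) (Finset.mem_univ i)
    have hcs := sq_sum_le_card_mul_sum_sq (s := (Finset.univ : Finset (Fin m)))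
      (f := fun i => ⟪b (Sum.inr i), B (b (Sum.inr i))⟫_ℝ)
    rw [Finset.card_univ, Fintype.card_fin] at hcs
    rw [hXY, neg_sq]
    rcases Nat.eq_zero_or_pos m with rfl | hm
    · simpa using hR.ge
    · have hm' : (0 : ℝ) < m := by exact_mod_cast hm
      have hκm : κ = 1 / (m : ℝ) := by
        rw [hκ, if_neg (by omega)]; push_cast; ring
      rw [hκm, one_div, inv_mul_le_iff₀ hm']
      exact hcs.trans (mul_le_mul_of_nonneg_left hdiag hm'.le)
  have h1 := hform X Y
  -- At `(1, -1)` the last term disappears, leaving `2 l ≥ 1 + D`, which is the sign needed for the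
  -- off-diagonal entry `Z`, counted twice in the norm.
  have h2 := hform 1 (-1)
  have h3 : l * (κ * (X + Y) ^ 2) ≤ l * R := mul_le_mul_of_nonneg_left hRle (by linarith)
  have h4 : 0 ≤ (2 * l - 1 - D) * Z ^ 2 := mul_nonneg (by linarith) (sq_nonneg Z)
  have h5 : 0 ≤ (2 * l - 1) * o₁ := mul_nonneg (by linarith) ho₁
  have h6 : 0 ≤ (2 * l - D) * o₂ := mul_nonneg (by linarith) ho₂
  simp only [ne_eq, OfNat.ofNat_ne_zero, not_false_eq_true, zero_pow, add_zero,
    Finset.sum_const_zero]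
  linarith

/-- The pointwise estimate behind the tilt inequality. -/
lemma exists_tilt_bound {n : ℕ} (hn : 2 ≤ n) {k t : ℝ}
    (hk : k = if n = 2 then 1 else 1 / ((n : ℝ) - 2)) (ht : -1 < t) (ht0 : t ≤ 0) :
    ∃ c : ℝ, 0 < c ∧ ∀ (B : E (n + 1) →ₗ[ℝ] E (n + 1)) (N : E (n + 1)),
      (∀ v w, ⟪B v, w⟫_ℝ = ⟪v, B w⟫_ℝ) → ‖N‖ = 1 → B N = 0 →
      (∑ i, ⟪B (EuclideanSpace.single i 1), EuclideanSpace.single i 1⟫_ℝ = 0) →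
      ∀ ε : ℝ, 0 < ε →
      c * (∑ i, ‖B (EuclideanSpace.single i 1)‖ ^ 2) ≤
        (1 + k * t * (t - N 0)) * (∑ i, ‖B (EuclideanSpace.single i 1)‖ ^ 2)
        - ‖B (EuclideanSpace.single (Fin.last n) 1)‖ ^ 2
        - (1 - k) * ‖B (EuclideanSpace.single 0 1)‖ ^ 2
        - ‖(N 0 + k * (t - N 0)) • B (EuclideanSpace.single 0 1)
            + N (Fin.last n) • B (EuclideanSpace.single (Fin.last n) 1)‖ ^ 2
          / (1 - N 0 ^ 2 - N (Fin.last n) ^ 2 + k * (t - N 0) ^ 2 + ε) := by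
  have hn' : (2 : ℝ) ≤ n := by exact_mod_cast hn
  have hk01 : 0 < k ∧ k ≤ 1 := by
    rw [hk]
    split_ifs with h
    · norm_num
    · have h3 : (3 : ℝ) ≤ n := by exact_mod_cast (by omega : 3 ≤ n)
      exact ⟨by apply one_div_pos.2; linarith, by rw [div_le_one (by linarith)]; linarith⟩
  obtain ⟨c, hc0, hc⟩ := exists_tilt_form_nonneg hk01.1 hk01.2 ht ht0
  refine ⟨c, hc0, fun B N hB hN hBN htr ε hε => ?_⟩
  obtain ⟨f₁, f₂, hf, hfv⟩ := exists_tilt_frame hn hk01.1 hk01.2 ht ht0 N hN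
  have hlast : (0 : Fin (n + 1)) ≠ Fin.last n := by
    intro h; have := congrArg Fin.val h; simp at this; omega
  have hxy : N 0 ^ 2 + N (Fin.last n) ^ 2 ≤ 1 := by
    have h1 : ‖N‖ ^ 2 = ∑ i, N i ^ 2 := by rw [EuclideanSpace.real_norm_sq_eq]
    rw [hN, one_pow] at h1
    rw [h1, ← Finset.sum_pair (f := fun i => N i ^ 2) hlast]
    exact Finset.sum_le_sum_of_subset_of_nonneg (Finset.subset_univ _) fun _ _ _ => sq_nonneg _
  obtain ⟨hl, hform⟩ := hc _ _ hxy
  have key := tilt_operator_bound hn hl (by rw [← hk]; exact hform) B hB hf hBN htr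
  have hcoord : ∀ w : E (n + 1), ‖w‖ ^ 2 = ∑ j, w j ^ 2 := fun w =>
    EuclideanSpace.real_norm_sq_eq w
  -- By symmetry of `B` the coordinate `j` of `B v` is `⟨v, B e_j⟩`. The estimate is therefore the
  -- frame inequality for the tangent vectors `B e_j`, summed over `j`.
  have hentry : ∀ (v : E (n + 1)) j, B v j = ⟪v, B (EuclideanSpace.single j 1)⟫_ℝ := fun v j => by
    rw [← hB, real_inner_comm, inner_single_one_left]
  have hsum : ‖B (EuclideanSpace.single (Fin.last n) 1)‖ ^ 2
        + (1 - k) * ‖B (EuclideanSpace.single 0 1)‖ ^ 2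
        + ‖(N 0 + k * (t - N 0)) • B (EuclideanSpace.single 0 1)
            + N (Fin.last n) • B (EuclideanSpace.single (Fin.last n) 1)‖ ^ 2
          / (1 - N 0 ^ 2 - N (Fin.last n) ^ 2 + k * (t - N 0) ^ 2 + ε)
      ≤ ‖B f₁‖ ^ 2 + tiltEigenvalue k t (N 0) (N (Fin.last n)) * ‖B f₂‖ ^ 2 := by
    simp only [hcoord, Finset.mul_sum, Finset.sum_div, ← Finset.sum_add_distrib]
    refine Finset.sum_le_sum fun j _ => ?_
    have hj : ⟪N, B (EuclideanSpace.single j 1)⟫_ℝ = 0 := by rw [← hB, hBN, inner_zero_left]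
    have h1 := hfv _ hj ε hε
    simp only [PiLp.add_apply, PiLp.smul_apply, smul_eq_mul, hentry f₁ j, hentry f₂ j]
    rw [hentry _ j, hentry _ j, inner_single_one_left, inner_single_one_left]
    exact h1
  linarith

/-! ### Linear algebra of an injective map: projection, dual frame, Gram matrix, Jacobian. -/

section LinearAlgebra

variable {a b : ℕ}

/-- The standard basis vectors of Euclidean space. -/
abbrev bvec {d : ℕ} (i : Fin d) : E d := EuclideanSpace.single i 1

lemma sum_coord_smul_bvec (v : E a) : ∑ i, v i • (bvec i : E a) = v := by
  have := (EuclideanSpace.basisFun (Fin a) ℝ).sum_repr v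
  simpa using this

lemma isInvertible_gram {L : E a →L[ℝ] E b} (hL : Function.Injective L) :
    (ContinuousLinearMap.adjoint L ∘L L).IsInvertible := by
  have hinj : Function.Injective (ContinuousLinearMap.adjoint L ∘L L : E a →ₗ[ℝ] E a) := by
    rw [← LinearMap.ker_eq_bot, LinearMap.ker_eq_bot']
    intro v hv
    have h1 : ⟪ContinuousLinearMap.adjoint L (L v), v⟫_ℝ = 0 := by
      have : ContinuousLinearMap.adjoint L (L v) = 0 := hv
      rw [this, inner_zero_left]
    rw [ContinuousLinearMap.adjoint_inner_left, inner_self_eq_zero] at h1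
    exact hL (by rw [h1, map_zero])
  exact ⟨(LinearEquiv.ofInjectiveEndo _ hinj).toContinuousLinearEquiv, by ext v; rfl⟩

lemma leftInv_apply_self {L : E a →L[ℝ] E b} (hL : Function.Injective L) (v : E a) :
    leftInv L (L v) = v :=
  (isInvertible_gram hL).inverse_apply_self v

lemma leftInv_eq_zero_of_orthogonal {L : E a →L[ℝ] E b} {w : E b} (hw : ∀ v, ⟪w, L v⟫_ℝ = 0) :
    leftInv L w = 0 := by
  have h1 : ContinuousLinearMap.adjoint L w = 0 := by
    rw [← inner_self_eq_zero (𝕜 := ℝ), ContinuousLinearMap.adjoint_inner_left, hw]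
  simp [leftInv, h1]

/-- These are the normal equations `LᵀL (leftInv L w) = Lᵀ w`: `L ∘ leftInv L` is the orthogonal
projection to the range of `L`. -/
lemma inner_self_leftInv {L : E a →L[ℝ] E b} (hL : Function.Injective L) (v : E a) (w : E b) :
    ⟪L v, L (leftInv L w)⟫_ℝ = ⟪L v, w⟫_ℝ := by
  rw [← ContinuousLinearMap.adjoint_inner_right, ← ContinuousLinearMap.adjoint_inner_right]
  congr 1
  exact (isInvertible_gram hL).self_apply_inverse _

lemma inner_apply_leftInv_comm {L : E a →L[ℝ] E b} (hL : Function.Injective L) (v w : E b) :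
    ⟪L (leftInv L v), w⟫_ℝ = ⟪v, L (leftInv L w)⟫_ℝ := by
  rw [← inner_self_leftInv hL, real_inner_comm, inner_self_leftInv hL, real_inner_comm]

/-- The tangential part of a vector is determined by the unit normal. -/
lemma apply_leftInv {n : ℕ} {L : E n →L[ℝ] E (n + 1)} (hL : Function.Injective L)
    {N : E (n + 1)} (hN : ‖N‖ = 1) (hNL : ∀ v, ⟪N, L v⟫_ℝ = 0) (w : E (n + 1)) :
    L (leftInv L w) = w - ⟪N, w⟫_ℝ • N := by
  set T : Submodule ℝ (E (n + 1)) := LinearMap.range (L : E n →ₗ[ℝ] E (n + 1))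
  have hT : Module.finrank ℝ T = n := by
    rw [LinearMap.finrank_range_of_inj hL]; simp
  have hTo : Module.finrank ℝ Tᗮ = 1 := by
    have := T.finrank_add_finrank_orthogonal
    rw [hT] at this
    simp at this ⊢
    omega
  have hNT : N ∈ Tᗮ := by
    rw [Submodule.mem_orthogonal']
    rintro _ ⟨v, rfl⟩
    exact hNL v
  have hN0 : (⟨N, hNT⟩ : Tᗮ) ≠ 0 := by
    intro h
    have : N = 0 := congrArg Subtype.val h
    simp [this] at hN
  have hw : w - L (leftInv L w) ∈ Tᗮ := by
    rw [Submodule.mem_orthogonal]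
    rintro _ ⟨v, rfl⟩
    change ⟪L v, _⟫_ℝ = 0
    rw [inner_sub_right, inner_self_leftInv hL, sub_self]
  obtain ⟨c, hc⟩ := (finrank_eq_one_iff_of_nonzero' _ hN0).1 hTo ⟨_, hw⟩
  have hc' : c • N = w - L (leftInv L w) := congrArg Subtype.val hc
  have h2 : c = ⟪N, w⟫_ℝ := by
    have := congrArg (fun z => ⟪N, z⟫_ℝ) hc'
    simpa [inner_smul_right, inner_sub_right, hNL, hN] using this
  rw [← h2, hc']; abel

/-- This is why tangential derivatives do not depend on the chart: a change of coordinates `T` of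
the domain leaves the range, and hence the projection to it, unchanged. -/
lemma leftInv_comp {L : E a →L[ℝ] E b} (hL : Function.Injective L) (T : E a ≃L[ℝ] E a) :
    leftInv (L ∘L (T : E a →L[ℝ] E a)) = (T.symm : E a →L[ℝ] E a) ∘L leftInv L := by
  have hLT : Function.Injective (L ∘L (T : E a →L[ℝ] E a)) := hL.comp T.injective
  ext1 w
  have hw : leftInv (L ∘L (T : E a →L[ℝ] E a)) (w - L (leftInv L w)) = 0 :=
    leftInv_eq_zero_of_orthogonal fun v => by
      rw [real_inner_comm]
      change ⟪L (T v), _⟫_ℝ = 0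
      rw [inner_sub_right, inner_self_leftInv hL, sub_self]
  rw [map_sub, sub_eq_zero] at hw
  rw [hw]
  have := leftInv_apply_self hLT (T.symm (leftInv L w))
  simpa using this

/-- The dual frame of the frame `L e₀, …, L e_{a-1}` in its span. -/
def dualVec (L : E a →L[ℝ] E b) (i : Fin a) : E b :=
  ContinuousLinearMap.adjoint (leftInv L) (bvec i)

lemma inner_dualVec (L : E a →L[ℝ] E b) (i : Fin a) (v : E b) :
    ⟪dualVec L i, v⟫_ℝ = leftInv L v i := by
  rw [dualVec, ContinuousLinearMap.adjoint_inner_left, inner_single_one_left]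

lemma inner_dualVec_apply {L : E a →L[ℝ] E b} (hL : Function.Injective L) (i j : Fin a) :
    ⟪dualVec L i, L (bvec j)⟫_ℝ = if i = j then 1 else 0 := by
  rw [inner_dualVec, leftInv_apply_self hL]
  simp [bvec]

lemma inner_dualVec_normal {L : E a →L[ℝ] E b} {N : E b} (hNL : ∀ v, ⟪N, L v⟫_ℝ = 0)
    (i : Fin a) : ⟪dualVec L i, N⟫_ℝ = 0 := by
  rw [inner_dualVec, leftInv_eq_zero_of_orthogonal hNL]; rfl

lemma leftInv_eq_sum (L : E a →L[ℝ] E b) (v : E b) :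
    leftInv L v = ∑ i, ⟪dualVec L i, v⟫_ℝ • (bvec i : E a) := by
  simp_rw [inner_dualVec, sum_coord_smul_bvec]

/-- The dual frame and the unit normal span the whole space because the range of `L` is a
hyperplane. -/
lemma sum_inner_smul_dualVec {n : ℕ} {L : E n →L[ℝ] E (n + 1)} (hL : Function.Injective L)
    {N : E (n + 1)} (hN : ‖N‖ = 1) (hNL : ∀ v, ⟪N, L v⟫_ℝ = 0) (w : E (n + 1)) :
    w = ∑ k, ⟪w, L (bvec k)⟫_ℝ • dualVec L k + ⟪w, N⟫_ℝ • N := by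
  refine ext_inner_right ℝ fun v => ?_
  rw [inner_add_left, sum_inner, inner_smul_left]
  simp only [inner_smul_left, inner_dualVec, RCLike.conj_to_real]
  have h1 : ∑ k, ⟪w, L (bvec k)⟫_ℝ * leftInv L v k = ⟪w, L (leftInv L v)⟫_ℝ := by
    conv_rhs => rw [← sum_coord_smul_bvec (leftInv L v)]
    simp only [map_sum, map_smul, inner_sum, inner_smul_right]
    exact Finset.sum_congr rfl fun k _ => mul_comm _ _
  rw [h1, apply_leftInv hL hN hNL, inner_sub_right, inner_smul_right]
  ring

/-- Raising the index: the inner products of the dual vectors are the coefficients `gⁱᵏ` of the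
inverse metric. -/
lemma sum_inner_dualVec_smul {L : E a →L[ℝ] E b} (hL : Function.Injective L) (i : Fin a) :
    dualVec L i = ∑ k, ⟪dualVec L i, dualVec L k⟫_ℝ • L (bvec k) := by
  have h1 : L (leftInv L (dualVec L i)) = dualVec L i := by
    refine ext_inner_right ℝ fun v => ?_
    rw [inner_apply_leftInv_comm hL, inner_dualVec, inner_dualVec, leftInv_apply_self hL]
  conv_lhs => rw [← h1, leftInv_eq_sum]
  simp only [map_sum, map_smul]
  exact Finset.sum_congr rfl fun k _ => by rw [real_inner_comm]

/-- The Gram matrix of `L`. -/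
def gramMatrix (L : E a →L[ℝ] E b) : Matrix (Fin a) (Fin a) ℝ :=
  Matrix.of fun i j => ⟪L (bvec i), L (bvec j)⟫_ℝ

lemma dualGram_mul_gram {L : E a →L[ℝ] E b} (hL : Function.Injective L) :
    (Matrix.of fun i j => ⟪dualVec L i, dualVec L j⟫_ℝ) * gramMatrix L = 1 := by
  ext i j
  rw [Matrix.mul_apply, Matrix.one_apply, ← inner_dualVec_apply hL i j]
  conv_rhs => rw [sum_inner_dualVec_smul hL i]
  simp [sum_inner, inner_smul_left, gramMatrix]

lemma jacobian_eq_sqrt_det {V W ι : Type*} [NormedAddCommGroup V] [InnerProductSpace ℝ V]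
    [FiniteDimensional ℝ V] [NormedAddCommGroup W] [InnerProductSpace ℝ W] [FiniteDimensional ℝ W]
    [Fintype ι] [DecidableEq ι] (L : V →L[ℝ] W) (e : OrthonormalBasis ι ℝ V) :
    jacobian L = Real.sqrt (Matrix.det (Matrix.of fun i j => ⟪L (e i), L (e j)⟫_ℝ)) := by
  have := FiniteDimensional.complete ℝ V
  have := FiniteDimensional.complete ℝ W
  unfold jacobian
  congr 1
  rw [ContinuousLinearMap.det, ← LinearMap.det_toMatrix e.toBasis]
  congr 1
  ext i j
  rw [LinearMap.toMatrix_apply, OrthonormalBasis.coe_toBasis_repr_apply,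
    OrthonormalBasis.repr_apply_apply, OrthonormalBasis.coe_toBasis]
  exact ContinuousLinearMap.adjoint_inner_right L (e i) (L (e j))

lemma jacobian_eq_sqrt_det_gramMatrix (L : E a →L[ℝ] E b) :
    jacobian L = Real.sqrt (gramMatrix L).det := by
  rw [jacobian_eq_sqrt_det L (EuclideanSpace.basisFun (Fin a) ℝ)]
  simp [gramMatrix]

lemma det_gramMatrix_nonneg (L : E a →L[ℝ] E b) : 0 ≤ (gramMatrix L).det := by
  have : (gramMatrix L).PosSemidef := by
    refine Matrix.PosSemidef.of_dotProduct_mulVec_nonneg ?_ fun x => ?_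
    · ext i j
      simp [gramMatrix, real_inner_comm]
    · have h1 : star x ⬝ᵥ (gramMatrix L).mulVec x
          = ⟪∑ i, x i • L (bvec i), ∑ i, x i • L (bvec i)⟫_ℝ := by
        simp only [dotProduct, Matrix.mulVec, gramMatrix, sum_inner, inner_sum, inner_smul_left,
          inner_smul_right, Finset.mul_sum]
        refine Finset.sum_congr rfl fun i _ => Finset.sum_congr rfl fun j _ => ?_
        simp only [real_inner_comm (L (bvec i)), Matrix.of_apply, Pi.star_apply, star_trivial,
          RCLike.conj_to_real]
        ring
      rw [h1]; exact real_inner_self_nonneg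
  exact this.det_nonneg

lemma det_gramMatrix_pos {L : E a →L[ℝ] E b} (hL : Function.Injective L) :
    0 < (gramMatrix L).det := by
  refine (det_gramMatrix_nonneg L).lt_of_ne' fun h => ?_
  have := congrArg Matrix.det (dualGram_mul_gram hL)
  rw [Matrix.det_mul, h, mul_zero, Matrix.det_one] at this
  exact zero_ne_one this

lemma jacobian_comp {V W : Type*} [NormedAddCommGroup V] [InnerProductSpace ℝ V]
    [FiniteDimensional ℝ V] [NormedAddCommGroup W] [InnerProductSpace ℝ W] [FiniteDimensional ℝ W]
    (L : V →L[ℝ] W) (T : V →L[ℝ] V) : jacobian (L ∘L T) = |T.det| * jacobian L := by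
  have := FiniteDimensional.complete ℝ V
  have := FiniteDimensional.complete ℝ W
  unfold jacobian
  rw [← Real.sqrt_sq_eq_abs, ← Real.sqrt_mul (sq_nonneg _)]
  congr 1
  have h1 : ContinuousLinearMap.adjoint (L ∘L T) ∘L (L ∘L T)
      = ContinuousLinearMap.adjoint T * ((ContinuousLinearMap.adjoint L ∘L L) * T) := by
    rw [ContinuousLinearMap.adjoint_comp]; rfl
  have h2 : (ContinuousLinearMap.adjoint T).det = T.det := by
    have e := stdOrthonormalBasis ℝ V
    rw [ContinuousLinearMap.det, ContinuousLinearMap.det, ← LinearMap.det_toMatrix e.toBasis,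
      ← LinearMap.det_toMatrix e.toBasis, ← Matrix.det_transpose]
    congr 1
    ext i j
    rw [Matrix.transpose_apply, LinearMap.toMatrix_apply, LinearMap.toMatrix_apply,
      OrthonormalBasis.coe_toBasis_repr_apply, OrthonormalBasis.coe_toBasis_repr_apply,
      OrthonormalBasis.repr_apply_apply, OrthonormalBasis.repr_apply_apply,
      OrthonormalBasis.coe_toBasis, real_inner_comm]
    exact ContinuousLinearMap.adjoint_inner_left T (e j) (e i)
  rw [h1, ContinuousLinearMap.det, ContinuousLinearMap.toLinearMap_mul, ContinuousLinearMap.toLinearMap_mul,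
    map_mul, map_mul]
  change (ContinuousLinearMap.adjoint T).det * ((ContinuousLinearMap.adjoint L ∘L L).det * T.det)
    = _
  rw [h2]; ring

lemma faceIncl_single {n : ℕ} [NeZero n] (i : {i : Fin n // i ≠ 0}) :
    faceIncl n (EuclideanSpace.single i 1) = bvec i.1 := by
  simp [faceIncl, ContinuousLinearMap.smulRight_apply,
    PiLp.single_apply]

/-- The area factor of the face `x₀ = 0`. -/
lemma jacobian_comp_faceIncl {n d : ℕ} [NeZero n] {L : E n →L[ℝ] E d}
    (hL : Function.Injective L) :
    jacobian (L ∘L faceIncl n) = jacobian L * ‖dualVec L 0‖ := by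
  classical
  rw [jacobian_eq_sqrt_det _ (EuclideanSpace.basisFun {i : Fin n // i ≠ 0} ℝ),
    jacobian_eq_sqrt_det_gramMatrix, norm_eq_sqrt_real_inner,
    ← Real.sqrt_mul (det_gramMatrix_nonneg L)]
  congr 1
  have hinv : (gramMatrix L)⁻¹ = Matrix.of fun i j => ⟪dualVec L i, dualVec L j⟫_ℝ :=
    Matrix.inv_eq_left_inv (dualGram_mul_gram hL)
  have hdet := (det_gramMatrix_pos hL).ne'
  -- The factor `‖dualVec L 0‖²` is `g⁰⁰`, and `det g · g⁰⁰` is the cofactor obtained by deleting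
  -- index `0`, which is the Gram determinant of the face.
  have h1 : (gramMatrix L).adjugate 0 0 = (gramMatrix L).det * ⟪dualVec L 0, dualVec L 0⟫_ℝ := by
    have h2 : (gramMatrix L)⁻¹ 0 0 = ⟪dualVec L 0, dualVec L 0⟫_ℝ := by rw [hinv]; rfl
    rw [← h2, Matrix.inv_def, Matrix.smul_apply, Ring.inverse_eq_inv', smul_eq_mul,
      mul_inv_cancel_left₀ hdet]
  rw [← h1, Matrix.adjugate_apply, Matrix.twoBlockTriangular_det _ (fun i : Fin n => i ≠ 0)]
  · have h3 : (Matrix.toSquareBlockProp ((gramMatrix L).updateRow 0 (Pi.single 0 1))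
        (fun i : Fin n => ¬ i ≠ 0)).det = 1 := by
      have h0 : ∀ i : {i : Fin n // ¬ i ≠ 0}, i.1 = 0 := fun i => not_not.1 i.2
      let _ : Unique {i : Fin n // ¬ i ≠ 0} :=
        ⟨⟨⟨0, by simp⟩⟩, fun i => Subtype.ext (h0 i)⟩
      rw [Matrix.det_unique, Matrix.toSquareBlockProp_def]
      simp [h0]
    rw [h3, mul_one]
    congr 1
    ext i j
    rw [Matrix.toSquareBlockProp_def]
    simp only [Matrix.of_apply, Matrix.updateRow_ne i.2]
    rw [EuclideanSpace.basisFun_apply, EuclideanSpace.basisFun_apply]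
    simp only [ContinuousLinearMap.comp_apply, faceIncl_single]
    rfl
  · intro i hi j hj
    rw [not_not.1 hi, Matrix.updateRow_self, Pi.single_eq_of_ne hj]

end LinearAlgebra

/-! ### Derivatives of the determinant, the Jacobian and the dual frame. -/

section Derivatives

variable {n d : ℕ} {F : Type*} [NormedAddCommGroup F] [NormedSpace ℝ F] {s : Set F} {x : F}

/-- The determinant as a continuous multilinear function of the rows. -/
def detMultilinear (n : ℕ) : ContinuousMultilinearMap ℝ (fun _ : Fin n => Fin n → ℝ) ℝ where
  toMultilinearMap := Matrix.detRowAlternating.toMultilinearMap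
  cont := Continuous.matrix_det (A := fun A : Fin n → Fin n → ℝ => Matrix.of A) continuous_id

/-- Jacobi's formula. -/
lemma hasFDerivWithinAt_det {A : F → Matrix (Fin n) (Fin n) ℝ}
    {A' : Fin n → Fin n → F →L[ℝ] ℝ}
    (hA : ∀ i j, HasFDerivWithinAt (fun y => A y i j) (A' i j) s x) :
    HasFDerivWithinAt (fun y => (A y).det)
      (∑ i, ∑ j, (A x).adjugate j i • A' i j) s x := by
  have h1 : HasFDerivWithinAt (fun y => (fun i j => A y i j : Fin n → Fin n → ℝ))
      (ContinuousLinearMap.pi fun i => ContinuousLinearMap.pi fun j => A' i j) s x :=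
    hasFDerivWithinAt_pi.2 fun i => hasFDerivWithinAt_pi.2 fun j => hA i j
  have h2 := ((detMultilinear n).hasFDerivAt (fun i j => A x i j)).comp_hasFDerivWithinAt x h1
  refine h2.congr_fderiv ?_
  ext v
  simp only [ContinuousLinearMap.comp_apply, ContinuousMultilinearMap.linearDeriv_apply,
    sum_apply, smul_apply, ContinuousLinearMap.pi_apply]
  refine Finset.sum_congr rfl fun i _ => ?_
  have h3 : detMultilinear n (Function.update (fun i j => A x i j) i fun j => A' i j v)
      = ((A x).updateRow i fun j => A' i j v).det := rfl
  have h4 : (A x).transpose.adjugate.mulVec (fun j => A' i j v) i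
      = ∑ j, (A x).adjugate j i * A' i j v := by
    rw [← Matrix.adjugate_transpose]
    simp [Matrix.mulVec, dotProduct]
  rw [← Matrix.cramer_transpose_apply, Matrix.cramer_eq_adjugate_mulVec] at h3
  simp only [smul_eq_mul]
  rw [← h4, ← h3]
  rfl

/-- The formula `∂√det g = ½ √det g gⁱʲ ∂gᵢⱼ`. The two terms of `∂gᵢⱼ` contribute equally, and their
sum is the trace of the derivative of the frame against the dual frame, that is, a trace of
Christoffel symbols. -/
lemma hasFDerivWithinAt_jacobian {L : F → E n →L[ℝ] E d} {L' : F →L[ℝ] E n →L[ℝ] E d}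
    (hL : HasFDerivWithinAt L L' s x) (hinj : Function.Injective (L x)) (v : F) :
    ∃ J' : F →L[ℝ] ℝ, HasFDerivWithinAt (fun y => jacobian (L y)) J' s x ∧
      J' v = jacobian (L x) * ∑ k, ⟪dualVec (L x) k, L' v (bvec k)⟫_ℝ := by
  have hLb : ∀ i, HasFDerivWithinAt (fun y => L y (bvec i))
      ((ContinuousLinearMap.apply ℝ (E d) (bvec i : E n)) ∘L L') s x := fun i =>
    (ContinuousLinearMap.apply ℝ (E d) (bvec i : E n)).hasFDerivAt.comp_hasFDerivWithinAt x hL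
  have hG : ∀ i j, HasFDerivWithinAt (fun y => gramMatrix (L y) i j) _ s x := fun i j =>
    (hLb i).inner ℝ (hLb j)
  have hdet := hasFDerivWithinAt_det hG
  have hpos := det_gramMatrix_pos hinj
  have hJ := hdet.sqrt hpos.ne'
  simp_rw [jacobian_eq_sqrt_det_gramMatrix]
  refine ⟨_, hJ, ?_⟩
  have hinv : (gramMatrix (L x))⁻¹ = Matrix.of fun i j => ⟪dualVec (L x) i, dualVec (L x) j⟫_ℝ :=
    Matrix.inv_eq_left_inv (dualGram_mul_gram hinj)
  have hadj : ∀ i j, (gramMatrix (L x)).adjugate i j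
      = (gramMatrix (L x)).det * ⟪dualVec (L x) i, dualVec (L x) j⟫_ℝ := fun i j => by
    have h2 : (gramMatrix (L x))⁻¹ i j = ⟪dualVec (L x) i, dualVec (L x) j⟫_ℝ := by rw [hinv]; rfl
    rw [← h2, Matrix.inv_def, Matrix.smul_apply, Ring.inverse_eq_inv', smul_eq_mul,
      mul_inv_cancel_left₀ hpos.ne']
  have hk : ∀ i, ⟪dualVec (L x) i, L' v (bvec i)⟫_ℝ
      = ∑ j, ⟪dualVec (L x) i, dualVec (L x) j⟫_ℝ * ⟪L x (bvec j), L' v (bvec i)⟫_ℝ := fun i => by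
    conv_lhs => rw [sum_inner_dualVec_smul hinj i]
    simp [sum_inner, inner_smul_left]
  have hsum : ∑ i, ∑ j, (gramMatrix (L x)).adjugate j i
      * (⟪L x (bvec i), L' v (bvec j)⟫_ℝ + ⟪L' v (bvec i), L x (bvec j)⟫_ℝ)
      = 2 * ((gramMatrix (L x)).det * ∑ k, ⟪dualVec (L x) k, L' v (bvec k)⟫_ℝ) := by
    have e1 : ∑ i, ∑ j, (gramMatrix (L x)).adjugate j i * ⟪L x (bvec i), L' v (bvec j)⟫_ℝ
        = (gramMatrix (L x)).det * ∑ k, ⟪dualVec (L x) k, L' v (bvec k)⟫_ℝ := by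
      rw [Finset.sum_comm, Finset.mul_sum]
      refine Finset.sum_congr rfl fun j _ => ?_
      rw [hk, Finset.mul_sum]
      refine Finset.sum_congr rfl fun i _ => ?_
      rw [hadj]; ring
    have e2 : ∑ i, ∑ j, (gramMatrix (L x)).adjugate j i * ⟪L' v (bvec i), L x (bvec j)⟫_ℝ
        = (gramMatrix (L x)).det * ∑ k, ⟪dualVec (L x) k, L' v (bvec k)⟫_ℝ := by
      rw [Finset.mul_sum]
      refine Finset.sum_congr rfl fun i _ => ?_
      rw [hk, Finset.mul_sum]
      refine Finset.sum_congr rfl fun j _ => ?_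
      rw [hadj, real_inner_comm (dualVec (L x) i), real_inner_comm (L x (bvec j))]; ring
    simp_rw [mul_add, Finset.sum_add_distrib]
    rw [e1, e2]; ring
  have hs : Real.sqrt (gramMatrix (L x)).det ≠ 0 := (Real.sqrt_pos.2 hpos).ne'
  have key : (∑ i, ∑ j, (gramMatrix (L x)).adjugate j i •
      ((fderivInnerCLM ℝ (L x (bvec i), L x (bvec j))).comp
        (((ContinuousLinearMap.apply ℝ (E d) (bvec i : E n)) ∘L L').prod
          ((ContinuousLinearMap.apply ℝ (E d) (bvec j : E n)) ∘L L')))) v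
      = 2 * ((gramMatrix (L x)).det * ∑ k, ⟪dualVec (L x) k, L' v (bvec k)⟫_ℝ) := by
    rw [← hsum]
    simp only [sum_apply, smul_apply, smul_eq_mul,
      ContinuousLinearMap.comp_apply, ContinuousLinearMap.prod_apply, fderivInnerCLM_apply,
      ContinuousLinearMap.apply_apply]
  rw [smul_apply, key, smul_eq_mul]
  field_simp
  rw [Real.sq_sqrt hpos.le]

lemma contDiffWithinAt_jacobian {m : WithTop ℕ∞} {L : F → E n →L[ℝ] E d}
    (hL : ContDiffWithinAt ℝ m L s x) (hinj : Function.Injective (L x)) :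
    ContDiffWithinAt ℝ m (fun y => jacobian (L y)) s x := by
  simp_rw [jacobian_eq_sqrt_det_gramMatrix]
  have hLb : ∀ i, ContDiffWithinAt ℝ m (fun y => L y (bvec i)) s x := fun i =>
    hL.clm_apply contDiffWithinAt_const
  have h1 : ContDiffWithinAt ℝ m
      (fun y => (fun i j => gramMatrix (L y) i j : Fin n → Fin n → ℝ)) s x :=
    contDiffWithinAt_pi.2 fun i => contDiffWithinAt_pi.2 fun j => (hLb i).inner ℝ (hLb j)
  have h2 := (detMultilinear n).contDiff.contDiffAt.comp_contDiffWithinAt x h1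
  exact h2.sqrt (det_gramMatrix_pos hinj).ne'

/-- Inversion of operators is smooth near the invertible operator `LᵀL`, so nothing is lost in the
order of differentiability. -/
lemma contDiffWithinAt_leftInv {m : WithTop ℕ∞} {L : F → E n →L[ℝ] E d}
    (hL : ContDiffWithinAt ℝ m L s x) (hinj : Function.Injective (L x)) :
    ContDiffWithinAt ℝ m (fun y => leftInv (L y)) s x := by
  have hadj : ContDiffWithinAt ℝ m (fun y => ContinuousLinearMap.adjoint (L y)) s x := by
    have h : ContDiff ℝ m (fun T : E n →L[ℝ] E d => ContinuousLinearMap.adjoint T) :=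
      (ContinuousLinearMap.adjoint (𝕜 := ℝ) (E := E n) (F := E d)).toContinuousLinearEquiv
        |>.contDiff
    exact h.contDiffAt.comp_contDiffWithinAt x hL
  have h1 := hadj.clm_comp hL
  have h2 := (isInvertible_gram hinj).contDiffAt_map_inverse (n := m)
    |>.comp_contDiffWithinAt x h1
  exact h2.clm_comp hadj

lemma contDiffWithinAt_dualVec {m : WithTop ℕ∞} {L : F → E n →L[ℝ] E d}
    (hL : ContDiffWithinAt ℝ m L s x) (hinj : Function.Injective (L x)) (i : Fin n) :
    ContDiffWithinAt ℝ m (fun y => dualVec (L y) i) s x := by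
  have h : ContDiff ℝ m (fun T : E d →L[ℝ] E n => ContinuousLinearMap.adjoint T) :=
    (ContinuousLinearMap.adjoint (𝕜 := ℝ) (E := E d) (F := E n)).toContinuousLinearEquiv
      |>.contDiff
  exact (h.contDiffAt.comp_contDiffWithinAt x (contDiffWithinAt_leftInv hL hinj)).clm_apply
    contDiffWithinAt_const

end Derivatives

/-! ### The divergence theorem on the model half-space. -/

section HalfSpace

variable {n : ℕ} [NeZero n]

/-- The model half-space `x₀ ≥ 0`. -/
def modelHalf (n : ℕ) [NeZero n] : Set (E n) := {x | 0 ≤ x 0}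

lemma mem_modelHalf {x : E n} : x ∈ modelHalf n ↔ 0 ≤ x 0 := Iff.rfl

lemma range_model_eq : range (𝓡∂ n) = modelHalf n := range_modelWithCornersEuclideanHalfSpace n

lemma isClosed_modelHalf : IsClosed (modelHalf n) := by
  rw [← range_model_eq]; exact (𝓡∂ n).isClosed_range

lemma uniqueDiffOn_modelHalf : UniqueDiffOn ℝ (modelHalf n) := by
  rw [← range_model_eq]; exact (𝓡∂ n).uniqueDiffOn

lemma measurableSet_modelHalf : MeasurableSet (modelHalf n) := isClosed_modelHalf.measurableSet

lemma convex_modelHalf : Convex ℝ (modelHalf n) := by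
  rw [← range_model_eq]
  exact (𝓡∂ n).convex_range

lemma faceIncl_apply (y : EuclideanSpace ℝ {i : Fin n // i ≠ 0}) (j : Fin n) :
    faceIncl n y j = if h : j ≠ 0 then y ⟨j, h⟩ else 0 := by
  have h1 : faceIncl n y j = ∑ i : {i : Fin n // i ≠ 0}, y i * (bvec i.1 : E n) j := by
    simp only [faceIncl, sum_apply, ContinuousLinearMap.smulRight_apply, WithLp.ofLp_sum,
      Finset.sum_apply, PiLp.smul_apply, smul_eq_mul]
    rfl
  rw [h1]
  simp only [bvec, PiLp.single_apply]
  split_ifs with h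
  · rw [Finset.sum_eq_single ⟨j, h⟩]
    · simp
    · intro b _ hb
      have : j ≠ b.1 := fun h' => hb (Subtype.ext h'.symm)
      simp [this]
    · simp
  · push Not at h
    refine Finset.sum_eq_zero fun b _ => ?_
    have : j ≠ b.1 := fun h' => b.2 (h'.symm.trans h)
    simp [this]

lemma faceIncl_zero_coord (y : EuclideanSpace ℝ {i : Fin n // i ≠ 0}) : faceIncl n y 0 = 0 := by
  simp [faceIncl_apply]

lemma faceIncl_mem (y : EuclideanSpace ℝ {i : Fin n // i ≠ 0}) : faceIncl n y ∈ modelHalf n :=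
  (faceIncl_zero_coord y).ge

lemma norm_faceIncl (y : EuclideanSpace ℝ {i : Fin n // i ≠ 0}) : ‖faceIncl n y‖ = ‖y‖ := by
  rw [EuclideanSpace.norm_eq, EuclideanSpace.norm_eq]
  congr 1
  rw [← Fintype.sum_subtype_add_sum_subtype (p := fun i : Fin n => i ≠ 0)
    (fun i => ‖faceIncl n y i‖ ^ 2)]
  have h2 : ∑ x : {x : Fin n // ¬ x ≠ 0}, ‖faceIncl n y x.1‖ ^ 2 = 0 :=
    Finset.sum_eq_zero fun x _ => by
      have : x.1 = 0 := not_not.1 x.2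
      rw [this, faceIncl_zero_coord]; simp
  rw [h2, add_zero]
  exact Finset.sum_congr rfl fun i _ => by rw [faceIncl_apply, dif_pos i.2]

lemma isClosedEmbedding_faceIncl : Topology.IsClosedEmbedding (faceIncl n) :=
  (AddMonoidHomClass.isometry_of_norm (faceIncl n) norm_faceIncl).isClosedEmbedding

/-- Fubini's theorem in the coordinate of index `0`. -/
lemma integral_eq_integral_face_line (f : E n → ℝ) (hf : Integrable f) :
    ∫ x, f x = ∫ y : EuclideanSpace ℝ {i : Fin n // i ≠ 0},
      ∫ r : ℝ, f (r • bvec 0 + faceIncl n y) := by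
  let _ : Unique {i : Fin n // ¬ i ≠ 0} :=
    ⟨⟨⟨0, by simp⟩⟩, fun i => Subtype.ext (not_not.1 i.2)⟩
  have e1 := EuclideanSpace.volume_preserving_symm_measurableEquiv_toLp (Fin n)
  have e2 := volume_preserving_piEquivPiSubtypeProd (fun _ : Fin n => ℝ) (fun i : Fin n => i ≠ 0)
  have e3 : MeasurePreserving (MeasurableEquiv.funUnique {i : Fin n // ¬ i ≠ 0} ℝ) :=
    by convert volume_preserving_funUnique {i : Fin n // ¬ i ≠ 0} ℝ <;> rfl
  have e4 := EuclideanSpace.volume_preserving_symm_measurableEquiv_toLp {i : Fin n // i ≠ 0}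
  let G : EuclideanSpace ℝ {i : Fin n // i ≠ 0} × ℝ ≃ᵐ E n :=
    (((MeasurableEquiv.toLp 2 (Fin n → ℝ)).symm.trans
      (MeasurableEquiv.piEquivPiSubtypeProd (fun _ : Fin n => ℝ) (fun i : Fin n => i ≠ 0))).trans
        ((MeasurableEquiv.toLp 2 ({i : Fin n // i ≠ 0} → ℝ)).prodCongr
          (MeasurableEquiv.funUnique {i : Fin n // ¬ i ≠ 0} ℝ))).symm
  have hG : MeasurePreserving G := by
    refine MeasurePreserving.symm _ ?_
    refine ((e4.symm _).prod e3).comp ?_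
    exact e2.comp e1
  have hGapp : ∀ y r, G (y, r) = r • bvec 0 + faceIncl n y := fun y r => by
    rw [MeasurableEquiv.symm_apply_eq]
    ext i
    · have hi : i.1 ≠ 0 := i.2
      simp [MeasurableEquiv.piEquivPiSubtypeProd, Equiv.piEquivPiSubtypeProd, faceIncl_apply,
        MeasurableEquiv.prodCongr, hi, bvec]
    · have hdef : (default : {i : Fin n // ¬ i ≠ 0}).1 = 0 := rfl
      simp [MeasurableEquiv.piEquivPiSubtypeProd, Equiv.piEquivPiSubtypeProd, faceIncl_apply,
        MeasurableEquiv.prodCongr, bvec, MeasurableEquiv.funUnique, hdef]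
  have hf' : Integrable (fun z => f (G z)) (volume.prod volume) :=
    (hG.integrable_comp_emb G.measurableEmbedding).2 hf
  rw [← hG.integral_comp G.measurableEmbedding f]
  rw [Measure.volume_eq_prod, integral_prod _ hf']
  simp_rw [hGapp]

/-- A function that is continuous on the half-space and vanishes off a compact set. -/
lemma integrableOn_of_continuousOn {g : E n → ℝ} {K : Set (E n)} (hK : IsCompact K)
    (hg : ContinuousOn g (modelHalf n)) (h0 : ∀ x ∉ K, g x = 0) :
    IntegrableOn g (modelHalf n) := by
  have h1 : IntegrableOn g (K ∩ modelHalf n) :=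
    (hg.mono inter_subset_right).integrableOn_compact (hK.inter_right isClosed_modelHalf)
  have h2 : IntegrableOn g (modelHalf n \ K) :=
    IntegrableOn.congr_fun integrableOn_zero (fun x hx => (h0 x hx.2).symm)
      (measurableSet_modelHalf.diff hK.measurableSet)
  exact (h1.union h2).mono_set fun x hx => by
    by_cases hxK : x ∈ K
    · exact Or.inl ⟨hxK, hx⟩
    · exact Or.inr ⟨hx, hxK⟩

lemma fderivWithin_eq_zero_of_notMem {F : Type*} [NormedAddCommGroup F] [NormedSpace ℝ F]
    {z : E n → F} {K : Set (E n)} (hK : IsClosed K) (h0 : ∀ x ∉ K, z x = 0)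
    {x : E n} (hx : x ∉ K) : fderivWithin ℝ z (modelHalf n) x = 0 := by
  have h1 : z =ᶠ[𝓝[modelHalf n] x] fun _ => 0 :=
    Filter.mem_of_superset (mem_nhdsWithin_of_mem_nhds (hK.isOpen_compl.mem_nhds hx)) h0
  rw [h1.fderivWithin_eq (h0 x hx), fderivWithin_fun_const]
  rfl

lemma continuousOn_fderivWithin_apply {F : Type*} [NormedAddCommGroup F] [NormedSpace ℝ F]
    {z : E n → F} (hz : ContDiffOn ℝ 1 z (modelHalf n)) (v : E n) :
    ContinuousOn (fun x => fderivWithin ℝ z (modelHalf n) x v) (modelHalf n) :=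
  (hz.continuousOn_fderivWithin uniqueDiffOn_modelHalf le_rfl).clm_apply continuousOn_const

/-- The divergence theorem in the normal direction. -/
lemma integral_fderivWithin_normal {z : E n → ℝ} {K : Set (E n)} (hK : IsCompact K)
    (hz : ContDiffOn ℝ 1 z (modelHalf n)) (h0 : ∀ x ∉ K, z x = 0) :
    ∫ x in modelHalf n, fderivWithin ℝ z (modelHalf n) x (bvec 0)
      = -∫ y, z (faceIncl n y) := by
  have hint := integrableOn_of_continuousOn hK (continuousOn_fderivWithin_apply hz (bvec 0))
    (fun x hx => by rw [fderivWithin_eq_zero_of_notMem hK.isClosed h0 hx]; rfl)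
  rw [← integral_indicator measurableSet_modelHalf,
    integral_eq_integral_face_line _ (hint.integrable_indicator measurableSet_modelHalf),
    ← integral_neg]
  congr 1
  ext y
  have hcoord : ∀ r : ℝ, (r • bvec 0 + faceIncl n y : E n) 0 = r := fun r => by
    simp [faceIncl_zero_coord, bvec]
  have hmem : ∀ r : ℝ, (r • bvec 0 + faceIncl n y) ∈ modelHalf n ↔ r ∈ Ici (0 : ℝ) := fun r => by
    rw [mem_modelHalf, hcoord, mem_Ici]
  have hind : ∀ r : ℝ, (modelHalf n).indicator
      (fun x => fderivWithin ℝ z (modelHalf n) x (bvec 0)) (r • bvec 0 + faceIncl n y)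
      = (Ici (0 : ℝ)).indicator (fun r => fderivWithin ℝ z (modelHalf n)
          (r • bvec 0 + faceIncl n y) (bvec 0)) r := fun r => by
    by_cases hr : r ∈ Ici (0 : ℝ)
    · rw [indicator_of_mem hr, indicator_of_mem ((hmem r).2 hr)]
    · rw [indicator_of_notMem hr, indicator_of_notMem fun h => hr ((hmem r).1 h)]
  simp_rw [hind]
  rw [integral_indicator measurableSet_Ici, integral_Ici_eq_integral_Ioi]
  have hline : Continuous fun r : ℝ => (r • bvec 0 + faceIncl n y : E n) := by fun_prop
  have hcontz : ContinuousOn (fun r : ℝ => z (r • bvec 0 + faceIncl n y)) (Ici 0) :=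
    hz.continuousOn.comp hline.continuousOn fun r hr => (hmem r).2 hr
  obtain ⟨R, hR⟩ : ∃ R : ℝ, ∀ r : ℝ, R < r → (r • bvec 0 + faceIncl n y : E n) ∉ K := by
    obtain ⟨R, hR⟩ := hK.isBounded.exists_norm_le
    refine ⟨R, fun r hr hmemK => ?_⟩
    have h2 : |r| ≤ ‖(r • bvec 0 + faceIncl n y : E n)‖ := by
      have := PiLp.norm_apply_le (r • bvec 0 + faceIncl n y : E n) 0
      rwa [hcoord] at this
    have h3 := hR _ hmemK
    have := le_abs_self r
    linarith
  have htend : Filter.Tendsto (fun r : ℝ => z (r • bvec 0 + faceIncl n y)) Filter.atTop (𝓝 0) := by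
    refine tendsto_const_nhds.congr' ?_
    filter_upwards [Filter.eventually_gt_atTop R] with r hr
    rw [h0 _ (hR r hr)]
  -- For `r > 0` the point lies in the interior of the half-space, so the derivative within the
  -- half-space is a genuine derivative.
  have hderiv : ∀ r ∈ Ioi (0 : ℝ), HasDerivAt (fun r : ℝ => z (r • bvec 0 + faceIncl n y))
      (fderivWithin ℝ z (modelHalf n) (r • bvec 0 + faceIncl n y) (bvec 0)) r := by
    intro r hr
    have hnhds : modelHalf n ∈ 𝓝 (r • bvec 0 + faceIncl n y : E n) := by
      have ho : IsOpen {x : E n | 0 < x 0} :=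
        isOpen_lt continuous_const (EuclideanSpace.proj (0 : Fin n)).continuous
      refine Filter.mem_of_superset (ho.mem_nhds ?_) fun x hx => mem_modelHalf.2 (le_of_lt hx)
      change 0 < (r • bvec 0 + faceIncl n y : E n) 0
      rw [hcoord]; exact hr
    have hd := (hz.differentiableOn one_ne_zero _
      ((hmem r).2 (mem_Ici.2 (le_of_lt hr)))).hasFDerivWithinAt.hasFDerivAt hnhds
    have hl : HasDerivAt (fun r : ℝ => (r • bvec 0 + faceIncl n y : E n)) (bvec 0) r := by
      simpa using ((hasDerivAt_id r).smul_const (bvec 0 : E n)).add_const (faceIncl n y)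
    exact hd.comp_hasDerivAt r hl
  have hintr : IntegrableOn (fun r : ℝ => fderivWithin ℝ z (modelHalf n)
      (r • bvec 0 + faceIncl n y) (bvec 0)) (Ioi 0) := by
    have hc : ContinuousOn (fun r : ℝ => fderivWithin ℝ z (modelHalf n)
      (r • bvec 0 + faceIncl n y) (bvec 0)) (Ici 0) :=
      (continuousOn_fderivWithin_apply hz (bvec 0)).comp hline.continuousOn
        fun r hr => (hmem r).2 hr
    have h1 : IntegrableOn (fun r : ℝ => fderivWithin ℝ z (modelHalf n)
      (r • bvec 0 + faceIncl n y) (bvec 0)) (Icc 0 R) :=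
      (hc.mono Icc_subset_Ici_self).integrableOn_compact isCompact_Icc
    have h2 : IntegrableOn (fun r : ℝ => fderivWithin ℝ z (modelHalf n)
      (r • bvec 0 + faceIncl n y) (bvec 0)) (Ioi R) :=
      IntegrableOn.congr_fun integrableOn_zero (fun r hr => by
        rw [fderivWithin_eq_zero_of_notMem hK.isClosed h0 (hR r hr)]; rfl) measurableSet_Ioi
    refine (h1.union h2).mono_set fun r hr => ?_
    rcases le_or_gt r R with h | h
    · exact Or.inl ⟨le_of_lt hr, h⟩
    · exact Or.inr h
  have := integral_Ioi_of_hasDerivAt_of_tendsto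
    (hcontz 0 self_mem_Ici) hderiv hintr htend
  rw [this]; simp

end HalfSpace

/-! ### Difference quotients and the weak symmetry of second derivatives. -/

section HalfSpaceParts

variable {n : ℕ} [NeZero n]

/-- The difference quotient in the coordinate direction of index `i`. -/
def diffQuot (i : Fin n) (h : ℝ) (f : E n → ℝ) (x : E n) : ℝ :=
  h⁻¹ * (f (x + h • bvec i) - f x)

lemma add_smul_bvec_mem_iff {i : Fin n} (hi : i ≠ 0) (h : ℝ) (x : E n) :
    x + h • bvec i ∈ modelHalf n ↔ x ∈ modelHalf n := by
  rw [mem_modelHalf, mem_modelHalf]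
  simp [bvec, hi.symm]

lemma setIntegral_translate {i : Fin n} (hi : i ≠ 0) (h : ℝ) (f : E n → ℝ) :
    ∫ x in modelHalf n, f (x + h • bvec i) = ∫ x in modelHalf n, f x := by
  rw [← integral_indicator measurableSet_modelHalf, ← integral_indicator measurableSet_modelHalf,
    ← integral_add_right_eq_self ((modelHalf n).indicator f) (h • bvec i)]
  congr 1
  ext x
  by_cases hx : x ∈ modelHalf n
  · rw [indicator_of_mem hx, indicator_of_mem ((add_smul_bvec_mem_iff hi h x).2 hx)]
  · rw [indicator_of_notMem hx,
      indicator_of_notMem fun h' => hx ((add_smul_bvec_mem_iff hi h x).1 h')]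

lemma exists_norm_fderivWithin_le {f : E n → ℝ} {K : Set (E n)} (hK : IsCompact K)
    (hf : ContDiffOn ℝ 1 f (modelHalf n)) (h0 : ∀ x ∉ K, f x = 0) :
    ∃ C : ℝ, 0 ≤ C ∧ ∀ x ∈ modelHalf n, ‖fderivWithin ℝ f (modelHalf n) x‖ ≤ C := by
  obtain ⟨C, hC⟩ := (hK.inter_right isClosed_modelHalf).exists_bound_of_continuousOn
    ((hf.continuousOn_fderivWithin uniqueDiffOn_modelHalf le_rfl).mono inter_subset_right)
  refine ⟨max C 0, le_max_right _ _, fun x hx => ?_⟩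
  by_cases hxK : x ∈ K
  · exact (hC x ⟨hxK, hx⟩).trans (le_max_left _ _)
  · rw [fderivWithin_eq_zero_of_notMem hK.isClosed h0 hxK, norm_zero]
    exact le_max_right _ _

/-- The mean value inequality on the convex half-space gives a bound that is uniform in `h`; it
supplies the dominating functions below. Tangential translations keep the segment inside the
half-space. -/
lemma exists_abs_diffQuot_le {f : E n → ℝ} {K : Set (E n)} (hK : IsCompact K)
    (hf : ContDiffOn ℝ 1 f (modelHalf n)) (h0 : ∀ x ∉ K, f x = 0) {i : Fin n} (hi : i ≠ 0) :
    ∃ C : ℝ, 0 ≤ C ∧ ∀ h : ℝ, ∀ x ∈ modelHalf n, |diffQuot i h f x| ≤ C := by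
  obtain ⟨C, hC0, hC⟩ := exists_norm_fderivWithin_le hK hf h0
  refine ⟨C, hC0, fun h x hx => ?_⟩
  rcases eq_or_ne h 0 with rfl | hh
  · simpa [diffQuot] using hC0
  have h1 := convex_modelHalf.norm_image_sub_le_of_norm_fderivWithin_le
    (hf.differentiableOn one_ne_zero) hC hx ((add_smul_bvec_mem_iff hi h x).2 hx)
  have h2 : ‖x + h • bvec i - x‖ = |h| := by simp [bvec, norm_smul]
  rw [h2, Real.norm_eq_abs] at h1
  rw [diffQuot, abs_mul, abs_inv, inv_mul_le_iff₀ (abs_pos.2 hh), mul_comm]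
  exact h1

lemma tendsto_diffQuot {f : E n → ℝ} (hf : ContDiffOn ℝ 1 f (modelHalf n)) {i : Fin n}
    (hi : i ≠ 0) {x : E n} (hx : x ∈ modelHalf n) :
    Filter.Tendsto (fun h => diffQuot i h f x) (𝓝[≠] 0)
      (𝓝 (fderivWithin ℝ f (modelHalf n) x (bvec i))) := by
  have hd := (hf.differentiableOn one_ne_zero x hx).hasFDerivWithinAt
  have hl : HasDerivWithinAt (fun h : ℝ => x + h • (bvec i : E n)) (bvec i) univ 0 := by
    have := ((hasDerivAt_id (0 : ℝ)).smul_const (bvec i : E n)).const_add x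
    rw [one_smul] at this
    exact this.hasDerivWithinAt
  have hd' : HasFDerivWithinAt f (fderivWithin ℝ f (modelHalf n) x) (modelHalf n)
      (x + (0 : ℝ) • bvec i) := by simpa using hd
  have h1 := hd'.comp_hasDerivWithinAt (0 : ℝ) hl
    (fun h _ => (add_smul_bvec_mem_iff hi h x).2 hx)
  rw [hasDerivWithinAt_univ, hasDerivAt_iff_tendsto_slope_zero] at h1
  refine h1.congr fun h => ?_
  simp [diffQuot]

lemma continuousOn_diffQuot {f : E n → ℝ} (hf : ContinuousOn f (modelHalf n)) {i : Fin n}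
    (hi : i ≠ 0) (h : ℝ) : ContinuousOn (diffQuot i h f) (modelHalf n) := by
  refine continuousOn_const.mul (ContinuousOn.sub ?_ hf)
  exact hf.comp (by fun_prop) fun x hx => (add_smul_bvec_mem_iff hi h x).2 hx

omit [NeZero n] in
lemma diffQuot_eq_zero {f : E n → ℝ} {R : ℝ} (h0 : ∀ x, R < ‖x‖ → f x = 0) {i : Fin n}
    {h : ℝ} (hh : |h| ≤ 1) {x : E n} (hx : R + 1 < ‖x‖) : diffQuot i h f x = 0 := by
  have h1 : R < ‖x + h • bvec i‖ := by
    have h2 : ‖h • (bvec i : E n)‖ = |h| := by simp [bvec, norm_smul]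
    have h3 := norm_sub_le (x + h • bvec i) (h • bvec i : E n)
    rw [add_sub_cancel_right, h2] at h3
    linarith
  rw [diffQuot, h0 _ h1, h0 x (by linarith), sub_self, mul_zero]

/-- The divergence theorem in a tangential direction. -/
lemma integral_fderivWithin_tangential {z : E n → ℝ} {K : Set (E n)} (hK : IsCompact K)
    (hz : ContDiffOn ℝ 1 z (modelHalf n)) (h0 : ∀ x ∉ K, z x = 0) {i : Fin n} (hi : i ≠ 0) :
    ∫ x in modelHalf n, fderivWithin ℝ z (modelHalf n) x (bvec i) = 0 := by
  obtain ⟨R, hR⟩ := hK.isBounded.exists_norm_le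
  have hR0 : ∀ x, R < ‖x‖ → z x = 0 := fun x hx => h0 x fun hxK => absurd (hR x hxK) (not_le.2 hx)
  obtain ⟨C, hC0, hC⟩ := exists_abs_diffQuot_le hK hz h0 hi
  -- A tangential translation preserves the integral over the half-space, so every difference
  -- quotient has integral zero, and the derivative inherits this by dominated convergence.
  have hlim : Filter.Tendsto (fun h => ∫ x in modelHalf n, diffQuot i h z x) (𝓝[≠] 0)
      (𝓝 (∫ x in modelHalf n, fderivWithin ℝ z (modelHalf n) x (bvec i))) := by
    refine tendsto_integral_filter_of_dominated_convergence
      ((Metric.closedBall 0 (R + 1)).indicator fun _ => C) ?_ ?_ ?_ ?_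
    · exact Filter.Eventually.of_forall fun h =>
        (continuousOn_diffQuot hz.continuousOn hi h).aestronglyMeasurable measurableSet_modelHalf
    · have : ∀ᶠ h : ℝ in 𝓝[≠] 0, |h| ≤ 1 := by
        refine mem_nhdsWithin_of_mem_nhds ?_
        filter_upwards [Metric.closedBall_mem_nhds (0 : ℝ) one_pos] with h hh
        simpa using hh
      filter_upwards [this] with h hh
      filter_upwards [ae_restrict_mem measurableSet_modelHalf] with x hx
      by_cases hxR : x ∈ Metric.closedBall (0 : E n) (R + 1)
      · rw [indicator_of_mem hxR]; exact hC h x hx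
      · rw [indicator_of_notMem hxR, diffQuot_eq_zero hR0 hh (by simpa using hxR), norm_zero]
    · refine Integrable.integrableOn (IntegrableOn.integrable_indicator ?_
        measurableSet_closedBall)
      exact integrableOn_const (isCompact_closedBall _ _).measure_lt_top.ne
    · filter_upwards [ae_restrict_mem measurableSet_modelHalf] with x hx
      exact tendsto_diffQuot hz hi hx
  refine tendsto_nhds_unique hlim (tendsto_const_nhds.congr fun h => ?_)
  have hint := integrableOn_of_continuousOn hK hz.continuousOn h0
  have hint' : IntegrableOn (fun x => z (x + h • bvec i)) (modelHalf n) := by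
    refine integrableOn_of_continuousOn (K := (fun x => x - h • bvec i) '' K)
      (hK.image (by fun_prop))
      (hz.continuousOn.comp (by fun_prop) fun x hx => (add_smul_bvec_mem_iff hi h x).2 hx)
      fun x hx => h0 _ fun hxK => hx ⟨_, hxK, by simp⟩
  simp only [diffQuot]
  rw [integral_const_mul, integral_sub hint' hint, setIntegral_translate hi, sub_self, mul_zero]

/-- The boundary term of the divergence theorem for the coordinate direction `j`. -/
def faceTerm (j : Fin n) (z : E n → ℝ) : ℝ := if j = 0 then -∫ y, z (faceIncl n y) else 0

lemma integral_fderivWithin_eq_faceTerm {z : E n → ℝ} {K : Set (E n)} (hK : IsCompact K)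
    (hz : ContDiffOn ℝ 1 z (modelHalf n)) (h0 : ∀ x ∉ K, z x = 0) (j : Fin n) :
    ∫ x in modelHalf n, fderivWithin ℝ z (modelHalf n) x (bvec j) = faceTerm j z := by
  unfold faceTerm
  split_ifs with hj
  · rw [hj]; exact integral_fderivWithin_normal hK hz h0
  · exact integral_fderivWithin_tangential hK hz h0 hj

lemma integral_mul_fderivWithin {f z : E n → ℝ} {K : Set (E n)} (hK : IsCompact K)
    (hf : ContDiffOn ℝ 1 f (modelHalf n)) (hz : ContDiffOn ℝ 1 z (modelHalf n))
    (h0 : ∀ x ∉ K, z x = 0) (j : Fin n) :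
    ∫ x in modelHalf n, f x * fderivWithin ℝ z (modelHalf n) x (bvec j)
      = -(∫ x in modelHalf n, fderivWithin ℝ f (modelHalf n) x (bvec j) * z x)
        + faceTerm j (fun x => f x * z x) := by
  have h1 := integral_fderivWithin_eq_faceTerm hK (hf.mul hz)
    (fun x hx => by rw [h0 x hx, mul_zero]) j
  have h2 : ∫ x in modelHalf n, fderivWithin ℝ (fun x => f x * z x) (modelHalf n) x (bvec j)
      = ∫ x in modelHalf n, (f x * fderivWithin ℝ z (modelHalf n) x (bvec j)
        + fderivWithin ℝ f (modelHalf n) x (bvec j) * z x) := by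
    refine setIntegral_congr_fun measurableSet_modelHalf fun x hx => ?_
    rw [fderivWithin_fun_mul (uniqueDiffOn_modelHalf x hx) (hf.differentiableOn one_ne_zero x hx)
      (hz.differentiableOn one_ne_zero x hx)]
    simp [mul_comm]
  rw [h2, integral_add] at h1
  · linarith
  · refine integrableOn_of_continuousOn hK
      (hf.continuousOn.mul (continuousOn_fderivWithin_apply hz _)) fun x hx => ?_
    rw [fderivWithin_eq_zero_of_notMem hK.isClosed h0 hx]; simp
  · exact integrableOn_of_continuousOn hK
      ((continuousOn_fderivWithin_apply hf _).mul hz.continuousOn)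
      fun x hx => by rw [h0 x hx, mul_zero]

lemma tendsto_integral_diffQuot_mul {f w : E n → ℝ} {K K' : Set (E n)} (hK : IsCompact K)
    (hf : ContDiffOn ℝ 1 f (modelHalf n)) (h0 : ∀ x ∉ K, f x = 0) (hK' : IsCompact K')
    (hw : ContinuousOn w (modelHalf n)) (hw0 : ∀ x ∉ K', w x = 0) {i : Fin n} (hi : i ≠ 0) :
    Filter.Tendsto (fun h => ∫ x in modelHalf n, diffQuot i h f x * w x) (𝓝[≠] 0)
      (𝓝 (∫ x in modelHalf n, fderivWithin ℝ f (modelHalf n) x (bvec i) * w x)) := by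
  obtain ⟨C, hC0, hC⟩ := exists_abs_diffQuot_le hK hf h0 hi
  refine tendsto_integral_filter_of_dominated_convergence (fun x => C * ‖w x‖) ?_ ?_ ?_ ?_
  · exact Filter.Eventually.of_forall fun h =>
      ((continuousOn_diffQuot hf.continuousOn hi h).mul hw).aestronglyMeasurable
        measurableSet_modelHalf
  · refine Filter.Eventually.of_forall fun h => ?_
    filter_upwards [ae_restrict_mem measurableSet_modelHalf] with x hx
    rw [norm_mul]
    exact mul_le_mul_of_nonneg_right (hC h x hx) (norm_nonneg _)
  · exact (integrableOn_of_continuousOn hK' hw hw0).norm.const_mul C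
  · filter_upwards [ae_restrict_mem measurableSet_modelHalf] with x hx
    exact (tendsto_diffQuot hf hi hx).mul_const _

lemma continuous_comp_faceIncl {w : E n → ℝ} (hw : ContinuousOn w (modelHalf n)) :
    Continuous fun y => w (faceIncl n y) :=
  hw.comp_continuous (faceIncl n).continuous faceIncl_mem

lemma integrable_comp_faceIncl {w : E n → ℝ} {K : Set (E n)} (hK : IsCompact K)
    (hw : ContinuousOn w (modelHalf n)) (h0 : ∀ x ∉ K, w x = 0) :
    Integrable fun y => w (faceIncl n y) := by
  refine (continuous_comp_faceIncl hw).integrable_of_hasCompactSupport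
    (HasCompactSupport.intro (isClosedEmbedding_faceIncl.isCompact_preimage hK) fun y hy => ?_)
  exact h0 _ hy

lemma tendsto_faceTerm_diffQuot_mul {f w : E n → ℝ} {K K' : Set (E n)} (hK : IsCompact K)
    (hf : ContDiffOn ℝ 1 f (modelHalf n)) (h0 : ∀ x ∉ K, f x = 0) (hK' : IsCompact K')
    (hw : ContinuousOn w (modelHalf n)) (hw0 : ∀ x ∉ K', w x = 0) {i : Fin n} (hi : i ≠ 0)
    (j : Fin n) :
    Filter.Tendsto (fun h => faceTerm j fun x => diffQuot i h f x * w x) (𝓝[≠] 0)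
      (𝓝 (faceTerm j fun x => fderivWithin ℝ f (modelHalf n) x (bvec i) * w x)) := by
  unfold faceTerm
  split_ifs with hj
  swap
  · exact tendsto_const_nhds
  refine Filter.Tendsto.neg ?_
  obtain ⟨C, hC0, hC⟩ := exists_abs_diffQuot_le hK hf h0 hi
  refine tendsto_integral_filter_of_dominated_convergence (fun y => C * ‖w (faceIncl n y)‖)
    ?_ ?_ ?_ ?_
  · exact Filter.Eventually.of_forall fun h => (continuous_comp_faceIncl
      ((continuousOn_diffQuot hf.continuousOn hi h).mul hw)).aestronglyMeasurable
  · refine Filter.Eventually.of_forall fun h => Filter.Eventually.of_forall fun y => ?_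
    rw [norm_mul]
    exact mul_le_mul_of_nonneg_right (hC h _ (faceIncl_mem y)) (norm_nonneg _)
  · exact (integrable_comp_faceIncl hK' hw hw0).norm.const_mul C
  · exact Filter.Eventually.of_forall fun y => (tendsto_diffQuot hf hi (faceIncl_mem y)).mul_const _

lemma contDiffOn_translate {f : E n → ℝ} (hf : ContDiffOn ℝ 1 f (modelHalf n)) {i : Fin n}
    (hi : i ≠ 0) (h : ℝ) : ContDiffOn ℝ 1 (fun x => f (x + h • bvec i)) (modelHalf n) :=
  hf.comp (by fun_prop) fun x hx => (add_smul_bvec_mem_iff hi h x).2 hx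

lemma fderivWithin_translate {f : E n → ℝ} (hf : ContDiffOn ℝ 1 f (modelHalf n)) {i : Fin n}
    (hi : i ≠ 0) (h : ℝ) {x : E n} (hx : x ∈ modelHalf n) :
    fderivWithin ℝ (fun x => f (x + h • bvec i)) (modelHalf n) x
      = fderivWithin ℝ f (modelHalf n) (x + h • bvec i) := by
  have hx' := (add_smul_bvec_mem_iff hi h x).2 hx
  have h1 := (hf.differentiableOn one_ne_zero _ hx').hasFDerivWithinAt
  have h2 : HasFDerivWithinAt (fun x : E n => x + h • bvec i) (ContinuousLinearMap.id ℝ (E n))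
      (modelHalf n) x := (hasFDerivWithinAt_id x _).add_const _
  have h3 := h1.comp x h2 fun y hy => (add_smul_bvec_mem_iff hi h y).2 hy
  rw [ContinuousLinearMap.comp_id] at h3
  exact h3.fderivWithin (uniqueDiffOn_modelHalf x hx)

/-- The weak form of the symmetry of second derivatives, for a function that is only `C¹`; the
direction `i` is tangential to the boundary. -/
lemma integral_fderivWithin_mul_comm {f z : E n → ℝ} {K K' : Set (E n)} (hK : IsCompact K)
    (hf : ContDiffOn ℝ 1 f (modelHalf n)) (h0 : ∀ x ∉ K, f x = 0) (hK' : IsCompact K')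
    (hz : ContDiffOn ℝ 1 z (modelHalf n)) (hz0 : ∀ x ∉ K', z x = 0) {i : Fin n} (hi : i ≠ 0)
    (j : Fin n) :
    ∫ x in modelHalf n, fderivWithin ℝ f (modelHalf n) x (bvec i)
        * fderivWithin ℝ z (modelHalf n) x (bvec j)
      = (∫ x in modelHalf n, fderivWithin ℝ z (modelHalf n) x (bvec i)
          * fderivWithin ℝ f (modelHalf n) x (bvec j))
        + faceTerm j fun x => fderivWithin ℝ f (modelHalf n) x (bvec i) * z x := by
  have hfz : ∀ x ∉ K, fderivWithin ℝ f (modelHalf n) x (bvec j) = 0 := fun x hx => by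
    rw [fderivWithin_eq_zero_of_notMem hK.isClosed h0 hx]; rfl
  have hzz : ∀ x ∉ K', fderivWithin ℝ z (modelHalf n) x (bvec j) = 0 := fun x hx => by
    rw [fderivWithin_eq_zero_of_notMem hK'.isClosed hz0 hx]; rfl
  -- The derivative `∂ᵢ f` is only continuous, but the difference quotient of `f` is `C¹`. For it
  -- one integrates by parts in the direction `j`, then shifts the translation onto `z`, which
  -- changes `h` to `-h`, and finally lets `h → 0`.
  have t1 := tendsto_integral_diffQuot_mul hK hf h0 hK' (continuousOn_fderivWithin_apply hz (bvec j))
    hzz hi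
  have t2 := (tendsto_integral_diffQuot_mul hK' hz hz0 hK
    (continuousOn_fderivWithin_apply hf (bvec j)) hfz hi)
  have hneg : Filter.Tendsto (fun h : ℝ => -h) (𝓝[≠] 0) (𝓝[≠] 0) := by
    refine tendsto_nhdsWithin_iff.2 ⟨?_, ?_⟩
    · have : Filter.Tendsto (fun h : ℝ => -h) (𝓝 0) (𝓝 (-0)) := continuous_neg.tendsto 0
      rw [neg_zero] at this
      exact this.mono_left nhdsWithin_le_nhds
    · filter_upwards [self_mem_nhdsWithin] with h hh
      simpa using hh
  have t3 := (t2.comp hneg).add (tendsto_faceTerm_diffQuot_mul hK hf h0 hK' hz.continuousOn hz0 hi j)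
  refine tendsto_nhds_unique t1 (t3.congr' ?_)
  filter_upwards [self_mem_nhdsWithin] with h hh
  have hh0 : h ≠ 0 := hh
  have hdq : ContDiffOn ℝ 1 (diffQuot i h f) (modelHalf n) :=
    contDiffOn_const.mul ((contDiffOn_translate hf hi h).sub hf)
  rw [integral_mul_fderivWithin hK' hdq hz hz0 j]
  congr 1
  have hder : ∀ x ∈ modelHalf n, fderivWithin ℝ (diffQuot i h f) (modelHalf n) x (bvec j)
      = h⁻¹ * (fderivWithin ℝ f (modelHalf n) (x + h • bvec i) (bvec j)
        - fderivWithin ℝ f (modelHalf n) x (bvec j)) := fun x hx => by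
    have hu := uniqueDiffOn_modelHalf x hx
    have e1 := (contDiffOn_translate hf hi h).differentiableOn one_ne_zero x hx
    have e2 := hf.differentiableOn one_ne_zero x hx
    unfold diffQuot
    rw [fderivWithin_const_mul hu (e1.fun_sub e2)]
    change h⁻¹ * fderivWithin ℝ (fun x => f (x + h • bvec i) - f x) (modelHalf n) x (bvec j) = _
    rw [fderivWithin_fun_sub hu e1 e2,
      fderivWithin_translate hf hi h hx]
    rfl
  have hR : ∫ x in modelHalf n, fderivWithin ℝ (diffQuot i h f) (modelHalf n) x (bvec j) * z x
      = h⁻¹ * ((∫ x in modelHalf n,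
          fderivWithin ℝ f (modelHalf n) (x + h • bvec i) (bvec j) * z x)
        - ∫ x in modelHalf n, fderivWithin ℝ f (modelHalf n) x (bvec j) * z x) := by
    rw [← integral_sub, ← integral_const_mul]
    · refine setIntegral_congr_fun measurableSet_modelHalf fun x hx => ?_
      rw [hder x hx]; ring
    · refine integrableOn_of_continuousOn hK' (ContinuousOn.mul ?_ hz.continuousOn)
        fun x hx => by rw [hz0 x hx, mul_zero]
      exact (continuousOn_fderivWithin_apply hf (bvec j)).comp (by fun_prop)
        fun x hx => (add_smul_bvec_mem_iff hi h x).2 hx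
    · exact integrableOn_of_continuousOn hK'
        ((continuousOn_fderivWithin_apply hf (bvec j)).mul hz.continuousOn)
        fun x hx => by rw [hz0 x hx, mul_zero]
  have hT : ∫ x in modelHalf n, fderivWithin ℝ f (modelHalf n) (x + h • bvec i) (bvec j) * z x
      = ∫ x in modelHalf n, fderivWithin ℝ f (modelHalf n) x (bvec j) * z (x + (-h) • bvec i) := by
    rw [← setIntegral_translate hi h (fun x => fderivWithin ℝ f (modelHalf n) x (bvec j)
      * z (x + (-h) • bvec i))]
    simp
  rw [hR, hT, ← integral_sub, ← integral_const_mul, ← integral_neg]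
  · simp only [Function.comp]
    refine setIntegral_congr_fun measurableSet_modelHalf fun x hx => ?_
    simp only [diffQuot]
    rw [inv_neg]; ring
  · refine integrableOn_of_continuousOn hK ((continuousOn_fderivWithin_apply hf (bvec j)).mul ?_)
      fun x hx => by rw [hfz x hx, zero_mul]
    exact (contDiffOn_translate hz hi (-h)).continuousOn
  · exact integrableOn_of_continuousOn hK
      ((continuousOn_fderivWithin_apply hf (bvec j)).mul hz.continuousOn)
      fun x hx => by rw [hfz x hx, zero_mul]

end HalfSpaceParts

/-! ### Weak `d² = 0` for vector-valued functions. -/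

section VectorParts

variable {n d : ℕ} [NeZero n]

omit [NeZero n] in
lemma fderivWithin_coord {N : E n → E d} {s : Set (E n)} {x : E n}
    (hN : DifferentiableWithinAt ℝ N s x) (hs : UniqueDiffWithinAt ℝ s x) (a : Fin d) (v : E n) :
    fderivWithin ℝ (fun y => N y a) s x v = fderivWithin ℝ N s x v a := by
  have h := ((EuclideanSpace.proj a : E d →L[ℝ] ℝ).hasFDerivAt (x := N x)).comp_hasFDerivWithinAt x
    hN.hasFDerivWithinAt
  have h2 := h.fderivWithin hs
  exact congrArg (fun T : E n →L[ℝ] ℝ => T v) h2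

omit [NeZero n] in
lemma contDiffOn_coord {N : E n → E d} {s : Set (E n)} (hN : ContDiffOn ℝ 1 N s) (a : Fin d) :
    ContDiffOn ℝ 1 (fun y => N y a) s :=
  (EuclideanSpace.proj a : E d →L[ℝ] ℝ).contDiff.comp_contDiffOn hN

lemma inner_eq_sum_coord (v w : E d) : ⟪v, w⟫_ℝ = ∑ a, v a * w a := by
  rw [PiLp.inner_apply]
  exact Finset.sum_congr rfl fun a _ => by simp [mul_comm]

lemma integral_inner_fderivWithin_comm {N Z : E n → E d} {K K' : Set (E n)} (hK : IsCompact K)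
    (hN : ContDiffOn ℝ 1 N (modelHalf n)) (h0 : ∀ x ∉ K, N x = 0) (hK' : IsCompact K')
    (hZ : ContDiffOn ℝ 1 Z (modelHalf n)) (hZ0 : ∀ x ∉ K', Z x = 0) {i : Fin n} (hi : i ≠ 0)
    (j : Fin n) :
    ∫ x in modelHalf n, ⟪fderivWithin ℝ N (modelHalf n) x (bvec i),
        fderivWithin ℝ Z (modelHalf n) x (bvec j)⟫_ℝ
      = (∫ x in modelHalf n, ⟪fderivWithin ℝ N (modelHalf n) x (bvec j),
          fderivWithin ℝ Z (modelHalf n) x (bvec i)⟫_ℝ)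
        + faceTerm j fun x => ⟪fderivWithin ℝ N (modelHalf n) x (bvec i), Z x⟫_ℝ := by
  have key : ∀ a, _ := fun a => integral_fderivWithin_mul_comm hK (contDiffOn_coord hN a)
    (fun x hx => by rw [h0 x hx]; rfl) hK' (contDiffOn_coord hZ a)
    (fun x hx => by rw [hZ0 x hx]; rfl) hi j
  have hint : ∀ (u v : E n) (a : Fin d), IntegrableOn (fun x =>
      fderivWithin ℝ (fun y => N y a) (modelHalf n) x u
        * fderivWithin ℝ (fun y => Z y a) (modelHalf n) x v) (modelHalf n) := fun u v a => by
    refine integrableOn_of_continuousOn hK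
      ((continuousOn_fderivWithin_apply (contDiffOn_coord hN a) u).mul
        (continuousOn_fderivWithin_apply (contDiffOn_coord hZ a) v)) fun x hx => ?_
    rw [fderivWithin_eq_zero_of_notMem (z := fun y => N y a) hK.isClosed
      (fun x hx => by rw [h0 x hx]; rfl) hx]
    simp
  have hexp : ∀ u v : E n, ∫ x in modelHalf n, ⟪fderivWithin ℝ N (modelHalf n) x u,
        fderivWithin ℝ Z (modelHalf n) x v⟫_ℝ
      = ∑ a, ∫ x in modelHalf n, fderivWithin ℝ (fun y => N y a) (modelHalf n) x u
        * fderivWithin ℝ (fun y => Z y a) (modelHalf n) x v := fun u v => by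
    rw [← integral_finsetSum _ fun a _ => hint u v a]
    refine setIntegral_congr_fun measurableSet_modelHalf fun x hx => ?_
    have hu := uniqueDiffOn_modelHalf x hx
    rw [inner_eq_sum_coord]
    refine Finset.sum_congr rfl fun a _ => ?_
    rw [fderivWithin_coord (hN.differentiableOn one_ne_zero x hx) hu,
      fderivWithin_coord (hZ.differentiableOn one_ne_zero x hx) hu]
  have hface : (faceTerm j fun x => ⟪fderivWithin ℝ N (modelHalf n) x (bvec i), Z x⟫_ℝ)
      = ∑ a, faceTerm j fun x => fderivWithin ℝ (fun y => N y a) (modelHalf n) x (bvec i) * Z x a := by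
    unfold faceTerm
    split_ifs with hj
    · rw [Finset.sum_neg_distrib, ← integral_finsetSum]
      · congr 2
        ext y
        simp only
        rw [inner_eq_sum_coord]
        refine Finset.sum_congr rfl fun a _ => ?_
        rw [fderivWithin_coord (hN.differentiableOn one_ne_zero _ (faceIncl_mem y))
          (uniqueDiffOn_modelHalf _ (faceIncl_mem y))]
      · intro a _
        exact integrable_comp_faceIncl (w := fun x =>
          fderivWithin ℝ (fun y => N y a) (modelHalf n) x (bvec i) * Z x a) hK'
          ((continuousOn_fderivWithin_apply (contDiffOn_coord hN a) _).mul
            (contDiffOn_coord hZ a).continuousOn) fun x hx => by simp [hZ0 x hx]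
    · simp
  rw [hexp, hexp, hface, ← Finset.sum_add_distrib]
  refine Finset.sum_congr rfl fun a _ => ?_
  rw [key a]
  congr 2
  ext x
  ring

/-- The weak form of `d² = 0`, tested with an antisymmetric family. -/
lemma sum_integral_inner_fderivWithin {N : E n → E d} {Z : Fin n → Fin n → E n → E d}
    {K K' : Set (E n)} (hK : IsCompact K)
    (hN : ContDiffOn ℝ 1 N (modelHalf n)) (h0 : ∀ x ∉ K, N x = 0) (hK' : IsCompact K')
    (hZ : ∀ i j, ContDiffOn ℝ 1 (Z i j) (modelHalf n)) (hZ0 : ∀ i j, ∀ x ∉ K', Z i j x = 0)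
    (hanti : ∀ i j, Z j i = -Z i j) :
    ∑ i, ∑ j, ∫ x in modelHalf n, ⟪fderivWithin ℝ N (modelHalf n) x (bvec i),
        fderivWithin ℝ (Z i j) (modelHalf n) x (bvec j)⟫_ℝ
      = -∑ i, ∫ y, ⟪fderivWithin ℝ N (modelHalf n) (faceIncl n y) (bvec i),
          Z i 0 (faceIncl n y)⟫_ℝ := by
  set I : Fin n → Fin n → ℝ := fun i j => ∫ x in modelHalf n,
    ⟪fderivWithin ℝ N (modelHalf n) x (bvec i),
      fderivWithin ℝ (Z i j) (modelHalf n) x (bvec j)⟫_ℝ with hI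
  set B : Fin n → Fin n → ℝ := fun i j =>
    faceTerm j fun x => ⟪fderivWithin ℝ N (modelHalf n) x (bvec i), Z i j x⟫_ℝ with hB
  -- Antisymmetry of `Z` turns weak symmetry of second derivatives into a statement on `I i j + I j
  -- i`. It requires one tangential index; for `i = j = 0` everything vanishes since `Z 0 0 = 0`.
  have hpair : ∀ i j, i ≠ 0 → I i j + I j i = B i j := fun i j hi => by
    have h1 := integral_inner_fderivWithin_comm hK hN h0 hK' (hZ i j) (hZ0 i j) hi j
    have h2 : ∫ x in modelHalf n, ⟪fderivWithin ℝ N (modelHalf n) x (bvec j),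
        fderivWithin ℝ (Z i j) (modelHalf n) x (bvec i)⟫_ℝ = -I j i := by
      rw [hI, ← integral_neg]
      refine setIntegral_congr_fun measurableSet_modelHalf fun x hx => ?_
      rw [hanti i j, fderivWithin_neg (uniqueDiffOn_modelHalf x hx)]
      simp
    rw [h2] at h1
    rw [hI, hB]
    simp only at h1 ⊢
    rw [h1]; ring
  have hBz : ∀ i j, j ≠ 0 → B i j = 0 := fun i j hj => by simp [hB, faceTerm, hj]
  have hZd : ∀ i, Z i i = 0 := fun i => by
    have := hanti i i
    ext1 x
    have h := congrFun this x
    simpa [eq_neg_iff_add_eq_zero, ← two_smul ℝ] using h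
  have hsym : ∀ i j, I i j + I j i = B i j + B j i := fun i j => by
    by_cases hi : i = 0
    · by_cases hj : j = 0
      · subst hi; subst hj
        simp [hI, hB, hZd, faceTerm]
      · rw [hBz i j hj, zero_add, add_comm, hpair j i hj]
    · rw [hBz j i hi, add_zero, hpair i j hi]
  have hsum : ∑ i, ∑ j, I i j = ∑ i, ∑ j, B i j := by
    have h1 : ∑ i, ∑ j, (I i j + I j i) = ∑ i, ∑ j, (B i j + B j i) :=
      Finset.sum_congr rfl fun i _ => Finset.sum_congr rfl fun j _ => hsym i j
    simp_rw [Finset.sum_add_distrib] at h1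
    rw [Finset.sum_comm (f := fun i j => I j i), Finset.sum_comm (f := fun i j => B j i)] at h1
    linarith
  rw [hsum, ← Finset.sum_neg_distrib]
  refine Finset.sum_congr rfl fun i _ => ?_
  rw [Finset.sum_eq_single 0 (fun j _ hj => hBz i j hj) (by simp)]
  simp [hB, faceTerm]

end VectorParts

/-! ### Structure equations of a hypersurface. -/

section LocalGeometry

/-- The algebra behind the divergence of the antisymmetric tensor `c ∧ e`: the terms with
Christoffel symbols cancel. -/
lemma sum_christoffel_cancel {n : ℕ} (Γ : Fin n → Fin n → Fin n → ℝ)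
    (hΓ : ∀ i j k, Γ i j k = Γ i k j) (c : Fin n → ℝ) (a : Fin n → Fin n → ℝ) (m : ℝ) :
    ∑ i, ∑ j, ((∑ k, Γ k j k) * (c i * a i j - c j * a i i)
      + ((-(∑ k, Γ i j k * c k) - a j i * m) * a i j + c i * (-∑ k, Γ j j k * a i k)
        - (-(∑ k, Γ j j k * c k) - a j j * m) * a i i - c j * (-∑ k, Γ i j k * a i k)))
    = m * ((∑ i, a i i) ^ 2 - ∑ i, ∑ j, a i j * a j i) := by
  -- The Christoffel terms cancel in the three pairs `q1`, `q2`, `q3` after renaming summation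
  -- indices and using the symmetry of `Γ` in its lower indices.
  have q1 : ∑ i, ∑ j, (∑ k, Γ k j k) * (c i * a i j)
      = ∑ i, ∑ j, c i * ∑ k, Γ j j k * a i k := by
    refine Finset.sum_congr rfl fun i _ => ?_
    simp_rw [Finset.sum_mul, Finset.mul_sum]
    rw [Finset.sum_comm]
    refine Finset.sum_congr rfl fun j _ => Finset.sum_congr rfl fun k _ => ?_
    rw [hΓ j j k]; ring
  have q2 : ∑ i, ∑ j, (∑ k, Γ k j k) * (c j * a i i)
      = ∑ i, ∑ j, (∑ k, Γ j j k * c k) * a i i := by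
    refine Finset.sum_congr rfl fun i _ => ?_
    simp_rw [Finset.sum_mul]
    rw [Finset.sum_comm]
    refine Finset.sum_congr rfl fun j _ => Finset.sum_congr rfl fun k _ => ?_
    rw [hΓ j j k]; ring
  have q3 : ∑ i, ∑ j, (∑ k, Γ i j k * c k) * a i j
      = ∑ i, ∑ j, c j * ∑ k, Γ i j k * a i k := by
    refine Finset.sum_congr rfl fun i _ => ?_
    simp_rw [Finset.sum_mul, Finset.mul_sum]
    rw [Finset.sum_comm]
    refine Finset.sum_congr rfl fun j _ => Finset.sum_congr rfl fun k _ => ?_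
    rw [hΓ i j k]; ring
  have q4 : ∑ i, ∑ j, a j j * m * a i i = m * (∑ i, a i i) ^ 2 := by
    rw [sq, Finset.sum_mul_sum, Finset.mul_sum]
    simp_rw [Finset.mul_sum]
    exact Finset.sum_congr rfl fun i _ => Finset.sum_congr rfl fun j _ => by ring
  have q5 : ∑ i, ∑ j, a j i * m * a i j = m * ∑ i, ∑ j, a i j * a j i := by
    simp_rw [Finset.mul_sum]
    exact Finset.sum_congr rfl fun i _ => Finset.sum_congr rfl fun j _ => by ring
  have hsplit : ∀ i j, ((∑ k, Γ k j k) * (c i * a i j - c j * a i i)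
      + ((-(∑ k, Γ i j k * c k) - a j i * m) * a i j + c i * (-∑ k, Γ j j k * a i k)
        - (-(∑ k, Γ j j k * c k) - a j j * m) * a i i - c j * (-∑ k, Γ i j k * a i k)))
      = (∑ k, Γ k j k) * (c i * a i j) - (∑ k, Γ k j k) * (c j * a i i)
        - (∑ k, Γ i j k * c k) * a i j - a j i * m * a i j - c i * (∑ k, Γ j j k * a i k)
        + (∑ k, Γ j j k * c k) * a i i + a j j * m * a i i + c j * ∑ k, Γ i j k * a i k :=
    fun i j => by ring
  simp_rw [hsplit, Finset.sum_add_distrib, Finset.sum_sub_distrib]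
  rw [q1, q2, q3, q4, q5]
  ring

variable {F : Type*} [NormedAddCommGroup F] [NormedSpace ℝ F] {s : Set F} {x : F} {d : ℕ}

/-- All structure equations below come from differentiating constant inner products: `⟨N, L v⟩ = 0`,
`⟨N, N⟩ = 1`, `⟨eⁱ, L e_k⟩ = δ` and `⟨eⁱ, N⟩ = 0`. -/
lemma inner_hasFDerivWithinAt_eq_zero {v w : F → E d} {v' w' : F →L[ℝ] E d} {r : ℝ}
    (hv : HasFDerivWithinAt v v' s x) (hw : HasFDerivWithinAt w w' s x)
    (hs : UniqueDiffWithinAt ℝ s x) (hx : x ∈ s) (h : ∀ᶠ y in 𝓝[s] x, ⟪v y, w y⟫_ℝ = r) (u : F) :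
    ⟪v x, w' u⟫_ℝ + ⟪v' u, w x⟫_ℝ = 0 := by
  have h1 := hv.inner ℝ hw
  have h2 : HasFDerivWithinAt (fun y => ⟪v y, w y⟫_ℝ) (0 : F →L[ℝ] ℝ) s x :=
    (hasFDerivWithinAt_const r x s).congr_of_eventuallyEq h (h.self_of_nhdsWithin hx)
  have h3 := congrArg (fun T : F →L[ℝ] ℝ => T u) (hs.eq h1 h2)
  simpa [fderivInnerCLM_apply] using h3

/-- The structure equations of a hypersurface at a point. -/
structure HypersurfaceGerm {n : ℕ} (L : E n → E n →L[ℝ] E (n + 1)) (N : E n → E (n + 1))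
    (s : Set (E n)) (x : E n) : Prop where
  mem : x ∈ s
  unique : UniqueDiffWithinAt ℝ s x
  contDiff_frame : ContDiffWithinAt ℝ 1 L s x
  contDiff_normal : ContDiffWithinAt ℝ 1 N s x
  symm : ∀ u v, fderivWithin ℝ L s x u v = fderivWithin ℝ L s x v u
  injective : ∀ᶠ y in 𝓝[s] x, Function.Injective (L y)
  normal : ∀ᶠ y in 𝓝[s] x, ∀ v, ⟪N y, L y v⟫_ℝ = 0
  unit : ∀ᶠ y in 𝓝[s] x, ‖N y‖ = 1

namespace HypersurfaceGerm

variable {n : ℕ} {L : E n → E n →L[ℝ] E (n + 1)} {N : E n → E (n + 1)} {s : Set (E n)} {x : E n}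
  (g : HypersurfaceGerm L N s x)

include g

lemma injective_self : Function.Injective (L x) := g.injective.self_of_nhdsWithin g.mem

lemma normal_self : ∀ v, ⟪N x, L x v⟫_ℝ = 0 := g.normal.self_of_nhdsWithin g.mem

lemma unit_self : ‖N x‖ = 1 := g.unit.self_of_nhdsWithin g.mem

lemma hasFDerivWithinAt_frame : HasFDerivWithinAt L (fderivWithin ℝ L s x) s x :=
  (g.contDiff_frame.differentiableWithinAt one_ne_zero).hasFDerivWithinAt

lemma hasFDerivWithinAt_normal : HasFDerivWithinAt N (fderivWithin ℝ N s x) s x :=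
  (g.contDiff_normal.differentiableWithinAt one_ne_zero).hasFDerivWithinAt

lemma hasFDerivWithinAt_frame_apply (v : E n) :
    HasFDerivWithinAt (fun y => L y v)
      ((ContinuousLinearMap.apply ℝ (E (n + 1)) v) ∘L fderivWithin ℝ L s x) s x :=
  (ContinuousLinearMap.apply ℝ (E (n + 1)) v).hasFDerivAt.comp_hasFDerivWithinAt x
    g.hasFDerivWithinAt_frame

lemma inner_deriv_normal_frame (u v : E n) :
    ⟪fderivWithin ℝ N s x u, L x v⟫_ℝ = -⟪N x, fderivWithin ℝ L s x u v⟫_ℝ := by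
  have := inner_hasFDerivWithinAt_eq_zero g.hasFDerivWithinAt_normal
    (g.hasFDerivWithinAt_frame_apply v) g.unique g.mem (g.normal.mono fun y hy => hy v) u
  have h2 : ⟪N x, fderivWithin ℝ L s x u v⟫_ℝ + ⟪fderivWithin ℝ N s x u, L x v⟫_ℝ = 0 := this
  linarith

/-- Both sides equal minus the normal component of the second derivative of the immersion, which is
symmetric. -/
lemma inner_deriv_normal_symm (u v : E n) :
    ⟪fderivWithin ℝ N s x u, L x v⟫_ℝ = ⟪fderivWithin ℝ N s x v, L x u⟫_ℝ := by
  rw [g.inner_deriv_normal_frame, g.inner_deriv_normal_frame, g.symm]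

lemma inner_deriv_normal_normal (u : E n) : ⟪fderivWithin ℝ N s x u, N x⟫_ℝ = 0 := by
  have := inner_hasFDerivWithinAt_eq_zero (r := 1) g.hasFDerivWithinAt_normal
    g.hasFDerivWithinAt_normal g.unique g.mem
    (g.unit.mono fun y hy => by rw [real_inner_self_eq_norm_sq, hy, one_pow]) u
  rw [real_inner_comm] at this
  linarith

/-- The second fundamental form, extended by zero to normal vectors, is symmetric. -/
lemma inner_shape_symm (v w : E (n + 1)) :
    ⟪fderivWithin ℝ N s x (leftInv (L x) v), w⟫_ℝ
      = ⟪fderivWithin ℝ N s x (leftInv (L x) w), v⟫_ℝ := by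
  have h : ∀ u w, ⟪fderivWithin ℝ N s x u, w⟫_ℝ
      = ⟪fderivWithin ℝ N s x u, L x (leftInv (L x) w)⟫_ℝ := fun u w => by
    rw [apply_leftInv g.injective_self g.unit_self g.normal_self, inner_sub_right,
      inner_smul_right, g.inner_deriv_normal_normal, mul_zero, sub_zero]
  rw [h, h _ v, g.inner_deriv_normal_symm]

lemma differentiableWithinAt_dualVec (i : Fin n) :
    DifferentiableWithinAt ℝ (fun y => dualVec (L y) i) s x :=
  (contDiffWithinAt_dualVec g.contDiff_frame g.injective_self i).differentiableWithinAt one_ne_zero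

/-- The derivative of the dual frame in terms of Christoffel symbols and the second fundamental
form. -/
lemma fderivWithin_dualVec (i : Fin n) (u : E n) :
    fderivWithin ℝ (fun y => dualVec (L y) i) s x u
      = -(∑ k, ⟪dualVec (L x) i, fderivWithin ℝ L s x u (bvec k)⟫_ℝ • dualVec (L x) k)
        - ⟪fderivWithin ℝ N s x u, dualVec (L x) i⟫_ℝ • N x := by
  have he := (g.differentiableWithinAt_dualVec i).hasFDerivWithinAt
  rw [sum_inner_smul_dualVec g.injective_self g.unit_self g.normal_self
    (fderivWithin ℝ (fun y => dualVec (L y) i) s x u)]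
  have h1 : ∀ k, ⟪fderivWithin ℝ (fun y => dualVec (L y) i) s x u, L x (bvec k)⟫_ℝ
      = -⟪dualVec (L x) i, fderivWithin ℝ L s x u (bvec k)⟫_ℝ := fun k => by
    have := inner_hasFDerivWithinAt_eq_zero (r := if i = k then 1 else 0) he
      (g.hasFDerivWithinAt_frame_apply (bvec k)) g.unique g.mem
      (g.injective.mono fun y hy => inner_dualVec_apply hy i k) u
    have h2 : ⟪dualVec (L x) i, fderivWithin ℝ L s x u (bvec k)⟫_ℝ
      + ⟪fderivWithin ℝ (fun y => dualVec (L y) i) s x u, L x (bvec k)⟫_ℝ = 0 := this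
    linarith
  have h2 : ⟪fderivWithin ℝ (fun y => dualVec (L y) i) s x u, N x⟫_ℝ
      = -⟪fderivWithin ℝ N s x u, dualVec (L x) i⟫_ℝ := by
    have := inner_hasFDerivWithinAt_eq_zero (r := 0) he
      g.hasFDerivWithinAt_normal g.unique g.mem
      (g.normal.mono fun y hy => inner_dualVec_normal hy i) u
    rw [real_inner_comm] at this
    linarith
  simp_rw [h1, h2, neg_smul, Finset.sum_neg_distrib, sub_eq_add_neg]

end HypersurfaceGerm

end LocalGeometry

/-! ### The divergence of the test field and its contraction with the derivative of the normal. -/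

section LocalJacobi

variable {n : ℕ}

/-- The antisymmetric field `ζ √det g (cⁱ eʲ - cʲ eⁱ)`. -/
def wedgeField (L : E n → E n →L[ℝ] E (n + 1)) (ζ : E n → ℝ) (c : E (n + 1)) (i j : Fin n)
    (y : E n) : E (n + 1) :=
  (ζ y * jacobian (L y)) •
    (⟪c, dualVec (L y) i⟫_ℝ • dualVec (L y) j - ⟪c, dualVec (L y) j⟫_ℝ • dualVec (L y) i)

lemma wedgeField_swap (L : E n → E n →L[ℝ] E (n + 1)) (ζ : E n → ℝ) (c : E (n + 1))
    (i j : Fin n) : wedgeField L ζ c j i = -wedgeField L ζ c i j := by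
  ext1 y
  simp only [wedgeField, Pi.neg_apply]
  rw [← smul_neg, neg_sub]

namespace HypersurfaceGerm

variable {L : E n → E n →L[ℝ] E (n + 1)} {N : E n → E (n + 1)} {s : Set (E n)} {x : E n}
  (g : HypersurfaceGerm L N s x)

include g

lemma contDiffWithinAt_wedgeField {ζ : E n → ℝ} (hζ : ContDiffWithinAt ℝ 1 ζ s x)
    (c : E (n + 1)) (i j : Fin n) : ContDiffWithinAt ℝ 1 (wedgeField L ζ c i j) s x := by
  have he := contDiffWithinAt_dualVec g.contDiff_frame g.injective_self
  exact (hζ.mul (contDiffWithinAt_jacobian g.contDiff_frame g.injective_self)).smul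
    (((contDiffWithinAt_const.inner ℝ (he i)).smul (he j)).sub
      ((contDiffWithinAt_const.inner ℝ (he j)).smul (he i)))

lemma fderivWithin_wedgeField {ζ : E n → ℝ} (hζ : DifferentiableWithinAt ℝ ζ s x)
    (c : E (n + 1)) (i j : Fin n) (u : E n) :
    fderivWithin ℝ (wedgeField L ζ c i j) s x u
      = (fderivWithin ℝ ζ s x u * jacobian (L x)) •
          (⟪c, dualVec (L x) i⟫_ℝ • dualVec (L x) j - ⟪c, dualVec (L x) j⟫_ℝ • dualVec (L x) i)
        + (ζ x * jacobian (L x)) •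
          ((∑ k, ⟪dualVec (L x) k, fderivWithin ℝ L s x u (bvec k)⟫_ℝ) •
            (⟪c, dualVec (L x) i⟫_ℝ • dualVec (L x) j - ⟪c, dualVec (L x) j⟫_ℝ • dualVec (L x) i)
          + (⟪c, fderivWithin ℝ (fun y => dualVec (L y) i) s x u⟫_ℝ • dualVec (L x) j
            + ⟪c, dualVec (L x) i⟫_ℝ • fderivWithin ℝ (fun y => dualVec (L y) j) s x u
            - ⟪c, fderivWithin ℝ (fun y => dualVec (L y) j) s x u⟫_ℝ • dualVec (L x) i
            - ⟪c, dualVec (L x) j⟫_ℝ • fderivWithin ℝ (fun y => dualVec (L y) i) s x u)) := by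
  obtain ⟨J', hJ, hJ'⟩ := hasFDerivWithinAt_jacobian g.hasFDerivWithinAt_frame g.injective_self u
  have he := fun i => (g.differentiableWithinAt_dualVec i).hasFDerivWithinAt
  have hc := fun i => (hasFDerivWithinAt_const c x s).inner ℝ (he i)
  have h := (hζ.hasFDerivWithinAt.mul hJ).smul (((hc i).smul (he j)).sub ((hc j).smul (he i)))
  have h2 := h.fderivWithin g.unique
  have h3 : fderivWithin ℝ (wedgeField L ζ c i j) s x = _ := h2
  rw [h3]
  simp only [add_apply, smul_apply, ContinuousLinearMap.smulRight_apply, sub_apply,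
    ContinuousLinearMap.comp_apply, ContinuousLinearMap.prod_apply, fderivInnerCLM_apply,
    hJ', zero_apply, inner_zero_left, add_zero, smul_eq_mul, Pi.mul_apply, Pi.sub_apply,
    Pi.smul_apply']
  module

/-- The pointwise identity behind the weak Jacobi equation. -/
lemma sum_inner_fderivWithin_wedgeField {ζ : E n → ℝ} (hζ : DifferentiableWithinAt ℝ ζ s x)
    (c : E (n + 1)) :
    ∑ i, ∑ j, ⟪fderivWithin ℝ N s x (bvec i),
        fderivWithin ℝ (wedgeField L ζ c i j) s x (bvec j)⟫_ℝ
      = jacobian (L x) * ((∑ i, ∑ j, fderivWithin ℝ ζ s x (bvec j) *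
          (⟪c, dualVec (L x) i⟫_ℝ * ⟪fderivWithin ℝ N s x (bvec i), dualVec (L x) j⟫_ℝ
            - ⟪c, dualVec (L x) j⟫_ℝ * ⟪fderivWithin ℝ N s x (bvec i), dualVec (L x) i⟫_ℝ))
        + ζ x * (⟪c, N x⟫_ℝ *
          ((∑ i, ⟪fderivWithin ℝ N s x (bvec i), dualVec (L x) i⟫_ℝ) ^ 2
            - ∑ i, ∑ j, ⟪fderivWithin ℝ N s x (bvec i), dualVec (L x) j⟫_ℝ
              * ⟪fderivWithin ℝ N s x (bvec j), dualVec (L x) i⟫_ℝ))) := by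
  set a : Fin n → Fin n → ℝ := fun i j => ⟪fderivWithin ℝ N s x (bvec i), dualVec (L x) j⟫_ℝ
    with ha
  set C : Fin n → ℝ := fun i => ⟪c, dualVec (L x) i⟫_ℝ with hC
  set Γ : Fin n → Fin n → Fin n → ℝ := fun i j k =>
    ⟪dualVec (L x) i, fderivWithin ℝ L s x (bvec j) (bvec k)⟫_ℝ with hΓdef
  have hΓ : ∀ i j k, Γ i j k = Γ i k j := fun i j k => by simp only [hΓdef]; rw [g.symm]
  rw [← sum_christoffel_cancel Γ hΓ C a ⟪c, N x⟫_ℝ, Finset.mul_sum, ← Finset.sum_add_distrib,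
    Finset.mul_sum]
  refine Finset.sum_congr rfl fun i _ => ?_
  rw [Finset.mul_sum, ← Finset.sum_add_distrib, Finset.mul_sum]
  refine Finset.sum_congr rfl fun j _ => ?_
  -- The normal component of the derivative of the dual frame survives only against `c`; it yields
  -- the factor `⟨c, N⟩`. Against `∂ᵢN`, which is tangential, it vanishes.
  have hd1 : ∀ i j, ⟪c, fderivWithin ℝ (fun y => dualVec (L y) i) s x (bvec j)⟫_ℝ
      = -(∑ k, Γ i j k * C k) - a j i * ⟪c, N x⟫_ℝ := fun i j => by
    rw [g.fderivWithin_dualVec, inner_sub_right, inner_neg_right, inner_sum, inner_smul_right]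
    simp only [inner_smul_right, hΓdef, hC, ha]
  have hd2 : ∀ i j l, ⟪fderivWithin ℝ N s x (bvec i),
      fderivWithin ℝ (fun y => dualVec (L y) l) s x (bvec j)⟫_ℝ
      = -∑ k, Γ l j k * a i k := fun i j l => by
    rw [g.fderivWithin_dualVec, inner_sub_right, inner_neg_right, inner_sum, inner_smul_right,
      g.inner_deriv_normal_normal, mul_zero, sub_zero]
    simp only [inner_smul_right, hΓdef, ha]
  rw [g.fderivWithin_wedgeField hζ]
  simp only [inner_add_right, inner_sub_right, inner_smul_right]
  rw [hd1, hd1, hd2, hd2]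
  simp only [ha, hC, hΓdef]
  ring

omit g in
/-- The mean curvature in the coordinate frame. -/
lemma sum_inner_shape_bvec :
    ∑ b, ⟪fderivWithin ℝ N s x (leftInv (L x) (bvec b)), bvec b⟫_ℝ
      = ∑ i, ⟪fderivWithin ℝ N s x (bvec i), dualVec (L x) i⟫_ℝ := by
  have h1 : ∀ b : Fin (n + 1), ⟪fderivWithin ℝ N s x (leftInv (L x) (bvec b)), bvec b⟫_ℝ
      = ∑ i, dualVec (L x) i b * fderivWithin ℝ N s x (bvec i) b := fun b => by
    rw [leftInv_eq_sum, map_sum, sum_inner]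
    refine Finset.sum_congr rfl fun i _ => ?_
    rw [map_smul, inner_smul_left, RCLike.conj_to_real, real_inner_comm,
      inner_single_one_left, real_inner_comm, inner_single_one_left]
  simp_rw [h1]
  rw [Finset.sum_comm]
  refine Finset.sum_congr rfl fun i _ => ?_
  rw [inner_eq_sum_coord]
  exact Finset.sum_congr rfl fun b _ => mul_comm _ _

/-- The square of the second fundamental form in the coordinate frame. -/
lemma sum_sq_inner_shape_bvec :
    ∑ b, ∑ b', ⟪fderivWithin ℝ N s x (leftInv (L x) (bvec b)), bvec b'⟫_ℝ ^ 2
      = ∑ i, ∑ j, ⟪fderivWithin ℝ N s x (bvec i), dualVec (L x) j⟫_ℝ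
          * ⟪fderivWithin ℝ N s x (bvec j), dualVec (L x) i⟫_ℝ := by
  have h1 : ∀ b : Fin (n + 1),
      ∑ b', ⟪fderivWithin ℝ N s x (leftInv (L x) (bvec b)), bvec b'⟫_ℝ ^ 2
      = ∑ i, ∑ j, dualVec (L x) i b * (⟪fderivWithin ℝ N s x (bvec i), dualVec (L x) j⟫_ℝ
        * fderivWithin ℝ N s x (bvec j) b) := fun b => by
    -- Symmetry of the shape operator `S` turns the sum of squares into the trace of `S ∘ S`, which
    -- can then be computed in the coordinate frame.
    have e1 : ∑ b', ⟪fderivWithin ℝ N s x (leftInv (L x) (bvec b)), bvec b'⟫_ℝ ^ 2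
        = ∑ b', fderivWithin ℝ N s x (leftInv (L x) (bvec b)) b'
          * ⟪fderivWithin ℝ N s x (leftInv (L x) (bvec b')), bvec b⟫_ℝ := by
      refine Finset.sum_congr rfl fun b' _ => ?_
      rw [sq, g.inner_shape_symm (bvec b') (bvec b)]
      congr 1
      rw [real_inner_comm, inner_single_one_left]
    have e2 : ∑ b', fderivWithin ℝ N s x (leftInv (L x) (bvec b)) b'
          * ⟪fderivWithin ℝ N s x (leftInv (L x) (bvec b')), bvec b⟫_ℝ
        = ⟪fderivWithin ℝ N s x (leftInv (L x)
            (fderivWithin ℝ N s x (leftInv (L x) (bvec b)))), bvec b⟫_ℝ := by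
      conv_rhs => rw [← sum_coord_smul_bvec (fderivWithin ℝ N s x (leftInv (L x) (bvec b)))]
      simp only [map_sum, map_smul, sum_inner, inner_smul_left, RCLike.conj_to_real]
    rw [e1, e2, real_inner_comm, inner_single_one_left]
    rw [leftInv_eq_sum (L x) (bvec b)]
    simp only [map_sum, map_smul, WithLp.ofLp_sum, Finset.sum_apply, PiLp.smul_apply, smul_eq_mul]
    refine Finset.sum_congr rfl fun i _ => ?_
    rw [leftInv_eq_sum (L x) (fderivWithin ℝ N s x (bvec i))]
    simp only [map_sum, map_smul, WithLp.ofLp_sum, Finset.sum_apply, PiLp.smul_apply, smul_eq_mul]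
    rw [Finset.mul_sum]
    refine Finset.sum_congr rfl fun j _ => ?_
    rw [real_inner_comm, inner_single_one_left, real_inner_comm]
  simp_rw [h1]
  rw [Finset.sum_comm]
  refine Finset.sum_congr rfl fun i _ => ?_
  rw [Finset.sum_comm]
  refine Finset.sum_congr rfl fun j _ => ?_
  rw [inner_eq_sum_coord (fderivWithin ℝ N s x (bvec j)), Finset.mul_sum]
  exact Finset.sum_congr rfl fun b _ => by ring

/-- The inner product of the gradients of a function and of a component of the normal. -/
lemma sum_gradient_mul_shape (T : E n →L[ℝ] ℝ) (c : E (n + 1)) :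
    ∑ b, T (leftInv (L x) (bvec b)) * ⟪fderivWithin ℝ N s x (leftInv (L x) (bvec b)), c⟫_ℝ
      = ∑ i, ∑ j, T (bvec j) *
        (⟪c, dualVec (L x) i⟫_ℝ * ⟪fderivWithin ℝ N s x (bvec i), dualVec (L x) j⟫_ℝ) := by
  have e1 : ∑ b, T (leftInv (L x) (bvec b))
        * ⟪fderivWithin ℝ N s x (leftInv (L x) (bvec b)), c⟫_ℝ
      = T (leftInv (L x) (fderivWithin ℝ N s x (leftInv (L x) c))) := by
    conv_rhs => rw [← sum_coord_smul_bvec (fderivWithin ℝ N s x (leftInv (L x) c))]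
    simp only [map_sum, map_smul, smul_eq_mul]
    refine Finset.sum_congr rfl fun b _ => ?_
    rw [g.inner_shape_symm, mul_comm]
    congr 1
    rw [real_inner_comm, inner_single_one_left]
  rw [e1, leftInv_eq_sum (L x) c]
  simp only [map_sum, map_smul, smul_eq_mul]
  refine Finset.sum_congr rfl fun i _ => ?_
  rw [leftInv_eq_sum (L x) (fderivWithin ℝ N s x (bvec i))]
  simp only [map_sum, map_smul, smul_eq_mul]
  rw [Finset.mul_sum]
  refine Finset.sum_congr rfl fun j _ => ?_
  rw [real_inner_comm c, real_inner_comm (fderivWithin ℝ N s x (bvec i))]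
  ring

end HypersurfaceGerm

end LocalJacobi

/-! ### The weak Jacobi equation in a chart. -/

section LocalJacobiIntegral

variable {n : ℕ} [NeZero n]

omit [NeZero n] in
lemma exists_cutoff {K O : Set (E n)} (hK : IsCompact K) (hO : IsOpen O) (hKO : K ⊆ O) :
    ∃ χ : E n → ℝ, ContDiff ℝ ∞ χ ∧ (∀ᶠ x in 𝓝ˢ K, χ x = 1) ∧
      ∃ K' ⊆ O, IsCompact K' ∧ ∀ x ∉ K', χ x = 0 := by
  obtain ⟨K', hK', hKK', hK'O⟩ := exists_compact_between hK hO hKO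
  obtain ⟨f, hf1, hf0, -⟩ := exists_contMDiffMap_one_nhds_of_subset_interior (n := ⊤)
    𝓘(ℝ, E n) hK.isClosed hKK'
  exact ⟨f, f.contMDiff.contDiff, hf1, K', hK'O, hK', hf0⟩

/-- A function that is `C¹` on `O` within the half-space and vanishes off a compact subset of `O`
is `C¹` on the half-space. -/
lemma contDiffOn_of_support {F : Type*} [NormedAddCommGroup F] [NormedSpace ℝ F] {z : E n → F}
    {K O : Set (E n)} {m : WithTop ℕ∞} (hK : IsClosed K) (hKO : K ⊆ O)
    (hz : ∀ x ∈ O ∩ modelHalf n, ContDiffWithinAt ℝ m z (modelHalf n) x)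
    (h0 : ∀ x ∉ K, z x = 0) : ContDiffOn ℝ m z (modelHalf n) := by
  intro x hx
  by_cases hxK : x ∈ K
  · exact hz x ⟨hKO hxK, hx⟩
  · have h1 : z =ᶠ[𝓝[modelHalf n] x] fun _ => 0 :=
      Filter.mem_of_superset (mem_nhdsWithin_of_mem_nhds (hK.isOpen_compl.mem_nhds hxK)) h0
    exact contDiffWithinAt_const.congr_of_eventuallyEq h1 (h0 x hxK)

/-- The weak Jacobi equation for the components of the unit normal, in a chart. -/
lemma integral_local_jacobi {L : E n → E n →L[ℝ] E (n + 1)} {N : E n → E (n + 1)}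
    {O K : Set (E n)} (hO : IsOpen O) (hK : IsCompact K) (hKO : K ⊆ O)
    (g : ∀ x ∈ O ∩ modelHalf n, HypersurfaceGerm L N (modelHalf n) x)
    (hmin : ∀ x ∈ K ∩ modelHalf n,
      ∑ b, ⟪fderivWithin ℝ N (modelHalf n) x (leftInv (L x) (bvec b)), bvec b⟫_ℝ = 0)
    {ζ : E n → ℝ} (hζ : ContDiffOn ℝ 1 ζ (modelHalf n)) (hζ0 : ∀ x ∉ K, ζ x = 0)
    (c : E (n + 1)) :
    ∫ x in modelHalf n, jacobian (L x) *
        ((∑ b, fderivWithin ℝ ζ (modelHalf n) x (leftInv (L x) (bvec b))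
          * ⟪fderivWithin ℝ N (modelHalf n) x (leftInv (L x) (bvec b)), c⟫_ℝ)
        - (∑ b, ∑ b', ⟪fderivWithin ℝ N (modelHalf n) x (leftInv (L x) (bvec b)), bvec b'⟫_ℝ ^ 2)
          * (⟪c, N x⟫_ℝ * ζ x))
      = -∫ y, ζ (faceIncl n y) * jacobian (L (faceIncl n y)) *
          ⟪fderivWithin ℝ N (modelHalf n) (faceIncl n y) (leftInv (L (faceIncl n y)) c),
            dualVec (L (faceIncl n y)) 0⟫_ℝ := by
  obtain ⟨χ, hχ, hχ1, K', hK'O, hK', hχ0⟩ := exists_cutoff hK hO hKO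
  -- The normal is defined near `K` only. The cutoff is `1` near `K`, so it changes neither `N` nor
  -- its derivative on the support of the test field.
  set N₁ : E n → E (n + 1) := fun x => χ x • N x with hN₁
  have hN₁c : ContDiffOn ℝ 1 N₁ (modelHalf n) :=
    contDiffOn_of_support hK'.isClosed hK'O
      (fun x hx => ((hχ.of_le (by simp)).contDiffWithinAt).smul (g x hx).contDiff_normal)
      fun x hx => by simp [hN₁, hχ0 x hx]
  have hN₁0 : ∀ x ∉ K', N₁ x = 0 := fun x hx => by simp [hN₁, hχ0 x hx]
  have hN₁d : ∀ x ∈ K ∩ modelHalf n,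
      fderivWithin ℝ N₁ (modelHalf n) x = fderivWithin ℝ N (modelHalf n) x := fun x hx => by
    have h1 : ∀ᶠ y in 𝓝 x, χ y = 1 := Filter.Eventually.filter_mono (nhds_le_nhdsSet hx.1) hχ1
    refine Filter.EventuallyEq.fderivWithin_eq (h1.filter_mono nhdsWithin_le_nhds |>.mono
      fun y hy => ?_) ?_
    · simp [hN₁, hy]
    · simp [hN₁, h1.self_of_nhds]
  set Z := wedgeField L ζ c with hZ
  have hZ0 : ∀ i j, ∀ x ∉ K, Z i j x = 0 := fun i j x hx => by
    simp [hZ, wedgeField, hζ0 x hx]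
  have hZc : ∀ i j, ContDiffOn ℝ 1 (Z i j) (modelHalf n) := fun i j =>
    contDiffOn_of_support hK.isClosed hKO
      (fun x hx => (g x hx).contDiffWithinAt_wedgeField (hζ x hx.2) c i j) (hZ0 i j)
  have key := sum_integral_inner_fderivWithin hK' hN₁c hN₁0 hK hZc hZ0
    (wedgeField_swap L ζ c)
  have hint : ∀ i j, IntegrableOn (fun x => ⟪fderivWithin ℝ N₁ (modelHalf n) x (bvec i),
      fderivWithin ℝ (Z i j) (modelHalf n) x (bvec j)⟫_ℝ) (modelHalf n) := fun i j => by
    refine integrableOn_of_continuousOn hK ((continuousOn_fderivWithin_apply hN₁c _).inner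
      (continuousOn_fderivWithin_apply (hZc i j) _)) fun x hx => ?_
    rw [fderivWithin_eq_zero_of_notMem hK.isClosed (hZ0 i j) hx]
    simp
  have hL : ∑ i, ∑ j, ∫ x in modelHalf n, ⟪fderivWithin ℝ N₁ (modelHalf n) x (bvec i),
        fderivWithin ℝ (Z i j) (modelHalf n) x (bvec j)⟫_ℝ
      = ∫ x in modelHalf n, jacobian (L x) *
        ((∑ b, fderivWithin ℝ ζ (modelHalf n) x (leftInv (L x) (bvec b))
          * ⟪fderivWithin ℝ N (modelHalf n) x (leftInv (L x) (bvec b)), c⟫_ℝ)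
        - (∑ b, ∑ b', ⟪fderivWithin ℝ N (modelHalf n) x (leftInv (L x) (bvec b)), bvec b'⟫_ℝ ^ 2)
          * (⟪c, N x⟫_ℝ * ζ x)) := by
    simp_rw [← integral_finsetSum _ fun j _ => hint _ j]
    rw [← integral_finsetSum _ fun i _ => integrable_finsetSum _ fun j _ => hint i j]
    refine setIntegral_congr_fun measurableSet_modelHalf fun x hx => ?_
    by_cases hxK : x ∈ K
    · have gx := g x ⟨hKO hxK, hx⟩
      rw [hN₁d x ⟨hxK, hx⟩,
        gx.sum_inner_fderivWithin_wedgeField (hζ.differentiableOn one_ne_zero x hx) c,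
        gx.sum_gradient_mul_shape, gx.sum_sq_inner_shape_bvec,
        ← HypersurfaceGerm.sum_inner_shape_bvec, hmin x ⟨hxK, hx⟩]
      -- The second half of the antisymmetric field produces the mean curvature as a factor, which
      -- is zero here.
      have h1 : ∑ i, ∑ j, fderivWithin ℝ ζ (modelHalf n) x (bvec j) *
          (⟪c, dualVec (L x) i⟫_ℝ
            * ⟪fderivWithin ℝ N (modelHalf n) x (bvec i), dualVec (L x) j⟫_ℝ
            - ⟪c, dualVec (L x) j⟫_ℝ
              * ⟪fderivWithin ℝ N (modelHalf n) x (bvec i), dualVec (L x) i⟫_ℝ)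
          = ∑ i, ∑ j, fderivWithin ℝ ζ (modelHalf n) x (bvec j) *
          (⟪c, dualVec (L x) i⟫_ℝ
            * ⟪fderivWithin ℝ N (modelHalf n) x (bvec i), dualVec (L x) j⟫_ℝ) := by
        have h2 : ∑ i, ∑ j, fderivWithin ℝ ζ (modelHalf n) x (bvec j) * (⟪c, dualVec (L x) j⟫_ℝ
              * ⟪fderivWithin ℝ N (modelHalf n) x (bvec i), dualVec (L x) i⟫_ℝ) = 0 := by
          rw [Finset.sum_comm]
          refine Finset.sum_eq_zero fun j _ => ?_
          simp_rw [← mul_assoc]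
          rw [← Finset.mul_sum, ← HypersurfaceGerm.sum_inner_shape_bvec, hmin x ⟨hxK, hx⟩, mul_zero]
        simp_rw [mul_sub, Finset.sum_sub_distrib]
        rw [h2, sub_zero]
      rw [h1]
      ring
    · rw [fderivWithin_eq_zero_of_notMem hK.isClosed hζ0 hxK, hζ0 x hxK]
      simp only [zero_apply, zero_mul, Finset.sum_const_zero, mul_zero, sub_zero]
      refine Finset.sum_eq_zero fun i _ => Finset.sum_eq_zero fun j _ => ?_
      rw [fderivWithin_eq_zero_of_notMem hK.isClosed (hZ0 i j) hxK]
      simp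
  rw [← hL, key, ← integral_finsetSum]
  · congr 2
    ext y
    by_cases hy : faceIncl n y ∈ K
    · have gx := g _ ⟨hKO hy, faceIncl_mem y⟩
      rw [hN₁d _ ⟨hy, faceIncl_mem y⟩]
      simp only [hZ, wedgeField, inner_smul_right, inner_sub_right]
      rw [← Finset.mul_sum, Finset.sum_sub_distrib]
      congr 1
      rw [← Finset.mul_sum, ← HypersurfaceGerm.sum_inner_shape_bvec,
        hmin _ ⟨hy, faceIncl_mem y⟩, mul_zero, sub_zero, leftInv_eq_sum _ c, map_sum, sum_inner]
      refine Finset.sum_congr rfl fun i _ => ?_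
      rw [map_smul, inner_smul_left, real_inner_comm c, RCLike.conj_to_real]
    · rw [hζ0 _ hy, zero_mul, zero_mul]
      exact Finset.sum_eq_zero fun i _ => by rw [hZ0 i 0 _ hy, inner_zero_right]
  · intro i _
    exact integrable_comp_faceIncl (w := fun x =>
      ⟪fderivWithin ℝ N₁ (modelHalf n) x (bvec i), Z i 0 x⟫_ℝ) hK
      ((continuousOn_fderivWithin_apply hN₁c _).inner (hZc i 0).continuousOn)
      fun x hx => by simp [hZ0 i 0 x hx]

end LocalJacobiIntegral

/-! ### Passing between the manifold and its charts. -/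

section Charts

variable {n : ℕ} [NeZero n] {M : Type*} [TopologicalSpace M] [ChartedSpace (EuclideanHalfSpace n) M]

/-- The extended chart at `p`. -/
abbrev chart (n : ℕ) [NeZero n] {M : Type*} [TopologicalSpace M]
    [ChartedSpace (EuclideanHalfSpace n) M] (p : M) : PartialEquiv M (E n) :=
  extChartAt (𝓡∂ n) p

lemma exists_isOpen_chart_target (p : M) :
    ∃ O : Set (E n), IsOpen O ∧ (chart n p).target = O ∩ modelHalf n := by
  refine ⟨(𝓡∂ n).symm ⁻¹' (chartAt (EuclideanHalfSpace n) p).target,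
    (chartAt (EuclideanHalfSpace n) p).open_target.preimage (𝓡∂ n).continuous_symm, ?_⟩
  rw [← range_model_eq]
  exact extChartAt_target (𝓡∂ n) p

lemma chart_target_subset (p : M) : (chart n p).target ⊆ modelHalf n := by
  rw [← range_model_eq]; exact extChartAt_target_subset_range p

lemma chart_target_mem_nhdsWithin {p : M} {x : E n} (hx : x ∈ (chart n p).target) :
    (chart n p).target ∈ 𝓝[modelHalf n] x := by
  rw [← range_model_eq]; exact extChartAt_target_mem_nhdsWithin_of_mem hx

lemma measurableSet_chart_target (p : M) : MeasurableSet (chart n p).target := by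
  obtain ⟨O, hO, h⟩ := exists_isOpen_chart_target (n := n) p
  rw [h]; exact hO.measurableSet.inter measurableSet_modelHalf

variable [IsManifold (𝓡∂ n) 2 M]

lemma isManifold_one : IsManifold (𝓡∂ n) 1 M := IsManifold.of_le (m := 1) (n := 2) (by norm_num)

variable {F : Type*} [NormedAddCommGroup F] [NormedSpace ℝ F]

lemma contDiffWithinAt_comp_chart_symm {m : WithTop ℕ∞} (hm : m ≤ 2) {f : M → F}
    (hf : ContMDiff (𝓡∂ n) 𝓘(ℝ, F) m f) {p : M} {x : E n} (hx : x ∈ (chart n p).target) :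
    ContDiffWithinAt ℝ m (f ∘ (chart n p).symm) (modelHalf n) x := by
  have h1 : ContMDiffOn 𝓘(ℝ, E n) 𝓘(ℝ, F) m (f ∘ (chart n p).symm) (chart n p).target :=
    hf.comp_contMDiffOn ((contMDiffOn_extChartAt_symm (n := 2) p).of_le hm)
  have h2 := (contMDiffOn_iff_contDiffOn.1 h1) x hx
  exact h2.mono_of_mem_nhdsWithin (chart_target_mem_nhdsWithin hx)

/-- The differential of the chart at `p` in the point `q`, as an endomorphism of the model space. -/
def chartDiff (p q : M) : E n →L[ℝ] E n := mfderiv (𝓡∂ n) 𝓘(ℝ, E n) (chart n p) q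

lemma exists_equiv_chartDiff {p q : M} (hq : q ∈ (chart n p).source) :
    ∃ T : E n ≃L[ℝ] E n, (T : E n →L[ℝ] E n) = chartDiff p q := by
  have : IsManifold (𝓡∂ n) 1 M := isManifold_one
  exact isInvertible_mfderiv_extChartAt (I := 𝓡∂ n) hq

lemma mdifferentiableAt_of_comp_chart_symm {f : M → F} {p q : M} (hq : q ∈ (chart n p).source)
    (hf : DifferentiableWithinAt ℝ (f ∘ (chart n p).symm) (modelHalf n) (chart n p q)) :
    MDifferentiableAt (𝓡∂ n) 𝓘(ℝ, F) f q := by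
  have : IsManifold (𝓡∂ n) 1 M := isManifold_one
  rw [← range_model_eq] at hf
  have hψ : MDifferentiableAt (𝓡∂ n) 𝓘(ℝ, E n) (chart n p) q :=
    mdifferentiableAt_extChartAt (by rwa [extChartAt_source] at hq)
  have h1 : MDifferentiableWithinAt (𝓡∂ n) 𝓘(ℝ, F) ((f ∘ (chart n p).symm) ∘ chart n p)
      (chart n p).source q :=
    hf.mdifferentiableWithinAt.comp q hψ.mdifferentiableWithinAt
      fun z hz => extChartAt_target_subset_range p ((chart n p).map_source hz)
  have h2 := h1.mdifferentiableAt (extChartAt_source_mem_nhds' hq)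
  refine h2.congr_of_eventuallyEq ?_
  filter_upwards [extChartAt_source_mem_nhds' (I := 𝓡∂ n) hq] with z hz
  simp only [Function.comp]
  rw [(chart n p).left_inv hz]

/-- No differentiability is assumed: the chart is invertible to first order, so `f` and its chart
expression are differentiable together, and otherwise both derivatives have the default value zero.
-/
lemma mfderiv_eq_fderivWithin_comp (f : M → F) {p q : M} (hq : q ∈ (chart n p).source) :
    (mfderiv (𝓡∂ n) 𝓘(ℝ, F) f q : E n →L[ℝ] F)
      = fderivWithin ℝ (f ∘ (chart n p).symm) (modelHalf n) (chart n p q) ∘L chartDiff p q := by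
  have : IsManifold (𝓡∂ n) 1 M := isManifold_one
  have hx := (chart n p).map_source hq
  by_cases hf : MDifferentiableAt (𝓡∂ n) 𝓘(ℝ, F) f q
  · have h1 : mfderivWithin 𝓘(ℝ, E n) 𝓘(ℝ, F) (f ∘ (chart n p).symm) (range (𝓡∂ n)) (chart n p q)
        = (mfderiv (𝓡∂ n) 𝓘(ℝ, F) f ((chart n p).symm (chart n p q))).comp
          (mfderivWithin 𝓘(ℝ, E n) (𝓡∂ n) (chart n p).symm (range (𝓡∂ n)) (chart n p q)) := by
      refine mfderiv_comp_mfderivWithin _ ?_ (mdifferentiableWithinAt_extChartAt_symm hx) ?_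
      · rw [(chart n p).left_inv hq]; exact hf
      · exact (𝓡∂ n).uniqueMDiffOn _ (extChartAt_target_subset_range p hx)
    have h2 := mfderivWithin_extChartAt_symm_comp_mfderiv_extChartAt' (I := 𝓡∂ n) hq
    have h3 : fderivWithin ℝ (f ∘ (chart n p).symm) (modelHalf n) (chart n p q)
        = mfderivWithin 𝓘(ℝ, E n) 𝓘(ℝ, F) (f ∘ (chart n p).symm) (range (𝓡∂ n)) (chart n p q) := by
      rw [mfderivWithin_eq_fderivWithin, range_model_eq]
    refine ContinuousLinearMap.ext fun v : E n => ?_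
    have h4 := congrArg (fun T : E n →L[ℝ] F => T (chartDiff p q v)) (h3.trans h1)
    have h5 := congrArg (fun T : E n →L[ℝ] E n => T v) h2
    refine Eq.trans ?_ h4.symm
    change _ = (mfderiv (𝓡∂ n) 𝓘(ℝ, F) f ((chart n p).symm (chart n p q)) : E n →L[ℝ] F)
      ((mfderivWithin 𝓘(ℝ, E n) (𝓡∂ n) (chart n p).symm (range (𝓡∂ n)) (chart n p q) :
        E n →L[ℝ] E n) (chartDiff p q v))
    have h6 : (mfderivWithin 𝓘(ℝ, E n) (𝓡∂ n) (chart n p).symm (range (𝓡∂ n)) (chart n p q) :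
        E n →L[ℝ] E n) (chartDiff p q v) = v := h5
    rw [h6, (chart n p).left_inv hq]
  · have h1 : ¬ DifferentiableWithinAt ℝ (f ∘ (chart n p).symm) (modelHalf n) (chart n p q) :=
      fun h => hf (mdifferentiableAt_of_comp_chart_symm hq h)
    rw [fderivWithin_zero_of_not_differentiableWithinAt h1, mfderiv_zero_of_not_mdifferentiableAt hf,
      ContinuousLinearMap.zero_comp]
    rfl

omit [IsManifold (𝓡∂ n) 2 M] in
lemma chartDeriv_eq (ι : M → E (n + 1)) (p : M) :
    chartDeriv ι p = fderivWithin ℝ (ι ∘ (chart n p).symm) (modelHalf n) := by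
  ext1 x; rw [chartDeriv, range_model_eq]

lemma diff_eq_chartDeriv_comp (ι : M → E (n + 1)) {p q : M} (hq : q ∈ (chart n p).source) :
    diff n ι q = chartDeriv ι p (chart n p q) ∘L chartDiff p q := by
  rw [chartDeriv_eq]
  exact mfderiv_eq_fderivWithin_comp ι hq

lemma injective_chartDeriv {ι : M → E (n + 1)} (hι : ∀ p, Function.Injective (diff n ι p))
    {p q : M} (hq : q ∈ (chart n p).source) :
    Function.Injective (chartDeriv ι p (chart n p q)) := by
  obtain ⟨T, hT⟩ := exists_equiv_chartDiff (n := n) hq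
  have h := hι q
  rw [diff_eq_chartDeriv_comp ι hq, ← hT] at h
  intro u v huv
  have := @h (T.symm u) (T.symm v) (by simpa using huv)
  exact T.symm.injective this

/-- Tangential derivatives may be computed in any chart. -/
lemma mfderiv_leftInv {ι : M → E (n + 1)} (hι : ∀ p, Function.Injective (diff n ι p))
    (f : M → F) {p q : M} (hq : q ∈ (chart n p).source) (v : E (n + 1)) :
    (mfderiv (𝓡∂ n) 𝓘(ℝ, F) f q : E n →L[ℝ] F) (leftInv (diff n ι q) v)
      = fderivWithin ℝ (f ∘ (chart n p).symm) (modelHalf n) (chart n p q)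
        (leftInv (chartDeriv ι p (chart n p q)) v) := by
  obtain ⟨T, hT⟩ := exists_equiv_chartDiff (n := n) hq
  rw [mfderiv_eq_fderivWithin_comp f hq, diff_eq_chartDeriv_comp ι hq, ← hT,
    leftInv_comp (injective_chartDeriv hι hq)]
  exact congrArg (fderivWithin ℝ (f ∘ (chart n p).symm) (modelHalf n) (chart n p q))
    (T.apply_symm_apply _)

/-- An immersion read in a chart satisfies the structure equations. -/
lemma hypersurfaceGerm_chart {U : Set (E (n + 1))} {ι ν : M → E (n + 1)}
    (h : IsProperTwoSidedImmersion U ι ν) {p : M} {x : E n} (hx : x ∈ (chart n p).target) :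
    HypersurfaceGerm (chartDeriv ι p) (ν ∘ (chart n p).symm) (modelHalf n) x := by
  have hxH := chart_target_subset p hx
  have hC2 := contDiffWithinAt_comp_chart_symm le_rfl h.contMDiff hx
  have hev : ∀ {P : E n → Prop}, (∀ y ∈ (chart n p).target, P y) → ∀ᶠ y in 𝓝[modelHalf n] x, P y :=
    fun hP => Filter.mem_of_superset (chart_target_mem_nhdsWithin hx) hP
  have hsrc : ∀ y ∈ (chart n p).target, (chart n p).symm y ∈ (chart n p).source :=
    fun y hy => (chart n p).map_target hy
  have hchart : ∀ y ∈ (chart n p).target, chart n p ((chart n p).symm y) = y :=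
    fun y hy => (chart n p).right_inv hy
  refine ⟨hxH, uniqueDiffOn_modelHalf x hxH, ?_, ?_, ?_, hev fun y hy => ?_, hev fun y hy v => ?_,
    hev fun y hy => h.norm_normal _⟩
  · rw [chartDeriv_eq]
    exact hC2.fderivWithin_right uniqueDiffOn_modelHalf (by norm_num) hxH
  · exact contDiffWithinAt_comp_chart_symm (by norm_num) h.contMDiff_normal hx
  · intro u v
    have hint : x ∈ closure (interior (modelHalf n)) := by
      rw [← range_model_eq]
      exact (𝓡∂ n).range_subset_closure_interior (range_model_eq (n := n) ▸ hxH)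
    have := hC2.isSymmSndFDerivWithinAt (by simp) uniqueDiffOn_modelHalf hint hxH
    rw [chartDeriv_eq]
    exact this u v
  · have := injective_chartDeriv h.injective_diff (hsrc y hy)
    rwa [hchart y hy] at this
  · obtain ⟨T, hT⟩ := exists_equiv_chartDiff (n := n) (hsrc y hy)
    have h1 := h.normal ((chart n p).symm y) (T.symm v)
    rw [diff_eq_chartDeriv_comp ι (hsrc y hy), hchart y hy, ← hT] at h1
    simpa using h1

end Charts

/-! ### Measures given by parametrizations, and their gluing. -/

section Parametrized

lemma measurableSet_inter_preimage {X Y : Type*} [TopologicalSpace X] [MeasurableSpace X]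
    [OpensMeasurableSpace X] [TopologicalSpace Y] [MeasurableSpace Y] [BorelSpace Y] {S : Set X}
    {α : X → Y} (hS : MeasurableSet S) (hα : ContinuousOn α S) {A : Set Y}
    (hA : MeasurableSet A) : MeasurableSet (S ∩ α ⁻¹' A) := by
  have h := (measurableSet_preimage (continuousOn_iff_continuous_domRestrict.1 hα).measurable hA)
  have := (MeasurableEmbedding.subtype_coe hS).measurableSet_image.2 h
  convert this using 1
  ext x; simp [Set.domRestrict, and_comm]

variable {M : Type*} [TopologicalSpace M] [MeasurableSpace M] [BorelSpace M]
  {V : Type*} [TopologicalSpace V] [MeasureSpace V] [BorelSpace V]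

/-- The measure with density `ρ` on `S`, carried to `M` by `α`. -/
def paramMeasure (S : Set V) (ρ : V → ℝ) (α : V → M) : Measure M :=
  ((volume.restrict S).withDensity fun x => ENNReal.ofReal (ρ x)).map α

variable {S : Set V} {ρ : V → ℝ} {α : V → M}

lemma aemeasurable_param (hS : MeasurableSet S) (hα : ContinuousOn α S) :
    AEMeasurable α ((volume.restrict S).withDensity fun x => ENNReal.ofReal (ρ x)) :=
  (hα.aemeasurable hS).mono_ac (withDensity_absolutelyContinuous _ _)

lemma paramMeasure_apply [SFinite (volume : Measure V)] (hS : MeasurableSet S)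
    (hα : ContinuousOn α S) {A : Set M} (hA : MeasurableSet A) :
    paramMeasure S ρ α A = ∫⁻ x in S ∩ α ⁻¹' A, ENNReal.ofReal (ρ x) := by
  rw [paramMeasure, Measure.map_apply_of_aemeasurable (aemeasurable_param hS hα) hA,
    withDensity_apply', Measure.restrict_restrict' hS, inter_comm]

lemma paramMeasure_eq_zero [SFinite (volume : Measure V)] (hS : MeasurableSet S)
    (hα : ContinuousOn α S) {A : Set M} (hA : MeasurableSet A)
    (h : volume (S ∩ α ⁻¹' A) = 0) : paramMeasure S ρ α A = 0 := by
  rw [paramMeasure_apply hS hα hA, Measure.restrict_eq_zero.2 h, lintegral_zero_measure]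

lemma paramMeasure_lt_top [SFinite (volume : Measure V)] [T2Space V]
    [IsFiniteMeasureOnCompacts (volume : Measure V)] (hS : MeasurableSet S)
    (hα : ContinuousOn α S) (hρ : ContinuousOn ρ S) {A : Set M} (hA : MeasurableSet A)
    (hK : IsCompact (S ∩ α ⁻¹' A)) : paramMeasure S ρ α A < ⊤ := by
  rw [paramMeasure_apply hS hα hA]
  have h := (hρ.mono inter_subset_left).integrableOn_compact hK (μ := volume)
  exact h.lintegral_lt_top

lemma integral_paramMeasure (hS : MeasurableSet S) (hα : ContinuousOn α S)
    (hρ : ContinuousOn ρ S) (hρ0 : ∀ x, 0 ≤ ρ x) {f : M → ℝ}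
    (hf : AEStronglyMeasurable f (paramMeasure S ρ α)) :
    ∫ z, f z ∂(paramMeasure S ρ α) = ∫ x in S, ρ x * f (α x) := by
  rw [paramMeasure, integral_map (aemeasurable_param hS hα) hf,
    integral_withDensity_eq_integral_toReal_smul₀ (hρ.aemeasurable hS).ennreal_ofReal
      (Filter.Eventually.of_forall fun _ => ENNReal.ofReal_lt_top)]
  simp_rw [ENNReal.toReal_ofReal (hρ0 _), smul_eq_mul]

/-- Change of variables between two parametrizations. -/
lemma paramMeasure_eq_of_transition {V : Type*} [NormedAddCommGroup V] [NormedSpace ℝ V]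
    [FiniteDimensional ℝ V] [MeasureSpace V] [BorelSpace V]
    [(volume : Measure V).IsAddHaarMeasure] {S S' : Set V} {ρ ρ' : V → ℝ} {α α' : V → M}
    (hS : MeasurableSet S) (hS' : MeasurableSet S') (hα : ContinuousOn α S)
    (hα' : ContinuousOn α' S') (hinj : InjOn α S)
    {A : Set M} (hA : MeasurableSet A) {τ τi : V → V} {τ' : V → V →L[ℝ] V}
    (hτ : ∀ x ∈ S ∩ α ⁻¹' A, τ x ∈ S' ∧ α' (τ x) = α x)
    (hτi : ∀ x ∈ S' ∩ α' ⁻¹' A, τi x ∈ S ∧ τ (τi x) = x)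
    (hd : ∀ x ∈ S ∩ α ⁻¹' A, HasFDerivWithinAt τ (τ' x) (S ∩ α ⁻¹' A) x)
    (hρ : ∀ x ∈ S ∩ α ⁻¹' A, ρ x = |(τ' x).det| * ρ' (τ x))
    (hααi : ∀ x ∈ S' ∩ α' ⁻¹' A, α (τi x) = α' x) :
    paramMeasure S ρ α A = paramMeasure S' ρ' α' A := by
  have hm := measurableSet_inter_preimage hS hα hA
  have himg : τ '' (S ∩ α ⁻¹' A) = S' ∩ α' ⁻¹' A := by
    ext x
    constructor
    · rintro ⟨z, hz, rfl⟩
      exact ⟨(hτ z hz).1, by change α' (τ z) ∈ A; rw [(hτ z hz).2]; exact hz.2⟩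
    · intro hx
      exact ⟨τi x, ⟨(hτi x hx).1, by change α (τi x) ∈ A; rw [hααi x hx]; exact hx.2⟩,
        (hτi x hx).2⟩
  have hτinj : InjOn τ (S ∩ α ⁻¹' A) := by
    intro x hx y hy hxy
    refine hinj hx.1 hy.1 ?_
    rw [← (hτ x hx).2, ← (hτ y hy).2, hxy]
  rw [paramMeasure_apply hS hα hA, paramMeasure_apply hS' hα' hA, ← himg,
    lintegral_image_eq_lintegral_abs_det_fderiv_mul volume hm hd hτinj]
  refine setLIntegral_congr_fun hm fun x hx => ?_
  rw [hρ x hx, ENNReal.ofReal_mul (abs_nonneg _)]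

end Parametrized

section Gluing

variable {M : Type*} [MeasurableSpace M] {J : Type*}

/-- The supremum of a compatible family of measures restricts to each of them. -/
lemma restrict_iSup_of_compatible {μ : J → Measure M} {X : J → Set M}
    (hX : ∀ p, MeasurableSet (X p)) (h0 : ∀ p, μ p (X p)ᶜ = 0)
    (hc : ∀ p q A, MeasurableSet A → A ⊆ X p ∩ X q → μ q A = μ p A) (p : J) :
    (⨆ q, μ q).restrict (X p) = μ p := by
  have hr : (μ p).restrict (X p) = μ p := Measure.restrict_eq_self_of_ae_mem (by
    rw [ae_iff]; exact h0 p)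
  refine le_antisymm ?_ ?_
  · have hle : (⨆ q, μ q) ≤ μ p + (⨆ q, μ q).restrict (X p)ᶜ := by
      refine iSup_le fun q => Measure.le_iff.2 fun A hA => ?_
      have h1 : μ q (A ∩ X p) ≤ μ p A := by
        have h2 : μ q (A ∩ X p) ≤ μ q (A ∩ X p ∩ X q) + μ q (X q)ᶜ := by
          refine (measure_mono fun z hz => ?_).trans (measure_union_le _ _)
          by_cases hq : z ∈ X q
          · exact Or.inl ⟨hz, hq⟩
          · exact Or.inr hq
        rw [h0 q, add_zero, hc p q _ ((hA.inter (hX p)).inter (hX q))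
          (fun z hz => ⟨hz.1.2, hz.2⟩)] at h2
        exact h2.trans (measure_mono fun z hz => hz.1.1)
      have h2 : μ q (A ∩ (X p)ᶜ) ≤ (⨆ q, μ q).restrict (X p)ᶜ A := by
        rw [Measure.restrict_apply hA]
        exact Measure.le_iff'.1 (le_iSup μ q) _
      calc μ q A ≤ μ q (A ∩ X p) + μ q (A ∩ (X p)ᶜ) := by
            rw [← sdiff_eq_compl_inter.trans (inter_comm _ _)]
            exact measure_le_inter_add_sdiff _ _ _
        _ ≤ _ := add_le_add h1 h2
    calc (⨆ q, μ q).restrict (X p) ≤ (μ p + (⨆ q, μ q).restrict (X p)ᶜ).restrict (X p) :=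
          Measure.restrict_mono_measure hle _
      _ = μ p := by
          rw [Measure.restrict_add, hr, Measure.restrict_restrict (hX p), inter_compl_self,
            Measure.restrict_empty, add_zero]
  · calc μ p = (μ p).restrict (X p) := hr.symm
      _ ≤ _ := Measure.restrict_mono_measure (le_iSup μ p) _

end Gluing

/-! ### The boundary and the transition maps in charts. -/

section BoundaryCharts

variable {n : ℕ} [NeZero n] {M : Type*} [TopologicalSpace M] [ChartedSpace (EuclideanHalfSpace n) M]
  [IsManifold (𝓡∂ n) 2 M]

/-- The boundary of `M` is the zero set of the coordinate of index `0` of any chart. -/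
lemma mem_boundary_iff_chart {p z : M} (hz : z ∈ (chart n p).source) :
    z ∈ (𝓡∂ n).boundary M ↔ chart n p z 0 = 0 := by
  have hz' : z ∈ (chartAt (EuclideanHalfSpace n) p).source := by rwa [extChartAt_source] at hz
  have h := (𝓡∂ n).isInteriorPoint_iff_of_mem_atlas (n := 2) (by norm_num)
    (chart_mem_atlas (EuclideanHalfSpace n) p) hz'
  obtain ⟨O, hO, hOt⟩ := exists_isOpen_chart_target (n := n) p
  have hm := (chart n p).map_source hz
  have hint : interior (chart n p).target = O ∩ {y | 0 < y 0} := by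
    rw [hOt, interior_inter, hO.interior_eq, ← range_model_eq,
      interior_range_modelWithCornersEuclideanHalfSpace]
  have h0 : 0 ≤ chart n p z 0 := (mem_modelHalf).1 (chart_target_subset p hm)
  have h1 : chart n p z ∈ interior (chart n p).target ↔ 0 < chart n p z 0 := by
    rw [hint]
    exact ⟨fun h => h.2, fun h => ⟨(hOt ▸ hm : _ ∈ O ∩ modelHalf n).1, h⟩⟩
  have h2 : z ∈ (𝓡∂ n).boundary M ↔ ¬ (𝓡∂ n).IsInteriorPoint z := by
    rw [(𝓡∂ n).isInteriorPoint_iff_not_isBoundaryPoint, not_not]; rfl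
  rw [h2, h]
  change ¬ (chart n p z ∈ interior (chart n p).target) ↔ _
  rw [h1, not_lt]
  exact ⟨fun h => le_antisymm h h0, fun h => h.le⟩

/-- The projection of the model space to its bounding hyperplane. -/
def faceProj (n : ℕ) [NeZero n] : E n →L[ℝ] EuclideanSpace ℝ {i : Fin n // i ≠ 0} :=
  LinearMap.toContinuousLinearMap
    { toFun := fun v => WithLp.toLp 2 fun i => v i.1
      map_add' := fun _ _ => rfl
      map_smul' := fun _ _ => rfl }

lemma faceProj_apply (v : E n) (i : {i : Fin n // i ≠ 0}) : faceProj n v i = v i.1 := rfl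

lemma faceProj_faceIncl (y : EuclideanSpace ℝ {i : Fin n // i ≠ 0}) :
    faceProj n (faceIncl n y) = y := by
  ext i
  rw [faceProj_apply, faceIncl_apply, dif_pos i.2]

lemma faceIncl_faceProj {v : E n} (hv : v 0 = 0) : faceIncl n (faceProj n v) = v := by
  ext j
  rw [faceIncl_apply]
  split_ifs with h
  · rfl
  · rw [not_not.1 h, hv]

/-- The derivative of the transition from the chart at `p` to the chart at `q`. -/
lemma hasFDerivWithinAt_transition {p q z : M} (hp : z ∈ (chart n p).source)
    (hq : z ∈ (chart n q).source) :
    HasFDerivWithinAt (chart n q ∘ (chart n p).symm)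
      (fderivWithin ℝ (chart n q ∘ (chart n p).symm) (modelHalf n) (chart n p z))
      (modelHalf n) (chart n p z) := by
  refine DifferentiableWithinAt.hasFDerivWithinAt ?_
  have h := contDiffWithinAt_ext_coord_change (n := 2) (I := 𝓡∂ n) q p (y := chart n p z) (by
    rw [PartialEquiv.trans_source]
    refine ⟨(chart n p).map_source hp, ?_⟩
    change (chart n p).symm (chart n p z) ∈ (chart n q).source
    rwa [(chart n p).left_inv hp])
  rw [range_model_eq] at h
  exact h.differentiableWithinAt (by norm_num)

/-- The chain rule, obtained by comparing the two chart expressions for the differential of `ι` at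
`z` and cancelling the invertible differential of the chart at `p`. -/
lemma chartDeriv_transition (ι : M → E (n + 1)) {p q z : M} (hp : z ∈ (chart n p).source)
    (hq : z ∈ (chart n q).source) :
    chartDeriv ι p (chart n p z) = chartDeriv ι q (chart n q z) ∘L
      fderivWithin ℝ (chart n q ∘ (chart n p).symm) (modelHalf n) (chart n p z) := by
  obtain ⟨T, hT⟩ := exists_equiv_chartDiff (n := n) hp
  have h1 := (diff_eq_chartDeriv_comp ι hp).symm.trans (diff_eq_chartDeriv_comp ι hq)
  have h2 : chartDiff q z
      = fderivWithin ℝ (chart n q ∘ (chart n p).symm) (modelHalf n) (chart n p z) ∘L chartDiff p z :=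
    mfderiv_eq_fderivWithin_comp (chart n q) hp
  rw [h2, ← hT] at h1
  refine ContinuousLinearMap.ext fun v => ?_
  have h3 := congrArg (fun L : E n →L[ℝ] E (n + 1) => L (T.symm v)) h1
  simpa using h3

end BoundaryCharts

section ChartCalculus

variable {n : ℕ} [NeZero n] {M : Type*} [TopologicalSpace M] [ChartedSpace (EuclideanHalfSpace n) M]
  [IsManifold (𝓡∂ n) 2 M] {U : Set (E (n + 1))} {ι ν : M → E (n + 1)}

lemma continuousOn_chart_symm (p : M) : ContinuousOn (chart n p).symm (chart n p).target :=
  continuousOn_extChartAt_symm p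

lemma injective_chartDeriv_target (h : IsProperTwoSidedImmersion U ι ν) {p : M} {x : E n}
    (hx : x ∈ (chart n p).target) : Function.Injective (chartDeriv ι p x) :=
  (hypersurfaceGerm_chart h hx).injective_self

lemma continuousOn_jacobian_chartDeriv (h : IsProperTwoSidedImmersion U ι ν) (p : M) :
    ContinuousOn (fun x => jacobian (chartDeriv ι p x)) (chart n p).target := fun _ hx =>
  (contDiffWithinAt_jacobian (hypersurfaceGerm_chart h hx).contDiff_frame
    (injective_chartDeriv_target h hx)).continuousWithinAt.mono (chart_target_subset p)

lemma jacobian_nonneg {V W : Type*} [NormedAddCommGroup V] [InnerProductSpace ℝ V]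
    [FiniteDimensional ℝ V] [NormedAddCommGroup W] [InnerProductSpace ℝ W] [FiniteDimensional ℝ W]
    (L : V →L[ℝ] W) : 0 ≤ jacobian L := Real.sqrt_nonneg _

/-- The image of the chart at `p` in the bounding hyperplane of the model. -/
def faceTarget (n : ℕ) [NeZero n] {M : Type*} [TopologicalSpace M]
    [ChartedSpace (EuclideanHalfSpace n) M] (p : M) : Set (EuclideanSpace ℝ {i : Fin n // i ≠ 0}) :=
  faceIncl n ⁻¹' (chart n p).target

lemma isOpen_faceTarget (p : M) : IsOpen (faceTarget n p) := by
  obtain ⟨O, hO, hOt⟩ := exists_isOpen_chart_target (n := n) p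
  have : faceTarget n p = faceIncl n ⁻¹' O := by
    rw [faceTarget, hOt, preimage_inter]
    exact inter_eq_left.2 fun y _ => faceIncl_mem y
  rw [this]
  exact hO.preimage (faceIncl n).continuous

/-- The parametrization of the boundary by the chart at `p`. -/
def faceParam (n : ℕ) [NeZero n] {M : Type*} [TopologicalSpace M]
    [ChartedSpace (EuclideanHalfSpace n) M] (p : M) : EuclideanSpace ℝ {i : Fin n // i ≠ 0} → M := (chart n p).symm ∘ faceIncl n

lemma continuousOn_faceParam (p : M) : ContinuousOn (faceParam n p) (faceTarget n p) :=
  (continuousOn_chart_symm p).comp (faceIncl n).continuous.continuousOn fun _ hy => hy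

/-- The transition between two charts maps the bounding hyperplane to itself. -/
lemma transition_faceIncl_zero {p q : M} {y : EuclideanSpace ℝ {i : Fin n // i ≠ 0}}
    (hy : y ∈ faceTarget n p) (hq : faceParam n p y ∈ (chart n q).source) :
    chart n q (faceParam n p y) 0 = 0 := by
  rw [← mem_boundary_iff_chart hq]
  refine (mem_boundary_iff_chart ((chart n p).map_target hy)).2 ?_
  rw [(chart n p).right_inv hy, faceIncl_zero_coord]

lemma continuousOn_faceJacobian (h : IsProperTwoSidedImmersion U ι ν) (p : M) :
    ContinuousOn (fun y => jacobian (chartDeriv ι p (faceIncl n y) ∘L faceIncl n))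
      (faceTarget n p) := by
  have h1 : ContinuousOn (fun x => jacobian (chartDeriv ι p x) * ‖dualVec (chartDeriv ι p x) 0‖)
      (chart n p).target := fun x hx =>
    ((continuousOn_jacobian_chartDeriv h p) x hx).mul
      ((contDiffWithinAt_dualVec (hypersurfaceGerm_chart h hx).contDiff_frame
        (injective_chartDeriv_target h hx) 0).continuousWithinAt.mono
          (chart_target_subset p)).norm
  refine (h1.comp (faceIncl n).continuous.continuousOn fun _ hy => hy).congr fun y hy => ?_
  exact jacobian_comp_faceIncl (injective_chartDeriv_target h hy)

lemma chart_target_inter_preimage {p : M} {K : Set M} (hK : K ⊆ (chart n p).source) :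
    (chart n p).target ∩ (chart n p).symm ⁻¹' K = chart n p '' K := by
  ext x
  constructor
  · rintro ⟨hx, hxK⟩
    exact ⟨_, hxK, (chart n p).right_inv hx⟩
  · rintro ⟨z, hz, rfl⟩
    refine ⟨(chart n p).map_source (hK hz), ?_⟩
    rw [mem_preimage, (chart n p).left_inv (hK hz)]
    exact hz

lemma isCompact_chart_image {p : M} {K : Set M} (hK : K ⊆ (chart n p).source) (hKc : IsCompact K) :
    IsCompact (chart n p '' K) :=
  hKc.image_of_continuousOn ((continuousOn_extChartAt p).mono hK)

lemma exists_isCompact_subset_source (p : M) :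
    ∃ K ∈ 𝓝 p, IsCompact K ∧ K ⊆ (chart n p).source := by
  have : LocallyCompactSpace M := Manifold.locallyCompact_of_finiteDimensional (𝓡∂ n)
  obtain ⟨K, h1, h2, h3⟩ := local_compact_nhds (extChartAt_source_mem_nhds (I := 𝓡∂ n) p)
  exact ⟨K, h1, h3, h2⟩

end ChartCalculus

/-! ### The area measure in charts. -/

section Area

variable {n : ℕ} [NeZero n] {M : Type*} [TopologicalSpace M] [ChartedSpace (EuclideanHalfSpace n) M]
  [IsManifold (𝓡∂ n) 2 M] [MeasurableSpace M] [BorelSpace M] {U : Set (E (n + 1))}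
  {ι ν : M → E (n + 1)}

lemma measurableSet_chart_source (p : M) : MeasurableSet (chart n p).source :=
  (isOpen_extChartAt_source p).measurableSet

lemma chartArea_eq_paramMeasure (ι : M → E (n + 1)) (p : M) :
    chartArea ι p = paramMeasure (chart n p).target (fun x => jacobian (chartDeriv ι p x))
      (chart n p).symm := rfl

lemma chartArea_compl_source (ι : M → E (n + 1)) (p : M) :
    chartArea ι p (chart n p).sourceᶜ = 0 := by
  rw [chartArea_eq_paramMeasure]
  refine paramMeasure_eq_zero (measurableSet_chart_target p) (continuousOn_chart_symm p)
    (measurableSet_chart_source p).compl ?_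
  have : (chart n p).target ∩ (chart n p).symm ⁻¹' (chart n p).sourceᶜ = ∅ := by
    ext x
    simp only [mem_inter_iff, mem_preimage, mem_compl_iff, mem_empty_iff_false, iff_false, not_and,
      not_not]
    exact fun hx => (chart n p).map_target hx
  rw [this, measure_empty]

/-- Change of variables: the Jacobian `√det g` is multiplied by `|det|` of the derivative of the
transition map. -/
lemma chartArea_compatible (ι : M → E (n + 1)) (p q : M) {A : Set M} (hA : MeasurableSet A)
    (hAs : A ⊆ (chart n p).source ∩ (chart n q).source) : chartArea ι p A = chartArea ι q A := by
  rw [chartArea_eq_paramMeasure, chartArea_eq_paramMeasure]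
  have hz : ∀ x ∈ (chart n p).target ∩ (chart n p).symm ⁻¹' A,
      ∃ z ∈ (chart n p).source ∩ (chart n q).source, x = chart n p z :=
    fun x hx => ⟨(chart n p).symm x, hAs hx.2, ((chart n p).right_inv hx.1).symm⟩
  refine paramMeasure_eq_of_transition (τ := chart n q ∘ (chart n p).symm)
    (τi := chart n p ∘ (chart n q).symm)
    (τ' := fderivWithin ℝ (chart n q ∘ (chart n p).symm) (modelHalf n))
    (measurableSet_chart_target p) (measurableSet_chart_target q)
    (continuousOn_chart_symm p) (continuousOn_chart_symm q) (chart n p).symm.injOn hA ?_ ?_ ?_ ?_ ?_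
  · intro x hx
    have h2 := (hAs hx.2).2
    exact ⟨(chart n q).map_source h2, (chart n q).left_inv h2⟩
  · intro x hx
    have h2 := (hAs hx.2).1
    refine ⟨(chart n p).map_source h2, ?_⟩
    change chart n q ((chart n p).symm (chart n p ((chart n q).symm x))) = x
    rw [(chart n p).left_inv h2, (chart n q).right_inv hx.1]
  · intro x hx
    obtain ⟨z, hz, rfl⟩ := hz x hx
    exact (hasFDerivWithinAt_transition hz.1 hz.2).mono
      (inter_subset_left.trans (chart_target_subset p))
  · intro x hx
    obtain ⟨z, hz, rfl⟩ := hz x hx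
    change jacobian (chartDeriv ι p (chart n p z)) = |_| * jacobian
      (chartDeriv ι q (chart n q ((chart n p).symm (chart n p z))))
    rw [chartDeriv_transition ι hz.1 hz.2, jacobian_comp, (chart n p).left_inv hz.1]
  · intro x hx
    exact (chart n p).left_inv (hAs hx.2).1

/-- The area measure restricts to the measures given by the charts. -/
lemma area_restrict_source (ι : M → E (n + 1)) (p : M) :
    (area ι).restrict (chart n p).source = chartArea ι p :=
  restrict_iSup_of_compatible (X := fun p : M => (chart n p).source) measurableSet_chart_source
    (chartArea_compl_source ι)
    (fun p q _ hA hAs => chartArea_compatible ι q p hA fun _ hz => (hAs hz).symm) p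

/-- Integration against the area measure in a chart. -/
lemma integral_area_eq (h : IsProperTwoSidedImmersion U ι ν) (p : M) {f : M → ℝ}
    (hf : AEStronglyMeasurable f (area ι)) (h0 : ∀ z ∉ (chart n p).source, f z = 0) :
    ∫ z, f z ∂(area ι) = ∫ x in (chart n p).target,
      jacobian (chartDeriv ι p x) * f ((chart n p).symm x) := by
  rw [← setIntegral_eq_integral_of_forall_compl_eq_zero h0, area_restrict_source,
    chartArea_eq_paramMeasure]
  refine integral_paramMeasure (measurableSet_chart_target p) (continuousOn_chart_symm p)
    (continuousOn_jacobian_chartDeriv h p) (fun _ => jacobian_nonneg _) ?_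
  rw [← chartArea_eq_paramMeasure, ← area_restrict_source]
  exact hf.restrict

/-- A property that holds almost everywhere in a chart holds almost everywhere for the area. -/
lemma ae_area_of_ae_chart (ι : M → E (n + 1)) (p : M) {P : M → Prop}
    (hP : ∀ᵐ x : E n, x ∈ (chart n p).target → P ((chart n p).symm x)) :
    ∀ᵐ z ∂(area ι), z ∈ (chart n p).source → P z := by
  rw [← ae_restrict_iff' (measurableSet_chart_source p), area_restrict_source,
    chartArea_eq_paramMeasure]
  -- The exceptional set need not be measurable, so it is enlarged to a measurable null set before
  -- being carried to `M`.
  set N : Set (E n) := {x | ¬ (x ∈ (chart n p).target → P ((chart n p).symm x))} with hN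
  have hN0 : volume (toMeasurable volume N) = 0 := by rw [measure_toMeasurable]; exact hP
  have hmeas : MeasurableSet ((chart n p).source ∩ chart n p ⁻¹' toMeasurable volume N) :=
    measurableSet_inter_preimage (measurableSet_chart_source p) (continuousOn_extChartAt p)
      (measurableSet_toMeasurable _ _)
  rw [ae_iff]
  refine measure_mono_null (t := (chart n p).sourceᶜ ∪
    ((chart n p).source ∩ chart n p ⁻¹' toMeasurable volume N)) ?_ (measure_union_null ?_ ?_)
  · intro z hz
    by_cases hzs : z ∈ (chart n p).source
    · refine Or.inr ⟨hzs, subset_toMeasurable _ _ ?_⟩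
      rw [hN]
      change ¬ (_ → _)
      rw [(chart n p).left_inv hzs]
      exact fun h => hz (h ((chart n p).map_source hzs))
    · exact Or.inl hzs
  · exact chartArea_compl_source ι p
  · refine paramMeasure_eq_zero (measurableSet_chart_target p) (continuousOn_chart_symm p) hmeas
      (measure_mono_null ?_ hN0)
    intro x hx
    have h2 := hx.2.2
    change chart n p ((chart n p).symm x) ∈ toMeasurable volume N at h2
    rwa [(chart n p).right_inv hx.1] at h2

end Area

/-! ### The boundary area measure in charts. -/

section BoundaryArea

variable {n : ℕ} [NeZero n] {M : Type*} [TopologicalSpace M] [ChartedSpace (EuclideanHalfSpace n) M]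
  [IsManifold (𝓡∂ n) 2 M] [MeasurableSpace M] [BorelSpace M] {U : Set (E (n + 1))}
  {ι ν : M → E (n + 1)}

lemma chartBoundaryArea_eq_paramMeasure (ι : M → E (n + 1)) (p : M) :
    chartBoundaryArea ι p = paramMeasure (faceTarget n p)
      (fun y => jacobian (chartDeriv ι p (faceIncl n y) ∘L faceIncl n)) (faceParam n p) := rfl

lemma chartBoundaryArea_compl_source (ι : M → E (n + 1)) (p : M) :
    chartBoundaryArea ι p (chart n p).sourceᶜ = 0 := by
  rw [chartBoundaryArea_eq_paramMeasure]
  refine paramMeasure_eq_zero (isOpen_faceTarget p).measurableSet (continuousOn_faceParam p)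
    (measurableSet_chart_source p).compl ?_
  have : faceTarget n p ∩ faceParam n p ⁻¹' (chart n p).sourceᶜ = ∅ := by
    ext x
    simp only [mem_inter_iff, mem_preimage, mem_compl_iff, mem_empty_iff_false, iff_false, not_and,
      not_not]
    exact fun hx => (chart n p).map_target hx
  rw [this, measure_empty]

lemma chartBoundaryArea_compatible (ι : M → E (n + 1)) (p q : M) {A : Set M} (hA : MeasurableSet A)
    (hAs : A ⊆ (chart n p).source ∩ (chart n q).source) :
    chartBoundaryArea ι p A = chartBoundaryArea ι q A := by
  rw [chartBoundaryArea_eq_paramMeasure, chartBoundaryArea_eq_paramMeasure]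
  set D := fun x : E n => fderivWithin ℝ (chart n q ∘ (chart n p).symm) (modelHalf n) x with hD
  have hz : ∀ y ∈ faceTarget n p ∩ faceParam n p ⁻¹' (chart n q).source,
      ∃ z ∈ (chart n p).source ∩ (chart n q).source, faceIncl n y = chart n p z ∧
        faceParam n p y = z :=
    fun y hy => ⟨faceParam n p y, ⟨(chart n p).map_target hy.1, hy.2⟩,
      ((chart n p).right_inv hy.1).symm, rfl⟩
  have hopen : IsOpen (faceTarget n p ∩ faceParam n p ⁻¹' (chart n q).source) :=
    (continuousOn_faceParam p).isOpen_inter_preimage (isOpen_faceTarget p)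
      (isOpen_extChartAt_source q)
  have hsub : faceTarget n p ∩ faceParam n p ⁻¹' A ⊆ faceTarget n p ∩ faceParam n p ⁻¹' (chart n q).source :=
    fun y hy => ⟨hy.1, (hAs hy.2).2⟩
  have hder : ∀ y ∈ faceTarget n p ∩ faceParam n p ⁻¹' (chart n q).source,
      HasFDerivAt (chart n q ∘ faceParam n p) (D (faceIncl n y) ∘L faceIncl n) y := by
    intro y hy
    obtain ⟨z, hz, hyz, -⟩ := hz y hy
    have h1 := hasFDerivWithinAt_transition hz.1 hz.2
    rw [← hyz] at h1
    exact (h1.comp y ((faceIncl n).hasFDerivAt.hasFDerivWithinAt (s := univ))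
      fun w _ => faceIncl_mem w).hasFDerivAt_of_univ
  -- Along the face the coordinate of index `0` of the transition map vanishes identically. Its
  -- derivative therefore maps the face into itself and can be replaced by an endomorphism of the
  -- face, whose determinant is the change of variables factor.
  have hface : ∀ y ∈ faceTarget n p ∩ faceParam n p ⁻¹' (chart n q).source,
      D (faceIncl n y) ∘L faceIncl n
        = faceIncl n ∘L (faceProj n ∘L D (faceIncl n y) ∘L faceIncl n) := by
    intro y hy
    have h1 : HasFDerivAt (fun w => (chart n q ∘ faceParam n p) w 0)
        ((EuclideanSpace.proj (0 : Fin n) : E n →L[ℝ] ℝ) ∘L (D (faceIncl n y) ∘L faceIncl n)) y :=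
      (EuclideanSpace.proj (0 : Fin n) : E n →L[ℝ] ℝ).hasFDerivAt.comp y (hder y hy)
    have h2 : HasFDerivAt (fun w => (chart n q ∘ faceParam n p) w 0)
        (0 : EuclideanSpace ℝ {i : Fin n // i ≠ 0} →L[ℝ] ℝ) y := by
      refine (hasFDerivAt_const (0 : ℝ) y).congr_of_eventuallyEq ?_
      filter_upwards [hopen.mem_nhds hy] with w hw
      exact transition_faceIncl_zero hw.1 hw.2
    have h3 := h1.unique h2
    refine ContinuousLinearMap.ext fun v => ?_
    refine (faceIncl_faceProj ?_).symm
    exact congrArg (fun L : EuclideanSpace ℝ {i : Fin n // i ≠ 0} →L[ℝ] ℝ => L v) h3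
  refine paramMeasure_eq_of_transition (τ := faceProj n ∘ chart n q ∘ faceParam n p)
    (τi := faceProj n ∘ chart n p ∘ faceParam n q)
    (τ' := fun y => faceProj n ∘L D (faceIncl n y) ∘L faceIncl n)
    (isOpen_faceTarget p).measurableSet (isOpen_faceTarget q).measurableSet
    (continuousOn_faceParam p) (continuousOn_faceParam q) ?_ hA ?_ ?_ ?_ ?_ ?_
  · intro y hy w hw hyw
    exact isClosedEmbedding_faceIncl.injective ((chart n p).symm.injOn hy hw hyw)
  · intro y hy
    have h2 := (hAs hy.2).2
    have h3 : faceIncl n ((faceProj n ∘ chart n q ∘ faceParam n p) y) = chart n q (faceParam n p y) :=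
      faceIncl_faceProj (transition_faceIncl_zero hy.1 h2)
    constructor
    · rw [faceTarget, mem_preimage, h3]
      exact (chart n q).map_source h2
    · rw [faceParam, Function.comp_apply, h3]
      exact (chart n q).left_inv h2
  · intro y hy
    have h2 := (hAs hy.2).1
    have h3 : faceIncl n ((faceProj n ∘ chart n p ∘ faceParam n q) y) = chart n p (faceParam n q y) :=
      faceIncl_faceProj (transition_faceIncl_zero hy.1 h2)
    constructor
    · rw [faceTarget, mem_preimage, h3]
      exact (chart n p).map_source h2
    · change faceProj n (chart n q ((chart n p).symm (faceIncl n _))) = y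
      rw [h3, (chart n p).left_inv h2]
      change faceProj n (chart n q ((chart n q).symm (faceIncl n y))) = y
      rw [(chart n q).right_inv hy.1, faceProj_faceIncl]
  · intro y hy
    exact ((faceProj n).hasFDerivAt.comp y (hder y (hsub hy))).hasFDerivWithinAt
  · intro y hy
    have hy' := hsub hy
    have h3 : faceIncl n ((faceProj n ∘ chart n q ∘ faceParam n p) y) = chart n q (faceParam n p y) :=
      faceIncl_faceProj (transition_faceIncl_zero hy'.1 hy'.2)
    rw [← jacobian_comp, h3]
    obtain ⟨z, hz, hyz, hyp⟩ := hz y hy'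
    rw [ContinuousLinearMap.comp_assoc, ← hface y hy', hyz, hyp, hD,
      chartDeriv_transition ι hz.1 hz.2, ContinuousLinearMap.comp_assoc]
  · intro y hy
    have h2 := (hAs hy.2).1
    have h3 : faceIncl n ((faceProj n ∘ chart n p ∘ faceParam n q) y) = chart n p (faceParam n q y) :=
      faceIncl_faceProj (transition_faceIncl_zero hy.1 h2)
    rw [faceParam, Function.comp_apply, h3]
    exact (chart n p).left_inv h2

/-- The boundary area restricts to the measures given by the charts. -/
lemma boundaryArea_restrict_source (ι : M → E (n + 1)) (p : M) :
    (boundaryArea ι).restrict (chart n p).source = chartBoundaryArea ι p :=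
  restrict_iSup_of_compatible (X := fun p : M => (chart n p).source) measurableSet_chart_source
    (chartBoundaryArea_compl_source ι)
    (fun p q _ hA hAs => chartBoundaryArea_compatible ι q p hA fun _ hz => (hAs hz).symm) p

/-- Integration against the boundary area in a chart. -/
lemma integral_boundaryArea_eq (h : IsProperTwoSidedImmersion U ι ν) (p : M) {f : M → ℝ}
    (hf : AEStronglyMeasurable f (boundaryArea ι)) (h0 : ∀ z ∉ (chart n p).source, f z = 0) :
    ∫ z, f z ∂(boundaryArea ι) = ∫ y in faceTarget n p,
      jacobian (chartDeriv ι p (faceIncl n y)) * ‖dualVec (chartDeriv ι p (faceIncl n y)) 0‖ *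
        f (faceParam n p y) := by
  rw [← setIntegral_eq_integral_of_forall_compl_eq_zero h0, boundaryArea_restrict_source,
    chartBoundaryArea_eq_paramMeasure, integral_paramMeasure (isOpen_faceTarget p).measurableSet
    (continuousOn_faceParam p) (continuousOn_faceJacobian h p) (fun _ => jacobian_nonneg _)]
  · refine setIntegral_congr_fun (isOpen_faceTarget p).measurableSet fun y hy => ?_
    rw [jacobian_comp_faceIncl (injective_chartDeriv_target h hy)]
  · rw [← chartBoundaryArea_eq_paramMeasure, ← boundaryArea_restrict_source]
    exact hf.restrict

/-- The boundary area is carried by the boundary. -/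
lemma ae_boundaryArea_mem_boundary [SecondCountableTopology M] (ι : M → E (n + 1)) :
    ∀ᵐ z ∂(boundaryArea ι), z ∈ (𝓡∂ n).boundary M := by
  -- Second countability reduces the claim to countably many charts.
  obtain ⟨T, hTc, hT⟩ := TopologicalSpace.countable_cover_nhds
    (fun p : M => extChartAt_source_mem_nhds (I := 𝓡∂ n) p)
  have hcl : IsClosed ((𝓡∂ n).boundary M) := (𝓡∂ n).isClosed_boundary (n := 2) (by norm_num)
  have h1 : ∀ p : M, ∀ᵐ z ∂(boundaryArea ι), z ∈ (chart n p).source → z ∈ (𝓡∂ n).boundary M := by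
    intro p
    rw [← ae_restrict_iff' (measurableSet_chart_source p), boundaryArea_restrict_source,
      chartBoundaryArea_eq_paramMeasure, ae_iff]
    refine paramMeasure_eq_zero (isOpen_faceTarget p).measurableSet (continuousOn_faceParam p)
      hcl.measurableSet.compl ?_
    refine measure_mono_null (t := ∅) ?_ measure_empty
    rintro y ⟨hy, hy2⟩
    refine hy2 ((mem_boundary_iff_chart ((chart n p).map_target hy)).2 ?_)
    rw [(chart n p).right_inv hy, faceIncl_zero_coord]
  have h2 := (ae_ball_iff hTc).2 fun p (_ : p ∈ T) => h1 p
  filter_upwards [h2] with z hz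
  obtain ⟨p, hp, hzp⟩ : ∃ p ∈ T, z ∈ (chart n p).source := by
    simpa using (hT ▸ mem_univ z : z ∈ ⋃ x ∈ T, (extChartAt (𝓡∂ n) x).source)
  exact hz p hp hzp

end BoundaryArea

/-! ### Local finiteness of the two measures. -/

section LocallyFinite

variable {n : ℕ} [NeZero n] {M : Type*} [TopologicalSpace M] [T2Space M]
  [ChartedSpace (EuclideanHalfSpace n) M]
  [IsManifold (𝓡∂ n) 2 M] [MeasurableSpace M] [BorelSpace M] {U : Set (E (n + 1))}
  {ι ν : M → E (n + 1)}

/-- A point has a compact neighbourhood in the domain of one chart, and the density is continuous on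
its compact image. This makes continuous functions with compact support integrable. -/
lemma isLocallyFiniteMeasure_area (h : IsProperTwoSidedImmersion U ι ν) :
    IsLocallyFiniteMeasure (area ι) := by
  refine ⟨fun p => ?_⟩
  obtain ⟨K, hK, hKc, hKs⟩ := exists_isCompact_subset_source (n := n) p
  refine ⟨K, hK, ?_⟩
  have h1 : (area ι) K = ((area ι).restrict (chart n p).source) K := by
    rw [Measure.restrict_apply hKc.measurableSet, inter_eq_left.2 hKs]
  rw [h1, area_restrict_source, chartArea_eq_paramMeasure]
  refine paramMeasure_lt_top (measurableSet_chart_target p) (continuousOn_chart_symm p)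
    (continuousOn_jacobian_chartDeriv h p) hKc.measurableSet ?_
  rw [chart_target_inter_preimage hKs]
  exact isCompact_chart_image hKs hKc

lemma isLocallyFiniteMeasure_boundaryArea (h : IsProperTwoSidedImmersion U ι ν) :
    IsLocallyFiniteMeasure (boundaryArea ι) := by
  refine ⟨fun p => ?_⟩
  obtain ⟨K, hK, hKc, hKs⟩ := exists_isCompact_subset_source (n := n) p
  refine ⟨K, hK, ?_⟩
  have h1 : (boundaryArea ι) K = ((boundaryArea ι).restrict (chart n p).source) K := by
    rw [Measure.restrict_apply hKc.measurableSet, inter_eq_left.2 hKs]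
  rw [h1, boundaryArea_restrict_source, chartBoundaryArea_eq_paramMeasure]
  refine paramMeasure_lt_top (isOpen_faceTarget p).measurableSet (continuousOn_faceParam p)
    (continuousOn_faceJacobian h p) hKc.measurableSet ?_
  have h2 : faceTarget n p ∩ faceParam n p ⁻¹' K = faceIncl n ⁻¹' (chart n p '' K) := by
    rw [← chart_target_inter_preimage hKs]; rfl
  rw [h2]
  exact isClosedEmbedding_faceIncl.isCompact_preimage (isCompact_chart_image hKs hKc)

end LocallyFinite

/-! ### Calculus of tangential derivatives on the hypersurface. -/

section TangentialDerivative

variable {n : ℕ} [NeZero n] {M : Type*} [TopologicalSpace M] [ChartedSpace (EuclideanHalfSpace n) M]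
  [IsManifold (𝓡∂ n) 2 M] {U : Set (E (n + 1))} {ι ν : M → E (n + 1)}
  {F : Type*} [NormedAddCommGroup F] [NormedSpace ℝ F]

/-- The derivative of `f` at `q` in the direction of the tangential part of `v`. -/
def tanDeriv (ι : M → E (n + 1)) (f : M → F) (q : M) (v : E (n + 1)) : F :=
  (mfderiv (𝓡∂ n) 𝓘(ℝ, F) f q : E n →L[ℝ] F) (leftInv (diff n ι q) v)

lemma gradSq_eq (ι : M → E (n + 1)) (φ : M → ℝ) (q : M) :
    gradSq ι φ q = ∑ b, tanDeriv ι φ q (bvec b) ^ 2 := rfl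

lemma secondFF_eq_tanDeriv (ι ν : M → E (n + 1)) (q : M) (v w : E (n + 1)) :
    secondFF ι ν q v w = -⟪tanDeriv ι ν q v, w⟫_ℝ := rfl

lemma secondFFSq_eq (ι ν : M → E (n + 1)) (q : M) :
    secondFFSq ι ν q = ∑ b, ∑ b', ⟪tanDeriv ι ν q (bvec b), bvec b'⟫_ℝ ^ 2 := by
  refine Finset.sum_congr rfl fun b _ => Finset.sum_congr rfl fun b' _ => ?_
  rw [secondFF_eq_tanDeriv, neg_sq]

lemma tanDeriv_eq_chart (h : IsProperTwoSidedImmersion U ι ν) (f : M → F) {p q : M}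
    (hq : q ∈ (chart n p).source) (v : E (n + 1)) :
    tanDeriv ι f q v = fderivWithin ℝ (f ∘ (chart n p).symm) (modelHalf n) (chart n p q)
      (leftInv (chartDeriv ι p (chart n p q)) v) :=
  mfderiv_leftInv h.injective_diff f hq v

lemma tanDeriv_symm_eq (h : IsProperTwoSidedImmersion U ι ν) (f : M → F) {p : M} {x : E n}
    (hx : x ∈ (chart n p).target) (v : E (n + 1)) :
    tanDeriv ι f ((chart n p).symm x) v
      = fderivWithin ℝ (f ∘ (chart n p).symm) (modelHalf n) x (leftInv (chartDeriv ι p x) v) := by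
  rw [tanDeriv_eq_chart h f ((chart n p).map_target hx) v, (chart n p).right_inv hx]

lemma contDiffWithinAt_leftInv_chartDeriv (h : IsProperTwoSidedImmersion U ι ν) {p : M} {x : E n}
    (hx : x ∈ (chart n p).target) :
    ContDiffWithinAt ℝ 1 (fun y => leftInv (chartDeriv ι p y)) (modelHalf n) x :=
  contDiffWithinAt_leftInv (hypersurfaceGerm_chart h hx).contDiff_frame
    (injective_chartDeriv_target h hx)

/-- Tangential derivatives of `C¹` functions are continuous. -/
lemma continuous_tanDeriv (h : IsProperTwoSidedImmersion U ι ν) {f : M → F}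
    (hf : ContMDiff (𝓡∂ n) 𝓘(ℝ, F) 1 f) (v : E (n + 1)) :
    Continuous fun q => tanDeriv ι f q v := by
  rw [continuous_iff_continuousAt]
  intro p
  have hp : chart n p p ∈ (chart n p).target := mem_extChartAt_target p
  have h1 : ContinuousWithinAt (fun x => fderivWithin ℝ (f ∘ (chart n p).symm) (modelHalf n) x
      (leftInv (chartDeriv ι p x) v)) (modelHalf n) (chart n p p) := by
    have ha := (contDiffWithinAt_comp_chart_symm (by norm_num) hf hp).fderivWithin_right
      uniqueDiffOn_modelHalf (m := 0) (by norm_num) (chart_target_subset p hp)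
    exact ha.continuousWithinAt.clm_apply
      ((contDiffWithinAt_leftInv_chartDeriv h hp).continuousWithinAt.clm_apply
        continuousWithinAt_const)
  have h2 : ContinuousWithinAt (fun q => fderivWithin ℝ (f ∘ (chart n p).symm) (modelHalf n)
      (chart n p q) (leftInv (chartDeriv ι p (chart n p q)) v)) (chart n p).source p :=
    h1.comp (continuousAt_extChartAt p).continuousWithinAt
      fun z hz => chart_target_subset p ((chart n p).map_source hz)
  have h3 : (chart n p).source ∈ 𝓝 p := extChartAt_source_mem_nhds p
  refine (h2.continuousAt h3).congr ?_
  filter_upwards [h3] with z hz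
  exact (tanDeriv_eq_chart h f hz v).symm

/-- The tangential derivative computed from a derivative in the chart at the point. -/
lemma tanDeriv_of_hasFDerivWithinAt (ι : M → E (n + 1)) {f : M → F} {q : M} {f' : E n →L[ℝ] F}
    (hf : HasFDerivWithinAt (f ∘ (chart n q).symm) f' (modelHalf n) (chart n q q))
    (v : E (n + 1)) : tanDeriv ι f q v = f' (leftInv (diff n ι q) v) := by
  have h1 := mdifferentiableAt_of_comp_chart_symm (mem_extChartAt_source (I := 𝓡∂ n) q)
    hf.differentiableWithinAt
  have h2 : HasMFDerivAt (𝓡∂ n) 𝓘(ℝ, F) f q f' := by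
    refine ⟨h1.continuousAt, ?_⟩
    rw [range_model_eq]
    exact hf
  rw [tanDeriv, h2.mfderiv]
  rfl

lemma hasFDerivWithinAt_comp_chart_symm {f : M → F} (hf : ContMDiff (𝓡∂ n) 𝓘(ℝ, F) 1 f) (q : M) :
    HasFDerivWithinAt (f ∘ (chart n q).symm)
      (fderivWithin ℝ (f ∘ (chart n q).symm) (modelHalf n) (chart n q q))
      (modelHalf n) (chart n q q) :=
  ((contDiffWithinAt_comp_chart_symm (by norm_num) hf (mem_extChartAt_target q)).differentiableWithinAt
    (by norm_num)).hasFDerivWithinAt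

lemma tanDeriv_mul (ι : M → E (n + 1)) {f g : M → ℝ} (hf : ContMDiff (𝓡∂ n) 𝓘(ℝ, ℝ) 1 f)
    (hg : ContMDiff (𝓡∂ n) 𝓘(ℝ, ℝ) 1 g) (q : M) (v : E (n + 1)) :
    tanDeriv ι (fun z => f z * g z) q v = f q * tanDeriv ι g q v + g q * tanDeriv ι f q v := by
  have h1 := hasFDerivWithinAt_comp_chart_symm hf q
  have h2 := hasFDerivWithinAt_comp_chart_symm hg q
  rw [tanDeriv_of_hasFDerivWithinAt ι h1, tanDeriv_of_hasFDerivWithinAt ι h2,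
    tanDeriv_of_hasFDerivWithinAt ι (f := fun z => f z * g z) (h1.mul h2)]
  have h3 := (chart n q).left_inv (mem_extChartAt_source (I := 𝓡∂ n) q)
  change f ((chart n q).symm (chart n q q)) * _ + g ((chart n q).symm (chart n q q)) * _ = _
  rw [h3]
  rfl

lemma tanDeriv_comp {G : Type*} [NormedAddCommGroup G] [NormedSpace ℝ G] (ι : M → E (n + 1))
    {f : M → F} (hf : ContMDiff (𝓡∂ n) 𝓘(ℝ, F) 1 f) (q : M) {Φ : F → G} {Φ' : F →L[ℝ] G}
    (hΦ : HasFDerivAt Φ Φ' (f q)) (v : E (n + 1)) :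
    tanDeriv ι (fun z => Φ (f z)) q v = Φ' (tanDeriv ι f q v) := by
  have h1 := hasFDerivWithinAt_comp_chart_symm hf q
  have h3 : HasFDerivAt Φ Φ' ((f ∘ (chart n q).symm) (chart n q q)) := by
    change HasFDerivAt Φ Φ' (f ((chart n q).symm (chart n q q)))
    rwa [(chart n q).left_inv (mem_extChartAt_source q)]
  rw [tanDeriv_of_hasFDerivWithinAt ι h1,
    tanDeriv_of_hasFDerivWithinAt ι (f := fun z => Φ (f z))
      (h3.comp_hasFDerivWithinAt (chart n q q) h1)]
  rfl

lemma tanDeriv_sum (ι : M → E (n + 1)) {J : Type*} (T : Finset J) {f : J → M → F} {q : M}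
    (hf : ∀ k ∈ T, MDifferentiableAt (𝓡∂ n) 𝓘(ℝ, F) (f k) q) (v : E (n + 1)) :
    tanDeriv ι (fun z => ∑ k ∈ T, f k z) q v = ∑ k ∈ T, tanDeriv ι (f k) q v := by
  have h1 : ∀ k ∈ T, HasFDerivWithinAt (f k ∘ (chart n q).symm)
      (fderivWithin ℝ (f k ∘ (chart n q).symm) (modelHalf n) (chart n q q)) (modelHalf n)
      (chart n q q) := fun k hk => by
    have := (hf k hk).hasMFDerivAt.2
    rw [range_model_eq] at this
    exact this.differentiableWithinAt.hasFDerivWithinAt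
  have h2 := HasFDerivWithinAt.fun_sum h1
  rw [tanDeriv_of_hasFDerivWithinAt ι (f := fun z => ∑ k ∈ T, f k z) h2,
    sum_apply]
  exact Finset.sum_congr rfl fun k hk => (tanDeriv_of_hasFDerivWithinAt ι (h1 k hk) v).symm

lemma tanDeriv_eq_zero_of_eventuallyEq (ι : M → E (n + 1)) {f : M → F} {q : M}
    (hf : ∀ᶠ z in 𝓝 q, f z = 0) (v : E (n + 1)) : tanDeriv ι f q v = 0 := by
  have h1 : f =ᶠ[𝓝 q] fun _ => (0 : F) := hf
  rw [tanDeriv, h1.mfderiv_eq, mfderiv_const]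
  rfl

lemma diff_eq_chartDeriv (h : IsProperTwoSidedImmersion U ι ν) (q : M) :
    diff n ι q = chartDeriv ι q (chart n q q) := by
  have h1 : MDifferentiableAt (𝓡∂ n) 𝓘(ℝ, E (n + 1)) ι q :=
    (h.contMDiff q).mdifferentiableAt (by norm_num)
  have h2 := h1.hasMFDerivAt.2
  have h3 : HasFDerivWithinAt (ι ∘ (chart n q).symm) (diff n ι q) (range (𝓡∂ n)) (chart n q q) := h2
  rw [chartDeriv, h3.fderivWithin ((𝓡∂ n).uniqueDiffOn _ (mem_range_self _))]

lemma continuous_immersion (h : IsProperTwoSidedImmersion U ι ν) : Continuous ι :=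
  h.contMDiff.continuous

lemma continuous_normal (h : IsProperTwoSidedImmersion U ι ν) : Continuous ν :=
  h.contMDiff_normal.continuous

lemma continuous_secondFFSq (h : IsProperTwoSidedImmersion U ι ν) :
    Continuous (secondFFSq ι ν) := by
  have : secondFFSq ι ν = fun q => ∑ b, ∑ b', ⟪tanDeriv ι ν q (bvec b), bvec b'⟫_ℝ ^ 2 :=
    funext fun q => secondFFSq_eq ι ν q
  rw [this]
  exact continuous_finsetSum _ fun b _ => continuous_finsetSum _ fun b' _ =>
    ((continuous_tanDeriv h h.contMDiff_normal _).inner continuous_const).pow 2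

lemma continuous_gradSq (h : IsProperTwoSidedImmersion U ι ν) {φ : M → ℝ}
    (hφ : ContMDiff (𝓡∂ n) 𝓘(ℝ, ℝ) 1 φ) : Continuous (gradSq ι φ) := by
  change Continuous fun q => ∑ b, tanDeriv ι φ q (bvec b) ^ 2
  exact continuous_finsetSum _ fun b _ => (continuous_tanDeriv h hφ _).pow 2

lemma inner_tanDeriv_normal (h : IsProperTwoSidedImmersion U ι ν) (q : M) (v : E (n + 1)) :
    ⟪tanDeriv ι ν q v, ν q⟫_ℝ = 0 := by
  have hq := mem_extChartAt_target (I := 𝓡∂ n) q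
  rw [tanDeriv_eq_chart h ν (mem_extChartAt_source q)]
  have := (hypersurfaceGerm_chart h hq).inner_deriv_normal_normal
    (leftInv (chartDeriv ι q (chart n q q)) v)
  rw [Function.comp_apply, (chart n q).left_inv (mem_extChartAt_source q)] at this
  exact this

lemma tanDeriv_normal_direction (h : IsProperTwoSidedImmersion U ι ν) (f : M → F) (q : M) :
    tanDeriv ι f q (ν q) = 0 := by
  rw [tanDeriv, leftInv_eq_zero_of_orthogonal (fun v => h.normal q v)]
  exact (mfderiv (𝓡∂ n) 𝓘(ℝ, F) f q : E n →L[ℝ] F).map_zero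

lemma inner_tanDeriv_symm (h : IsProperTwoSidedImmersion U ι ν) (q : M) (v w : E (n + 1)) :
    ⟪tanDeriv ι ν q v, w⟫_ℝ = ⟪v, tanDeriv ι ν q w⟫_ℝ := by
  have hq := mem_extChartAt_target (I := 𝓡∂ n) q
  rw [tanDeriv_eq_chart h ν (mem_extChartAt_source q), tanDeriv_eq_chart h ν (mem_extChartAt_source q),
    real_inner_comm _ v]
  exact (hypersurfaceGerm_chart h hq).inner_shape_symm v w

end TangentialDerivative

/-! ### Cutoff functions and partitions of unity in charts. -/

section Cutoff

variable {n : ℕ} [NeZero n] {M : Type*} [TopologicalSpace M] [T2Space M]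
  [ChartedSpace (EuclideanHalfSpace n) M] [IsManifold (𝓡∂ n) 2 M]

/-- A cutoff function supported in a chart. -/
lemma exists_chart_cutoff {p : M} {K V : Set M} (hK : IsCompact K) (hKs : K ⊆ (chart n p).source)
    (hV : IsOpen V) (hKV : K ⊆ V) :
    ∃ (f : M → ℝ) (K₁ : Set M), ContMDiff (𝓡∂ n) 𝓘(ℝ, ℝ) 1 f ∧ IsCompact K₁ ∧
      K₁ ⊆ (chart n p).source ∧ K₁ ⊆ V ∧ (∀ z ∉ K₁, f z = 0) ∧ ∀ z ∈ K, ∀ᶠ y in 𝓝 z, f y = 1 := by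
  classical
  obtain ⟨O, hO, hOt⟩ := exists_isOpen_chart_target (n := n) p
  obtain ⟨u, hu, hut⟩ := continuousOn_iff'.1 (continuousOn_chart_symm (n := n) p) V hV
  have hsub : chart n p '' K ⊆ O ∩ u := by
    rintro _ ⟨z, hz, rfl⟩
    have h1 := (chart n p).map_source (hKs hz)
    refine ⟨(hOt ▸ h1 : _ ∈ O ∩ modelHalf n).1, ?_⟩
    have h2 : chart n p z ∈ (chart n p).symm ⁻¹' V ∩ (chart n p).target :=
      ⟨by rw [mem_preimage, (chart n p).left_inv (hKs hz)]; exact hKV hz, h1⟩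
    exact (hut ▸ h2 : _ ∈ u ∩ (chart n p).target).1
  obtain ⟨χ, hχ, hχ1, K', hK'O, hK', hχ0⟩ := exists_cutoff (isCompact_chart_image hKs hK)
    (hO.inter hu) hsub
  have hKt : K' ∩ modelHalf n ⊆ (chart n p).target := by
    rw [hOt]; exact inter_subset_inter_left _ (hK'O.trans inter_subset_left)
  have hKc : IsCompact (K' ∩ modelHalf n) := hK'.inter_right isClosed_modelHalf
  set K₁ := (chart n p).symm '' (K' ∩ modelHalf n) with hK₁
  have hKcpt : IsCompact K₁ :=
    hKc.image_of_continuousOn ((continuousOn_extChartAt_symm p).mono hKt)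
  have hK₁s : K₁ ⊆ (chart n p).source := by
    rintro _ ⟨x, hx, rfl⟩; exact (chart n p).map_target (hKt hx)
  have hK₁V : K₁ ⊆ V := by
    rintro _ ⟨x, hx, rfl⟩
    have h2 : x ∈ u ∩ (chart n p).target := ⟨(hK'O hx.1).2, hKt hx⟩
    exact (hut ▸ h2 : x ∈ (chart n p).symm ⁻¹' V ∩ (chart n p).target).1
  set f : M → ℝ := fun z => if z ∈ (chart n p).source then χ (chart n p z) else 0 with hf
  have hf0 : ∀ z ∉ K₁, f z = 0 := by
    intro z hz
    by_cases hzs : z ∈ (chart n p).source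
    · rw [hf]
      change (if z ∈ (chart n p).source then χ (chart n p z) else 0) = 0
      rw [if_pos hzs]
      refine hχ0 _ fun hzK => hz ⟨chart n p z, ⟨hzK, ?_⟩, (chart n p).left_inv hzs⟩
      exact chart_target_subset p ((chart n p).map_source hzs)
    · exact if_neg hzs
  refine ⟨f, K₁, ?_, hKcpt, hK₁s, hK₁V, hf0, ?_⟩
  · intro z
    by_cases hzs : z ∈ (chart n p).source
    · have h1 : ContMDiffAt (𝓡∂ n) 𝓘(ℝ, ℝ) 1 (χ ∘ chart n p) z :=
        ((hχ.of_le (by norm_num)).contMDiff.contMDiffAt).comp z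
          ((contMDiffAt_extChartAt' (n := 2) (by rwa [extChartAt_source] at hzs)).of_le (by norm_num))
      refine h1.congr_of_eventuallyEq ?_
      filter_upwards [extChartAt_source_mem_nhds' (I := 𝓡∂ n) hzs] with y hy
      exact if_pos hy
    · have h1 : f =ᶠ[𝓝 z] fun _ => (0 : ℝ) := by
        filter_upwards [hKcpt.isClosed.isOpen_compl.mem_nhds fun hz => hzs (hK₁s hz)] with y hy
        exact hf0 y hy
      exact contMDiffAt_const.congr_of_eventuallyEq h1
  · intro z hz
    have h1 : ∀ᶠ x in 𝓝 (chart n p z), χ x = 1 :=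
      hχ1.filter_mono (nhds_le_nhdsSet (mem_image_of_mem _ hz))
    filter_upwards [(continuousAt_extChartAt' (hKs hz)).eventually h1,
      extChartAt_source_mem_nhds' (I := 𝓡∂ n) (hKs hz)] with y hy hys
    exact (if_pos hys).trans hy

/-- A finite partition of unity on a compact set, subordinate to charts. -/
lemma exists_chart_partition {C : Set M} (hC : IsCompact C) :
    ∃ (T : Finset M) (χ : M → M → ℝ), (∀ k, ContMDiff (𝓡∂ n) 𝓘(ℝ, ℝ) 1 (χ k)) ∧
      (∀ k, ∃ K ⊆ (chart n k).source, IsCompact K ∧ ∀ z ∉ K, χ k z = 0) ∧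
      ∀ z ∈ C, ∑ k ∈ T, χ k z = 1 := by
  classical
  have hcut := fun q : M => exists_chart_cutoff (n := n) (p := q) (isCompact_singleton (x := q))
    (singleton_subset_iff.2 (mem_extChartAt_source q)) isOpen_univ (subset_univ _)
  choose f K hf hK hKs _ hf0 hf1 using hcut
  obtain ⟨T, hT⟩ := hC.elim_nhds_subcover (fun q => {z | f q z = 1}) fun q _ => hf1 q q rfl
  have key : ∀ S : Finset M, ∃ χ : M → M → ℝ, (∀ k, ContMDiff (𝓡∂ n) 𝓘(ℝ, ℝ) 1 (χ k)) ∧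
      (∀ k z, f k z = 0 → χ k z = 0) ∧ ∀ z, ∑ k ∈ S, χ k z = 1 - ∏ k ∈ S, (1 - f k z) := by
    intro S
    induction S using Finset.induction_on with
    | empty => exact ⟨f, hf, fun _ _ h => h, fun z => by simp⟩
    | insert a S ha ih =>
      obtain ⟨χ, h1, h2, h3⟩ := ih
      have hprod : ContMDiff (𝓡∂ n) 𝓘(ℝ, ℝ) 1 fun z => ∏ k ∈ S, (1 - f k z) :=
        contMDiff_finsetProd fun k _ => contMDiff_const.sub (hf k)
      -- Telescoping: replacing the value at `a` by `f_a ∏ (1 - f_k)` keeps the sum equal to `1 - ∏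
      -- (1 - f_k)`, and this is `1` wherever some `f_k` equals `1`.
      refine ⟨Function.update χ a fun z => f a z * ∏ k ∈ S, (1 - f k z), fun k => ?_, fun k z hz => ?_,
        fun z => ?_⟩
      · by_cases hk : k = a
        · subst hk; rw [Function.update_self]; exact (hf k).mul hprod
        · rw [Function.update_of_ne hk]; exact h1 k
      · by_cases hk : k = a
        · subst hk; rw [Function.update_self, hz, zero_mul]
        · rw [Function.update_of_ne hk]; exact h2 k z hz
      · rw [Finset.sum_insert ha, Finset.prod_insert ha, Function.update_self,
          Finset.sum_congr rfl fun k hk => by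
            rw [Function.update_of_ne (fun h => ha (h ▸ hk) : k ≠ a)], h3 z]
        ring
  obtain ⟨χ, h1, h2, h3⟩ := key T
  refine ⟨T, χ, h1, fun k => ⟨K k, hKs k, hK k, fun z hz => h2 k z (hf0 k z hz)⟩, fun z hz => ?_⟩
  rw [h3, sub_eq_self]
  obtain ⟨k, hk, hkz⟩ : ∃ k ∈ T, f k z = 1 := by simpa using hT.2 hz
  exact Finset.prod_eq_zero hk (by rw [hkz, sub_self])

end Cutoff

/-! ### First order behaviour at the boundary, and the conormal. -/

section FaceDerivative

variable {n : ℕ} [NeZero n] {G : E n → ℝ} {G' : E n →L[ℝ] ℝ} {x : E n}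

/-- The derivative of a function that is constant on the face of the half-space. -/
lemma fderiv_of_const_on_face (hG : HasFDerivWithinAt G G' (modelHalf n) x) (hx : x 0 = 0) {r : ℝ}
    (hc : ∀ᶠ y in 𝓝[modelHalf n] x, y 0 = 0 → G y = r) (v : E n) : G' v = G' (bvec 0) * v 0 := by
  have hx' : faceIncl n (faceProj n x) = x := faceIncl_faceProj hx
  have h1 : HasFDerivAt (G ∘ faceIncl n) (G' ∘L faceIncl n) (faceProj n x) := by
    rw [← hx'] at hG
    exact (hG.comp (faceProj n x) ((faceIncl n).hasFDerivAt.hasFDerivWithinAt (s := univ))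
      fun w _ => faceIncl_mem w).hasFDerivAt_of_univ
  have h2 : HasFDerivAt (G ∘ faceIncl n) (0 : EuclideanSpace ℝ {i : Fin n // i ≠ 0} →L[ℝ] ℝ)
      (faceProj n x) := by
    refine (hasFDerivAt_const r _).congr_of_eventuallyEq ?_
    have ht : Filter.Tendsto (faceIncl n) (𝓝 (faceProj n x)) (𝓝[modelHalf n] x) := by
      refine tendsto_nhdsWithin_iff.2 ⟨?_, Filter.Eventually.of_forall fun w => faceIncl_mem w⟩
      have := (faceIncl n).continuous.tendsto (faceProj n x)
      rwa [hx'] at this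
    filter_upwards [ht.eventually hc] with w hw
    exact hw (faceIncl_zero_coord w)
  have h3 := h1.unique h2
  have h4 : (v - v 0 • (bvec 0 : E n)) 0 = 0 := by simp [bvec]
  have h5 := congrArg (fun L : EuclideanSpace ℝ {i : Fin n // i ≠ 0} →L[ℝ] ℝ =>
    L (faceProj n (v - v 0 • (bvec 0 : E n)))) h3
  have h6 : G' (faceIncl n (faceProj n (v - v 0 • (bvec 0 : E n)))) = 0 := h5
  rw [faceIncl_faceProj h4, map_sub, map_smul, smul_eq_mul] at h6
  linarith

lemma fderiv_normal_nonneg_of_isMin (hG : HasFDerivWithinAt G G' (modelHalf n) x)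
    (hx : x ∈ modelHalf n) (hmin : ∀ᶠ y in 𝓝[modelHalf n] x, G x ≤ G y) : 0 ≤ G' (bvec 0) := by
  refine IsLocalMinOn.hasFDerivWithinAt_nonneg (s := modelHalf n) (a := x) hmin hG ?_
  refine mem_posTangentConeAt_of_segment_subset ((convex_modelHalf).segment_subset hx ?_)
  rw [mem_modelHalf] at hx ⊢
  simp [bvec]
  linarith

end FaceDerivative

section Conormal

variable {n : ℕ} [NeZero n] {M : Type*} [TopologicalSpace M] [ChartedSpace (EuclideanHalfSpace n) M]
  [IsManifold (𝓡∂ n) 2 M] {U : Set (E (n + 1))} {ι ν : M → E (n + 1)} {θ : ℝ}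

/-- The outer unit conormal of a capillary hypersurface in terms of its normal. -/
def capillaryConormal (θ : ℝ) (ν : M → E (n + 1)) (q : M) : E (n + 1) :=
  -((Real.sin θ)⁻¹ • (bvec 0 - Real.cos θ • ν q))

lemma inner_bvec_right {d : ℕ} (v : E d) (i : Fin d) : ⟪v, bvec i⟫_ℝ = v i := by
  rw [real_inner_comm, inner_single_one_left]

lemma norm_sq_bvec_sub_normal {N : E (n + 1)} (hN : ‖N‖ = 1) (h0 : N 0 = Real.cos θ) :
    ‖(bvec 0 : E (n + 1)) - Real.cos θ • N‖ ^ 2 = Real.sin θ ^ 2 := by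
  rw [norm_sub_sq_real, norm_smul, hN, inner_smul_right, inner_single_one_left, h0]
  have h1 : ‖(bvec 0 : E (n + 1))‖ = 1 := by simp [bvec]
  have h2 := Real.sin_sq_add_cos_sq θ
  rw [h1, mul_one, Real.norm_eq_abs, sq_abs]
  nlinarith

/-- The image of `ι` lies in the half-space, so intersecting the open set with the half-space does
not change its preimage. -/
lemma isOpen_preimage_of_relOpen (h : IsProperTwoSidedImmersion U ι ν)
    (hU : ∃ O, IsOpen O ∧ U = O ∩ closedHalfSpace n) : IsOpen (ι ⁻¹' U) := by
  obtain ⟨O, hO, rfl⟩ := hU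
  have : ι ⁻¹' (O ∩ closedHalfSpace n) = ι ⁻¹' O := by
    rw [preimage_inter]
    exact inter_eq_left.2 fun q _ => h.mem_halfSpace q
  rw [this]
  exact hO.preimage (continuous_immersion h)

lemma eventually_mem_target (p : M) {x : E n} (hx : x ∈ (chart n p).target) {V : Set M}
    (hV : IsOpen V) (hxV : (chart n p).symm x ∈ V) :
    ∀ᶠ y in 𝓝[modelHalf n] x, y ∈ (chart n p).target ∧ (chart n p).symm y ∈ V := by
  have h1 := chart_target_mem_nhdsWithin hx
  have h2 : ContinuousWithinAt (chart n p).symm (chart n p).target x := continuousOn_chart_symm p x hx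
  have h3 : ContinuousWithinAt (chart n p).symm (modelHalf n) x := h2.mono_of_mem_nhdsWithin h1
  filter_upwards [h1, h3.eventually (hV.mem_nhds hxV)] with y hy hyV
  exact ⟨hy, hyV⟩

lemma symm_mem_boundary_iff {p : M} {x : E n} (hx : x ∈ (chart n p).target) :
    (chart n p).symm x ∈ (𝓡∂ n).boundary M ↔ x 0 = 0 := by
  rw [mem_boundary_iff_chart ((chart n p).map_target hx), (chart n p).right_inv hx]

/-- In a chart at the boundary the inner conormal is a positive multiple of `e₁ - cos θ ν`. -/
lemma exists_dualVec_eq (h : IsCapillaryMinimal θ U ι ν) (hs : 0 < Real.sin θ) {p : M} {x : E n}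
    (hx : x ∈ (chart n p).target) (hx0 : x 0 = 0) (hxU : ι ((chart n p).symm x) ∈ U) :
    ∃ a : ℝ, 0 < a ∧ dualVec (chartDeriv ι p x) 0
      = a • ((bvec 0 : E (n + 1)) - Real.cos θ • ν ((chart n p).symm x)) := by
  have hi := h.toIsProperTwoSidedImmersion
  have g := hypersurfaceGerm_chart hi hx
  set q := (chart n p).symm x with hq
  have hb : q ∈ (𝓡∂ n).boundary M := (symm_mem_boundary_iff hx).2 hx0
  have hν0 := h.contact_angle q hb hxU
  have hd : HasFDerivWithinAt (fun y => (ι ((chart n p).symm y)) 0)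
      ((EuclideanSpace.proj (0 : Fin (n + 1)) : E (n + 1) →L[ℝ] ℝ) ∘L chartDeriv ι p x)
      (modelHalf n) x := by
    have h1 := ((contDiffWithinAt_comp_chart_symm le_rfl hi.contMDiff hx).differentiableWithinAt
      (by norm_num)).hasFDerivWithinAt
    rw [chartDeriv_eq]
    exact (EuclideanSpace.proj (0 : Fin (n + 1)) : E (n + 1) →L[ℝ] ℝ).hasFDerivAt.comp_hasFDerivWithinAt
      x h1
  have hzero : ∀ y ∈ (chart n p).target, y 0 = 0 → (ι ((chart n p).symm y)) 0 = 0 := fun y hy hy0 =>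
    hi.boundary_mem_wall _ ((symm_mem_boundary_iff hy).2 hy0)
  have ht : ∀ᶠ y in 𝓝[modelHalf n] x, y ∈ (chart n p).target := chart_target_mem_nhdsWithin hx
  -- The first coordinate of `ι` vanishes on the boundary and is nonnegative elsewhere, so its
  -- differential is `b` times the coordinate form of index `0` with `b ≥ 0`. Expanding `e₁` in the
  -- dual frame then gives `e₁ - cos θ ν = b e⁰`, and `b ≠ 0` because the left side has length `sin
  -- θ`.
  have hface := fderiv_of_const_on_face hd hx0 (ht.mono fun y hy => hzero y hy)
  have hnn := fderiv_normal_nonneg_of_isMin hd (chart_target_subset p hx)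
    (Filter.Eventually.of_forall fun y => by
      rw [hzero x hx hx0]; exact hi.mem_halfSpace _)
  set b : ℝ := (chartDeriv ι p x (bvec 0)) 0 with hbdef
  have hface' : ∀ v : E n, (chartDeriv ι p x v) 0 = b * v 0 := hface
  have hb0 : 0 ≤ b := hnn
  have hsum := sum_inner_smul_dualVec g.injective_self g.unit_self g.normal_self
    (bvec 0 : E (n + 1))
  have h1 : ∑ k, ⟪(bvec 0 : E (n + 1)), chartDeriv ι p x (bvec k)⟫_ℝ • dualVec (chartDeriv ι p x) k
      = b • dualVec (chartDeriv ι p x) 0 := by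
    rw [Finset.sum_eq_single (0 : Fin n)]
    · rw [inner_single_one_left]
    · intro k _ hk
      rw [inner_single_one_left, hface']
      simp [bvec, hk.symm]
    · exact fun h => absurd (Finset.mem_univ _) h
  have h2 : ⟪(bvec 0 : E (n + 1)), (ν ∘ (chart n p).symm) x⟫_ℝ = Real.cos θ := by
    rw [inner_single_one_left]; exact hν0
  rw [h1, h2] at hsum
  have h3 : (bvec 0 : E (n + 1)) - Real.cos θ • ν q = b • dualVec (chartDeriv ι p x) 0 := by
    rw [sub_eq_iff_eq_add]; exact hsum
  have hbne : b ≠ 0 := by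
    intro hb0
    have h4 := norm_sq_bvec_sub_normal (hi.norm_normal q) hν0
    rw [h3, hb0, zero_smul, norm_zero] at h4
    nlinarith [pow_pos hs 2]
  refine ⟨b⁻¹, inv_pos.2 (lt_of_le_of_ne hb0 hbne.symm), ?_⟩
  rw [h3, smul_smul, inv_mul_cancel₀ hbne, one_smul]

lemma norm_capillaryConormal (h : IsCapillaryMinimal θ U ι ν) (hs : 0 < Real.sin θ) {q : M}
    (hq : q ∈ (𝓡∂ n).boundary M) (hqU : ι q ∈ U) : ‖capillaryConormal θ ν q‖ = 1 := by
  have h4 := norm_sq_bvec_sub_normal (h.norm_normal q) (h.contact_angle q hq hqU)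
  have h5 : ‖(bvec 0 : E (n + 1)) - Real.cos θ • ν q‖ = Real.sin θ :=
    (sq_eq_sq₀ (norm_nonneg _) hs.le).1 h4
  rw [capillaryConormal, norm_neg, norm_smul, h5, norm_inv, Real.norm_eq_abs, abs_of_pos hs,
    inv_mul_cancel₀ hs.ne']

lemma dualVec_eq_capillaryConormal (h : IsCapillaryMinimal θ U ι ν) (hs : 0 < Real.sin θ) {p : M}
    {x : E n} (hx : x ∈ (chart n p).target) (hx0 : x 0 = 0)
    (hxU : ι ((chart n p).symm x) ∈ U) :
    dualVec (chartDeriv ι p x) 0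
      = -(‖dualVec (chartDeriv ι p x) 0‖ • capillaryConormal θ ν ((chart n p).symm x)) ∧
        0 < ‖dualVec (chartDeriv ι p x) 0‖ := by
  obtain ⟨a, ha, hd⟩ := exists_dualVec_eq h hs hx hx0 hxU
  have hn := norm_capillaryConormal h hs ((symm_mem_boundary_iff hx).2 hx0) hxU
  have h1 : (bvec 0 : E (n + 1)) - Real.cos θ • ν ((chart n p).symm x)
      = -(Real.sin θ • capillaryConormal θ ν ((chart n p).symm x)) := by
    rw [capillaryConormal, smul_neg, neg_neg, smul_smul, mul_inv_cancel₀ hs.ne', one_smul]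
  have h2 : ‖dualVec (chartDeriv ι p x) 0‖ = a * Real.sin θ := by
    rw [hd, h1, smul_neg, norm_neg, norm_smul, norm_smul, hn, Real.norm_eq_abs, Real.norm_eq_abs,
      abs_of_pos ha, abs_of_pos hs, mul_one]
  refine ⟨?_, by rw [h2]; positivity⟩
  rw [h2, hd, h1, smul_neg, smul_smul]

/-- The chart gradient differs from `e₁ - cos θ ν` by a positive factor, which disappears in the
normalization; hence the conormal has a formula free of charts. -/
lemma outerConormal_eq (h : IsCapillaryMinimal θ U ι ν) (hs : 0 < Real.sin θ) {q : M}
    (hq : q ∈ (𝓡∂ n).boundary M) (hqU : ι q ∈ U) :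
    outerConormal ι q = capillaryConormal θ ν q := by
  have hqs := mem_extChartAt_source (I := 𝓡∂ n) q
  have hqt := mem_extChartAt_target (I := 𝓡∂ n) q
  have hl : (chart n q).symm (chart n q q) = q := (chart n q).left_inv hqs
  have h0 := (mem_boundary_iff_chart hqs).1 hq
  obtain ⟨h1, h2⟩ := dualVec_eq_capillaryConormal h hs hqt h0 (by rw [hl]; exact hqU)
  rw [hl] at h1
  have h3 : inwardConormal ι q = dualVec (chartDeriv ι q (chart n q q)) 0 := by
    rw [← diff_eq_chartDeriv h.toIsProperTwoSidedImmersion]; rfl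
  rw [outerConormal, h3]
  nth_rw 2 [h1]
  rw [smul_neg, neg_neg, smul_smul, inv_mul_cancel₀ h2.ne', one_smul]

/-- Along the boundary the conormal is a principal direction. -/
lemma secondFF_capillaryConormal (h : IsCapillaryMinimal θ U ι ν) (hU : IsOpen (ι ⁻¹' U))
    (hs : 0 < Real.sin θ) {q : M} (hq : q ∈ (𝓡∂ n).boundary M) (hqU : ι q ∈ U) (v : E (n + 1)) :
    secondFF ι ν q v (capillaryConormal θ ν q)
      = secondFF ι ν q (capillaryConormal θ ν q) (capillaryConormal θ ν q)
        * ⟪capillaryConormal θ ν q, v⟫_ℝ := by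
  have hi := h.toIsProperTwoSidedImmersion
  have hqs := mem_extChartAt_source (I := 𝓡∂ n) q
  have hqt := mem_extChartAt_target (I := 𝓡∂ n) q
  have hl : (chart n q).symm (chart n q q) = q := (chart n q).left_inv hqs
  have h0 := (mem_boundary_iff_chart hqs).1 hq
  set x := chart n q q with hx
  obtain ⟨hdual, -⟩ := dualVec_eq_capillaryConormal h hs hqt h0 (by rw [hl]; exact hqU)
  rw [hl] at hdual
  set η := capillaryConormal θ ν q with hη
  set N' := fderivWithin ℝ (ν ∘ (chart n q).symm) (modelHalf n) x with hN'
  have hd : HasFDerivWithinAt (fun y => (ν ((chart n q).symm y)) 0)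
      ((EuclideanSpace.proj (0 : Fin (n + 1)) : E (n + 1) →L[ℝ] ℝ) ∘L N') (modelHalf n) x :=
    (EuclideanSpace.proj (0 : Fin (n + 1)) : E (n + 1) →L[ℝ] ℝ).hasFDerivAt.comp_hasFDerivWithinAt
      x (hasFDerivWithinAt_comp_chart_symm hi.contMDiff_normal q)
  have hev := eventually_mem_target q hqt hU (by rw [hl]; exact hqU)
  -- The contact angle is constant along the boundary, so the differential of `ν₁` sees only the
  -- direction of the conormal. Since `η` is a combination of `e₁` and `ν`, this determines `A(·,
  -- η)`.
  have hface : ∀ v : E n, (N' v) 0 = (N' (bvec 0)) 0 * v 0 :=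
    fderiv_of_const_on_face hd h0 (hev.mono fun y hy hy0 =>
      h.contact_angle _ ((symm_mem_boundary_iff hy.1).2 hy0) hy.2)
  have key : ∃ m : ℝ, ∀ v, secondFF ι ν q v η = m * ⟪η, v⟫_ℝ := by
    refine ⟨(Real.sin θ)⁻¹ * ((N' (bvec 0)) 0 * -‖dualVec (chartDeriv ι q x) 0‖), fun v => ?_⟩
    have h1 : ⟪tanDeriv ι ν q v, bvec 0⟫_ℝ
        = (N' (bvec 0)) 0 * -‖dualVec (chartDeriv ι q x) 0‖ * ⟪η, v⟫_ℝ := by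
      rw [real_inner_comm, inner_single_one_left, tanDeriv_eq_chart hi ν hqs, hface,
        ← inner_dualVec]
      nth_rw 1 [hdual]
      rw [inner_neg_left, inner_smul_left]
      simp only [RCLike.conj_to_real]
      ring
    rw [secondFF_eq_tanDeriv]
    nth_rw 1 [hη, capillaryConormal]
    rw [inner_neg_right, inner_smul_right, inner_sub_right, inner_smul_right,
      inner_tanDeriv_normal hi, h1]
    ring
  obtain ⟨m, hm⟩ := key
  rw [hm v, hm η, real_inner_self_eq_norm_sq, norm_capillaryConormal h hs hq hqU]
  ring

end Conormal

/-! ### The weak Jacobi equation on the hypersurface. -/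

section WeakJacobi

variable {n : ℕ} [NeZero n] {M : Type*} [TopologicalSpace M] [T2Space M]
  [SecondCountableTopology M] [ChartedSpace (EuclideanHalfSpace n) M]
  [IsManifold (𝓡∂ n) 2 M] [MeasurableSpace M] [BorelSpace M] {U : Set (E (n + 1))}
  {ι ν : M → E (n + 1)} {θ : ℝ}

lemma integrable_area_of_continuous (h : IsProperTwoSidedImmersion U ι ν) {f : M → ℝ}
    (hf : Continuous f) {C : Set M} (hC : IsCompact C) (h0 : ∀ z ∉ C, f z = 0) :
    Integrable f (area ι) := by
  have := isLocallyFiniteMeasure_area h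
  exact hf.integrable_of_hasCompactSupport (HasCompactSupport.intro hC h0)

lemma integrable_boundaryArea_of_continuous (h : IsProperTwoSidedImmersion U ι ν) {f : M → ℝ}
    (hf : Continuous f) {C : Set M} (hC : IsCompact C) (h0 : ∀ z ∉ C, f z = 0) :
    Integrable f (boundaryArea ι) := by
  have := isLocallyFiniteMeasure_boundaryArea h
  exact hf.integrable_of_hasCompactSupport (HasCompactSupport.intro hC h0)

lemma tanDeriv_eq_zero_of_notMem (ι : M → E (n + 1)) {F : Type*} [NormedAddCommGroup F]
    [NormedSpace ℝ F] {f : M → F} {C : Set M} (hC : IsCompact C) (h0 : ∀ z ∉ C, f z = 0) {q : M}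
    (hq : q ∉ C) (v : E (n + 1)) : tanDeriv ι f q v = 0 :=
  tanDeriv_eq_zero_of_eventuallyEq ι
    (Filter.mem_of_superset (hC.isClosed.isOpen_compl.mem_nhds hq) h0) v

/-- The formula for the conormal makes sense on all of `M`, so the boundary integrands are
restrictions of continuous functions; their measurability and integrability follow from this. -/
lemma continuous_capillaryConormal (h : IsProperTwoSidedImmersion U ι ν) :
    Continuous (capillaryConormal θ ν) := by
  have hν := continuous_normal h
  unfold capillaryConormal
  fun_prop

lemma continuous_secondFF_conormal (h : IsProperTwoSidedImmersion U ι ν) (c : E (n + 1)) :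
    Continuous fun q => secondFF ι ν q c (capillaryConormal θ ν q) :=
  ((continuous_tanDeriv h h.contMDiff_normal c).inner (continuous_capillaryConormal h)).neg

/-- The integrand of the weak Jacobi equation for the component `⟨ν, c⟩` of the normal. -/
def jacobiIntegrand (ι ν : M → E (n + 1)) (c : E (n + 1)) (ζ : M → ℝ) (q : M) : ℝ :=
  (∑ b, tanDeriv ι ζ q (bvec b) * ⟪tanDeriv ι ν q (bvec b), c⟫_ℝ)
    - secondFFSq ι ν q * (⟪c, ν q⟫_ℝ * ζ q)

lemma continuous_jacobiIntegrand (h : IsProperTwoSidedImmersion U ι ν) (c : E (n + 1)) {ζ : M → ℝ}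
    (hζ : ContMDiff (𝓡∂ n) 𝓘(ℝ, ℝ) 1 ζ) : Continuous (jacobiIntegrand ι ν c ζ) := by
  unfold jacobiIntegrand
  refine (continuous_finsetSum _ fun b _ => (continuous_tanDeriv h hζ _).mul
    ((continuous_tanDeriv h h.contMDiff_normal _).inner continuous_const)).sub ?_
  exact (continuous_secondFFSq h).mul ((continuous_const.inner (continuous_normal h)).mul
    hζ.continuous)

lemma jacobiIntegrand_eq_zero (ι ν : M → E (n + 1)) (c : E (n + 1)) {ζ : M → ℝ} {C : Set M}
    (hC : IsCompact C) (h0 : ∀ z ∉ C, ζ z = 0) {q : M} (hq : q ∉ C) :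
    jacobiIntegrand ι ν c ζ q = 0 := by
  rw [jacobiIntegrand, h0 q hq, Finset.sum_eq_zero fun b _ => by
    rw [tanDeriv_eq_zero_of_notMem ι hC h0 hq, zero_mul]]
  ring

/-- The test function is extended by zero outside the image of the chart, and the local equation is
rewritten with the area measures. On the face the density is `√det g ‖e⁰‖` and `e⁰ = -‖e⁰‖ η`, which
turns the local boundary term into `-∫ ζ A(c, η)`. -/
lemma integral_jacobi_of_chart (h : IsCapillaryMinimal θ U ι ν) (hs : 0 < Real.sin θ) {p : M}
    {ζ : M → ℝ} (hζ : ContMDiff (𝓡∂ n) 𝓘(ℝ, ℝ) 1 ζ) {K : Set M} (hK : IsCompact K)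
    (hKs : K ⊆ (chart n p).source) (hKU : K ⊆ ι ⁻¹' U) (h0 : ∀ z ∉ K, ζ z = 0) (c : E (n + 1)) :
    ∫ q, jacobiIntegrand ι ν c ζ q ∂(area ι)
      = -∫ q, ζ q * secondFF ι ν q c (capillaryConormal θ ν q) ∂(boundaryArea ι) := by
  classical
  have hi := h.toIsProperTwoSidedImmersion
  obtain ⟨O, hO, hOt⟩ := exists_isOpen_chart_target (n := n) p
  set K' := chart n p '' K with hK'
  have hK'c : IsCompact K' := isCompact_chart_image hKs hK
  have hK't : K' ⊆ (chart n p).target := by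
    rintro _ ⟨z, hz, rfl⟩; exact (chart n p).map_source (hKs hz)
  have hK'O : K' ⊆ O := hK't.trans (by rw [hOt]; exact inter_subset_left)
  set Z : E n → ℝ := fun x => if x ∈ (chart n p).target then ζ ((chart n p).symm x) else 0 with hZ
  have hZt : ∀ x ∈ (chart n p).target, Z x = ζ ((chart n p).symm x) := fun x hx => if_pos hx
  have hZ0 : ∀ x ∉ K', Z x = 0 := by
    intro x hx
    by_cases hxt : x ∈ (chart n p).target
    · rw [hZt x hxt]
      exact h0 _ fun hz => hx ⟨_, hz, (chart n p).right_inv hxt⟩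
    · exact if_neg hxt
  have hZev : ∀ x ∈ (chart n p).target, Z =ᶠ[𝓝[modelHalf n] x] (ζ ∘ (chart n p).symm) := fun x hx =>
    Filter.mem_of_superset (chart_target_mem_nhdsWithin hx) hZt
  have hZc : ContDiffOn ℝ 1 Z (modelHalf n) :=
    contDiffOn_of_support hK'c.isClosed hK'O (fun x hx => by
      rw [← hOt] at hx
      exact (contDiffWithinAt_comp_chart_symm (by norm_num) hζ hx).congr_of_eventuallyEq
        (hZev x hx) (hZt x hx)) hZ0
  have hZd : ∀ x ∈ (chart n p).target, fderivWithin ℝ Z (modelHalf n) x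
      = fderivWithin ℝ (ζ ∘ (chart n p).symm) (modelHalf n) x := fun x hx =>
    (hZev x hx).fderivWithin_eq (hZt x hx)
  have hmem : ∀ x ∈ K', ι ((chart n p).symm x) ∈ U := by
    rintro _ ⟨z, hz, rfl⟩
    rw [(chart n p).left_inv (hKs hz)]
    exact hKU hz
  have key := integral_local_jacobi hO hK'c hK'O
    (fun x hx => hypersurfaceGerm_chart hi (p := p) (hOt ▸ hx)) (fun x hx => by
      have h1 := h.minimal _ (hmem x hx.1)
      rw [meanCurvature] at h1
      simp only [secondFF_eq_tanDeriv, Finset.sum_neg_distrib, neg_eq_zero] at h1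
      refine Eq.trans (Finset.sum_congr rfl fun b _ => ?_) h1
      rw [tanDeriv_symm_eq hi ν (hK't hx.1)]) hZc hZ0 c
  rw [integral_area_eq hi p (continuous_jacobiIntegrand hi c hζ).aestronglyMeasurable
      (fun z hz => jacobiIntegrand_eq_zero ι ν c hK h0 fun hzK => hz (hKs hzK)),
    integral_boundaryArea_eq hi p (f := fun q => ζ q * secondFF ι ν q c (capillaryConormal θ ν q))
      (hζ.continuous.mul (continuous_secondFF_conormal hi c)).aestronglyMeasurable
      (fun z hz => by rw [h0 z fun hzK => hz (hKs hzK), zero_mul])]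
  refine Eq.trans ?_ (key.trans ?_)
  · rw [setIntegral_eq_of_subset_of_forall_sdiff_eq_zero measurableSet_modelHalf
      (chart_target_subset p) (fun x hx => ?_)]
    · refine setIntegral_congr_fun (measurableSet_chart_target p) fun x hx => ?_
      simp only [jacobiIntegrand]
      rw [secondFFSq_eq]
      simp_rw [tanDeriv_symm_eq hi _ hx, hZd x hx, hZt x hx]
      rfl
    · have hxK : x ∉ K' := fun hxK => hx.2 (hK't hxK)
      rw [fderivWithin_eq_zero_of_notMem hK'c.isClosed hZ0 hxK, hZ0 x hxK]
      simp
  · congr 1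
    rw [← setIntegral_eq_integral_of_forall_compl_eq_zero (s := faceTarget n p) (fun y hy => ?_)]
    · refine setIntegral_congr_fun (isOpen_faceTarget p).measurableSet fun y hy => ?_
      change _ = jacobian _ * _ * (ζ ((chart n p).symm (faceIncl n y))
        * secondFF ι ν ((chart n p).symm (faceIncl n y)) c
          (capillaryConormal θ ν ((chart n p).symm (faceIncl n y))))
      have hyt : faceIncl n y ∈ (chart n p).target := hy
      by_cases hyK : faceIncl n y ∈ K'
      · obtain ⟨hd, -⟩ := dualVec_eq_capillaryConormal h hs hyt (faceIncl_zero_coord y)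
          (hmem _ hyK)
        rw [hZt _ hyt, secondFF_eq_tanDeriv, tanDeriv_symm_eq hi ν hyt]
        nth_rw 1 [hd]
        rw [inner_neg_right, inner_smul_right]
        ring
      · rw [← hZt _ hyt, hZ0 _ hyK]
        ring
    · rw [hZ0 _ fun hyK => hy (hK't hyK)]
      ring

/-- The weak Jacobi equation for the components of the normal. -/
lemma integral_jacobi (h : IsCapillaryMinimal θ U ι ν) (hs : 0 < Real.sin θ)
    {ζ : M → ℝ} (hζ : ContMDiff (𝓡∂ n) 𝓘(ℝ, ℝ) 1 ζ) {C : Set M} (hC : IsCompact C)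
    (hCU : C ⊆ ι ⁻¹' U) (h0 : ∀ z ∉ C, ζ z = 0) (c : E (n + 1)) :
    ∫ q, jacobiIntegrand ι ν c ζ q ∂(area ι)
      = -∫ q, ζ q * secondFF ι ν q c (capillaryConormal θ ν q) ∂(boundaryArea ι) := by
  have hi := h.toIsProperTwoSidedImmersion
  obtain ⟨T, χ, hχ, hχ0, hχ1⟩ := exists_chart_partition (n := n) hC
  have hsum : ∀ z, ζ z = ∑ k ∈ T, χ k z * ζ z := by
    intro z
    rw [← Finset.sum_mul]
    by_cases hz : z ∈ C
    · rw [hχ1 z hz, one_mul]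
    · rw [h0 z hz, mul_zero]
  have hχζ : ∀ k, ContMDiff (𝓡∂ n) 𝓘(ℝ, ℝ) 1 fun z => χ k z * ζ z := fun k => (hχ k).mul hζ
  have hz0 : ∀ k, ∀ z ∉ C, χ k z * ζ z = 0 := fun k z hz => by rw [h0 z hz, mul_zero]
  have hloc : ∀ k, ∫ q, jacobiIntegrand ι ν c (fun z => χ k z * ζ z) q ∂(area ι)
      = -∫ q, (χ k q * ζ q) * secondFF ι ν q c (capillaryConormal θ ν q) ∂(boundaryArea ι) := by
    intro k
    obtain ⟨K, hKs, hK, hK0⟩ := hχ0 k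
    refine integral_jacobi_of_chart h hs (hχζ k) (hK.inter hC) (inter_subset_left.trans hKs)
      (inter_subset_right.trans hCU) (fun z hz => ?_) c
    by_cases hzK : z ∈ K
    · exact hz0 k z fun hzC => hz ⟨hzK, hzC⟩
    · rw [hK0 z hzK, zero_mul]
  -- The integrand is linear in `ζ`, so the equation may be summed over a partition of unity.
  have h1 : ∀ q, jacobiIntegrand ι ν c ζ q
      = ∑ k ∈ T, jacobiIntegrand ι ν c (fun z => χ k z * ζ z) q := by
    intro q
    have h2 : ∀ b, tanDeriv ι ζ q (bvec b)
        = ∑ k ∈ T, tanDeriv ι (fun z => χ k z * ζ z) q (bvec b) := fun b => by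
      rw [← tanDeriv_sum ι T fun k _ => (hχζ k q).mdifferentiableAt (by norm_num)]
      exact congrArg (fun f => tanDeriv ι f q (bvec b)) (funext hsum)
    simp only [jacobiIntegrand]
    rw [Finset.sum_sub_distrib, Finset.sum_comm]
    simp_rw [h2, Finset.sum_mul]
    rw [← Finset.mul_sum, ← Finset.mul_sum, ← hsum q]
  have h2 : ∀ q, ζ q * secondFF ι ν q c (capillaryConormal θ ν q)
      = ∑ k ∈ T, (χ k q * ζ q) * secondFF ι ν q c (capillaryConormal θ ν q) := fun q => by
    rw [← Finset.sum_mul, ← hsum q]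
  simp_rw [h1]
  rw [integral_finsetSum _ fun k _ => integrable_area_of_continuous hi
    (continuous_jacobiIntegrand hi c (hχζ k)) hC
    fun z hz => jacobiIntegrand_eq_zero ι ν c hC (hz0 k) hz]
  rw [integral_congr_ae (Filter.Eventually.of_forall h2),
    integral_finsetSum _ fun k _ => integrable_boundaryArea_of_continuous hi
      (f := fun q => χ k q * ζ q * secondFF ι ν q c (capillaryConormal θ ν q))
      ((hχζ k).continuous.mul (continuous_secondFF_conormal hi c)) hC
      fun z hz => by rw [hz0 k z hz, zero_mul]]
  rw [← Finset.sum_neg_distrib]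
  exact Finset.sum_congr rfl fun k _ => hloc k

end WeakJacobi

/-! ### The square of the tilt function as a function of the normal. -/

section TiltPolynomial

variable {n : ℕ}

/-- `c` is a constant in the pointwise estimate of the second fundamental form. -/
def IsTiltConstant (n : ℕ) (k t c : ℝ) : Prop :=
  ∀ (B : E (n + 1) →ₗ[ℝ] E (n + 1)) (N : E (n + 1)),
    (∀ v w, ⟪B v, w⟫_ℝ = ⟪v, B w⟫_ℝ) → ‖N‖ = 1 → B N = 0 → (∑ i, ⟪B (bvec i), bvec i⟫_ℝ = 0) →
      ∀ ε : ℝ, 0 < ε →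
      c * (∑ i, ‖B (bvec i)‖ ^ 2) ≤
        (1 + k * t * (t - N 0)) * (∑ i, ‖B (bvec i)‖ ^ 2)
        - ‖B (bvec (Fin.last n))‖ ^ 2 - (1 - k) * ‖B (bvec 0)‖ ^ 2
        - ‖(N 0 + k * (t - N 0)) • B (bvec 0) + N (Fin.last n) • B (bvec (Fin.last n))‖ ^ 2
          / (1 - N 0 ^ 2 - N (Fin.last n) ^ 2 + k * (t - N 0) ^ 2 + ε)

/-- The square of the tilt function, as a nonnegative polynomial of the normal. -/
def tiltPoly (k t : ℝ) (v : E (n + 1)) : ℝ :=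
  ‖v‖ ^ 2 - v 0 ^ 2 - v (Fin.last n) ^ 2 + k * (t - v 0) ^ 2

/-- Having `‖v‖²` instead of `1` makes this true for all vectors. Hence `√(tiltPoly + ε)` is `C¹` on
the whole space, and its composition with `ν` is `C¹`. -/
lemma tiltPoly_nonneg (hn : 2 ≤ n) {k t : ℝ} (hk : 0 ≤ k) (v : E (n + 1)) : 0 ≤ tiltPoly k t v := by
  have h0 : (0 : Fin (n + 1)) ≠ Fin.last n := by
    intro h
    have := congrArg Fin.val h
    simp at this
    omega
  have h1 : v 0 ^ 2 + v (Fin.last n) ^ 2 ≤ ‖v‖ ^ 2 := by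
    rw [EuclideanSpace.real_norm_sq_eq, ← Finset.sum_pair h0 (f := fun i => v i ^ 2)]
    exact Finset.sum_le_sum_of_subset_of_nonneg (Finset.subset_univ _) fun i _ _ => sq_nonneg _
  have h2 : 0 ≤ k * (t - v 0) ^ 2 := by positivity
  rw [tiltPoly]
  linarith

lemma tiltPoly_of_norm_eq_one {k t : ℝ} {v : E (n + 1)} (hv : ‖v‖ = 1) :
    tiltPoly k t v = 1 - v 0 ^ 2 - v (Fin.last n) ^ 2 + k * (t - v 0) ^ 2 := by
  rw [tiltPoly, hv, one_pow]

/-- The coordinate of index `i` as a continuous linear form. -/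
abbrev coordForm (i : Fin (n + 1)) : E (n + 1) →L[ℝ] ℝ := EuclideanSpace.proj i

lemma contDiff_tiltPoly (k t : ℝ) : ContDiff ℝ 1 (tiltPoly (n := n) k t) := by
  have h : ∀ i : Fin (n + 1), ContDiff ℝ 1 fun v : E (n + 1) => v i := fun i =>
    (coordForm i).contDiff
  exact (((contDiff_norm_sq ℝ).sub ((h 0).pow 2)).sub ((h (Fin.last n)).pow 2)).add
    (contDiff_const.mul ((contDiff_const.sub (h 0)).pow 2))

lemma hasFDerivAt_tiltPoly (k t : ℝ) (v : E (n + 1)) :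
    HasFDerivAt (tiltPoly (n := n) k t)
      ((2 : ℝ) • (innerSL ℝ v) - (2 * v 0) • coordForm 0 - (2 * v (Fin.last n)) • coordForm (Fin.last n)
        - (2 * k * (t - v 0)) • coordForm 0) v := by
  have h : ∀ i : Fin (n + 1), HasFDerivAt (fun v : E (n + 1) => v i) (coordForm i) v := fun i =>
    (coordForm i).hasFDerivAt
  have h1 := (((hasStrictFDerivAt_norm_sq v).hasFDerivAt.sub ((h 0).pow 2)).sub
    ((h (Fin.last n)).pow 2)).add ((((h 0).const_sub t).pow 2).const_mul k)
  refine h1.congr_fderiv ?_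
  ext w
  simp
  ring

end TiltPolynomial

/-! ### The pointwise inequality that combines stability with the two Jacobi equations. -/

section C1Inequality

variable {n : ℕ} [NeZero n] {M : Type*} [TopologicalSpace M] [T2Space M]
  [SecondCountableTopology M] [ChartedSpace (EuclideanHalfSpace n) M]
  [IsManifold (𝓡∂ n) 2 M] [MeasurableSpace M] [BorelSpace M] {U : Set (E (n + 1))}
  {ι ν : M → E (n + 1)} {θ : ℝ}

lemma norm_sq_eq_sum_inner_bvec {d : ℕ} (v : E d) : ‖v‖ ^ 2 = ∑ b, ⟪v, bvec b⟫_ℝ ^ 2 := by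
  rw [EuclideanSpace.real_norm_sq_eq]
  refine Finset.sum_congr rfl fun b _ => ?_
  rw [real_inner_comm, inner_single_one_left]

/-- The shape operator, extended by zero on normal vectors (up to sign). -/
def shapeOp (ι ν : M → E (n + 1)) (q : M) : E (n + 1) →ₗ[ℝ] E (n + 1) :=
  ((mfderiv (𝓡∂ n) 𝓘(ℝ, E (n + 1)) ν q : E n →L[ℝ] E (n + 1)) ∘L leftInv (diff n ι q) :
    E (n + 1) →L[ℝ] E (n + 1))

/-- The left side is `|∇⟨ν, v⟩|²`; by symmetry of the shape operator it is the squared length of its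
value at `v`, the form in which the pointwise estimate applies. -/
lemma sum_sq_inner_tanDeriv (h : IsProperTwoSidedImmersion U ι ν) (q : M) (v : E (n + 1)) :
    ∑ b, ⟪tanDeriv ι ν q (bvec b), v⟫_ℝ ^ 2 = ‖tanDeriv ι ν q v‖ ^ 2 := by
  rw [norm_sq_eq_sum_inner_bvec]
  refine Finset.sum_congr rfl fun b _ => ?_
  rw [inner_tanDeriv_symm h, real_inner_comm]

lemma secondFFSq_eq_sum_norm (ι ν : M → E (n + 1)) (q : M) :
    secondFFSq ι ν q = ∑ b, ‖tanDeriv ι ν q (bvec b)‖ ^ 2 := by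
  rw [secondFFSq_eq]
  exact Finset.sum_congr rfl fun b _ => (norm_sq_eq_sum_inner_bvec _).symm

lemma tanDeriv_add_direction {F : Type*} [NormedAddCommGroup F] [NormedSpace ℝ F]
    (ι : M → E (n + 1)) (f : M → F) (q : M) (a b : ℝ) (v w : E (n + 1)) :
    tanDeriv ι f q (a • v + b • w) = a • tanDeriv ι f q v + b • tanDeriv ι f q w := by
  set L : E (n + 1) →L[ℝ] F :=
    (mfderiv (𝓡∂ n) 𝓘(ℝ, F) f q : E n →L[ℝ] F) ∘L leftInv (diff n ι q)
  change L (a • v + b • w) = a • L v + b • L w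
  rw [map_add, map_smul, map_smul]

lemma secondFFSq_nonneg (ι ν : M → E (n + 1)) (q : M) : 0 ≤ secondFFSq ι ν q :=
  Finset.sum_nonneg fun _ _ => Finset.sum_nonneg fun _ _ => sq_nonneg _

/-- The derivative of `ν`, extended by zero to the normal line, is a symmetric operator that kills
`ν` and, by minimality, has trace zero. -/
lemma tilt_bound_at (h : IsCapillaryMinimal θ U ι ν) {k c t : ℝ} (hc : IsTiltConstant n k t c)
    {ε : ℝ} (hε : 0 < ε) {q : M} (hq : ι q ∈ U) :
    c * secondFFSq ι ν q ≤ (1 + k * t * (t - ν q 0)) * secondFFSq ι ν q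
        - ‖tanDeriv ι ν q (bvec (Fin.last n))‖ ^ 2 - (1 - k) * ‖tanDeriv ι ν q (bvec 0)‖ ^ 2
        - ‖(ν q 0 + k * (t - ν q 0)) • tanDeriv ι ν q (bvec 0)
            + ν q (Fin.last n) • tanDeriv ι ν q (bvec (Fin.last n))‖ ^ 2
          / (1 - ν q 0 ^ 2 - ν q (Fin.last n) ^ 2 + k * (t - ν q 0) ^ 2 + ε) := by
  have hi := h.toIsProperTwoSidedImmersion
  have htr : ∑ i, ⟪shapeOp ι ν q (bvec i), bvec i⟫_ℝ = 0 := by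
    have h1 := h.minimal q hq
    rw [meanCurvature] at h1
    simp only [secondFF_eq_tanDeriv, Finset.sum_neg_distrib, neg_eq_zero] at h1
    exact h1
  have hbound := hc (shapeOp ι ν q) (ν q) (fun v w => inner_tanDeriv_symm hi q v w)
    (hi.norm_normal q) (tanDeriv_normal_direction hi ν q) htr ε hε
  rw [secondFFSq_eq_sum_norm]
  exact hbound

lemma contMDiff_sqrt_tiltPoly (h : IsProperTwoSidedImmersion U ι ν) (hn : 2 ≤ n) {k : ℝ}
    (hk : 0 ≤ k) (t : ℝ) {ε : ℝ} (hε : 0 < ε) :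
    ContMDiff (𝓡∂ n) 𝓘(ℝ, ℝ) 1 fun z => √(tiltPoly k t (ν z) + ε) := by
  have h1 : ContDiff ℝ 1 fun v : E (n + 1) => √(tiltPoly k t v + ε) :=
    ((contDiff_tiltPoly k t).add contDiff_const).sqrt fun v =>
      (add_pos_of_nonneg_of_pos (tiltPoly_nonneg hn hk v) hε).ne'
  exact h1.contMDiff.comp h.contMDiff_normal

lemma contMDiff_neg_tilt_coord (h : IsProperTwoSidedImmersion U ι ν) (k t : ℝ) :
    ContMDiff (𝓡∂ n) 𝓘(ℝ, ℝ) 1 fun z => -(ν z 0 + k * (t - ν z 0)) := by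
  have h1 : ContDiff ℝ 1 fun v : E (n + 1) => -(v 0 + k * (t - v 0)) :=
    ((coordForm 0).contDiff.add (contDiff_const.mul
      (contDiff_const.sub (coordForm 0).contDiff))).neg
  exact h1.contMDiff.comp h.contMDiff_normal

lemma contMDiff_neg_coord (h : IsProperTwoSidedImmersion U ι ν) (i : Fin (n + 1)) :
    ContMDiff (𝓡∂ n) 𝓘(ℝ, ℝ) 1 fun z => -(ν z i) := by
  have h1 : ContDiff ℝ 1 fun v : E (n + 1) => -(v i) := (coordForm i).contDiff.neg
  exact h1.contMDiff.comp h.contMDiff_normal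

/-- The pointwise inequality behind the integral estimate. -/
lemma pointwise_tilt_inequality (h : IsCapillaryMinimal θ U ι ν) (hn : 2 ≤ n) {k c : ℝ}
    (hk0 : 0 ≤ k) (hc : IsTiltConstant n k (Real.cos θ) c) {φ : M → ℝ}
    (hφ : ContMDiff (𝓡∂ n) 𝓘(ℝ, ℝ) 1 φ) {ε : ℝ} (hε : 0 < ε) {q : M} (hq : ι q ∈ U) :
    c * (secondFFSq ι ν q * φ q ^ 2)
        - (tiltPoly k (Real.cos θ) (ν q) + ε) * gradSq ι φ q
      ≤ secondFFSq ι ν q * (φ q * √(tiltPoly k (Real.cos θ) (ν q) + ε)) ^ 2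
        - gradSq ι (fun z => φ z * √(tiltPoly k (Real.cos θ) (ν z) + ε)) q
        + jacobiIntegrand ι ν (bvec 0)
          (fun z => φ z * φ z * -(ν z 0 + k * (Real.cos θ - ν z 0))) q
        + jacobiIntegrand ι ν (bvec (Fin.last n)) (fun z => φ z * φ z * -(ν z (Fin.last n))) q := by
  have hi := h.toIsProperTwoSidedImmersion
  have hν := hi.contMDiff_normal
  set t := Real.cos θ with ht
  set N := ν q with hN
  set x := N 0 with hx
  set y := N (Fin.last n) with hy
  set w := √(tiltPoly k t N + ε) with hw
  have hpos : 0 < tiltPoly k t N + ε := add_pos_of_nonneg_of_pos (tiltPoly_nonneg hn hk0 N) hε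
  have hwpos : 0 < w := Real.sqrt_pos.2 hpos
  have hw2 : w ^ 2 = tiltPoly k t N + ε := Real.sq_sqrt hpos.le
  have hN1 : ‖N‖ = 1 := hi.norm_normal q
  have hcontW := contMDiff_sqrt_tiltPoly hi hn hk0 t hε
  have hcont0 := contMDiff_neg_tilt_coord hi k t
  have hcontn := contMDiff_neg_coord hi (Fin.last n)
  have hφ2 : ContMDiff (𝓡∂ n) 𝓘(ℝ, ℝ) 1 fun z => φ z * φ z := hφ.mul hφ
  set S := fun b : Fin (n + 1) => tanDeriv ι ν q (bvec b) with hS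
  set D := fun b : Fin (n + 1) => tanDeriv ι φ q (bvec b) with hD
  set S0 := fun b : Fin (n + 1) => ⟪S b, bvec 0⟫_ℝ with hS0
  set Sn := fun b : Fin (n + 1) => ⟪S b, bvec (Fin.last n)⟫_ℝ with hSn
  have hcoord : ∀ (b i : Fin (n + 1)), (S b) i = ⟪S b, bvec i⟫_ℝ := fun b i => by
    rw [real_inner_comm, inner_single_one_left]
  -- The term `‖v‖²` of the polynomial contributes `2 ⟨ν, Dν⟩ = 0`.
  have hWd : ∀ b, tanDeriv ι (fun z => √(tiltPoly k t (ν z) + ε)) q (bvec b)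
      = (-(x + k * (t - x)) * S0 b - y * Sn b) / w := by
    intro b
    have h1 : HasFDerivAt (fun v : E (n + 1) => √(tiltPoly k t v + ε)) _ N :=
      ((hasFDerivAt_tiltPoly k t N).add_const ε).sqrt hpos.ne'
    rw [tanDeriv_comp ι hν q h1]
    have h2 : ⟪N, S b⟫_ℝ = 0 := by rw [real_inner_comm]; exact inner_tanDeriv_normal hi q _
    change (1 / (2 * w)) * (2 * ⟪N, S b⟫_ℝ - 2 * N 0 * (S b) 0
      - 2 * N (Fin.last n) * (S b) (Fin.last n) - 2 * k * (t - N 0) * (S b) 0) = _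
    rw [h2, hcoord, hcoord]
    field_simp
    ring
  have h0d : ∀ b, tanDeriv ι (fun z => -(ν z 0 + k * (t - ν z 0))) q (bvec b)
      = -(1 - k) * S0 b := by
    intro b
    have h1 : HasFDerivAt (fun v : E (n + 1) => -(v 0 + k * (t - v 0)))
        (-(coordForm 0 + k • -coordForm 0)) N :=
      ((coordForm 0).hasFDerivAt.add (((coordForm 0).hasFDerivAt.const_sub t).const_mul k)).neg
    rw [tanDeriv_comp ι hν q h1]
    change -((S b) 0 + k * -((S b) 0)) = _
    rw [hcoord]
    ring
  have hnd : ∀ b, tanDeriv ι (fun z => -(ν z (Fin.last n))) q (bvec b) = -Sn b := by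
    intro b
    have h1 : HasFDerivAt (fun v : E (n + 1) => -(v (Fin.last n))) (-coordForm (Fin.last n)) N :=
      (coordForm (Fin.last n)).hasFDerivAt.neg
    rw [tanDeriv_comp ι hν q h1]
    change -((S b) (Fin.last n)) = _
    rw [hcoord]
  have hφφ : ∀ b, tanDeriv ι (fun z => φ z * φ z) q (bvec b) = 2 * φ q * D b := fun b => by
    rw [tanDeriv_mul ι hφ hφ]
    ring
  have hψd : ∀ b, tanDeriv ι (fun z => φ z * √(tiltPoly k t (ν z) + ε)) q (bvec b)
      = φ q * ((-(x + k * (t - x)) * S0 b - y * Sn b) / w) + w * D b := fun b => by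
    rw [tanDeriv_mul ι hφ hcontW, hWd]
  have hζ0 : ∀ b, tanDeriv ι (fun z => φ z * φ z * -(ν z 0 + k * (t - ν z 0))) q (bvec b)
      = φ q ^ 2 * (-(1 - k) * S0 b) + -(x + k * (t - x)) * (2 * φ q * D b) := fun b => by
    rw [tanDeriv_mul ι hφ2 hcont0, h0d, hφφ]
    ring
  have hζn : ∀ b, tanDeriv ι (fun z => φ z * φ z * -(ν z (Fin.last n))) q (bvec b)
      = φ q ^ 2 * (-Sn b) + -y * (2 * φ q * D b) := fun b => by
    rw [tanDeriv_mul ι hφ2 hcontn, hnd, hφφ]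
    ring
  have hA0 : ∑ b, S0 b ^ 2 = ‖S 0‖ ^ 2 := sum_sq_inner_tanDeriv hi q _
  have hAn : ∑ b, Sn b ^ 2 = ‖S (Fin.last n)‖ ^ 2 := sum_sq_inner_tanDeriv hi q _
  have hAu : ∑ b, (-(x + k * (t - x)) * S0 b - y * Sn b) ^ 2
      = ‖(x + k * (t - x)) • S 0 + y • S (Fin.last n)‖ ^ 2 := by
    have h1 := sum_sq_inner_tanDeriv hi q ((x + k * (t - x)) • bvec 0 + y • bvec (Fin.last n))
    rw [tanDeriv_add_direction] at h1
    rw [← h1]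
    refine Finset.sum_congr rfl fun b _ => ?_
    rw [inner_add_right, inner_smul_right, inner_smul_right]
    change _ = ((x + k * (t - x)) * S0 b + y * Sn b) ^ 2
    ring
  -- The middle line is the cross term with `∇φ`. The cross terms in `hJ0` and `hJn` equal it, so
  -- they cancel when the squared gradient is subtracted.
  have hgrad : gradSq ι (fun z => φ z * √(tiltPoly k t (ν z) + ε)) q
      = φ q ^ 2 * (‖(x + k * (t - x)) • S 0 + y • S (Fin.last n)‖ ^ 2 / w ^ 2)
        + 2 * φ q * (-(x + k * (t - x)) * ∑ b, D b * S0 b - y * ∑ b, D b * Sn b)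
        + w ^ 2 * gradSq ι φ q := by
    rw [gradSq_eq, gradSq_eq, ← hAu, Finset.sum_div, Finset.mul_sum, Finset.mul_sum, Finset.mul_sum,
      Finset.mul_sum, ← Finset.sum_sub_distrib, Finset.mul_sum, ← Finset.sum_add_distrib,
      ← Finset.sum_add_distrib]
    refine Finset.sum_congr rfl fun b _ => ?_
    rw [hψd]
    change _ = _ + _ + w ^ 2 * D b ^ 2
    field_simp
    ring
  have hJ0 : jacobiIntegrand ι ν (bvec 0) (fun z => φ z * φ z * -(ν z 0 + k * (t - ν z 0))) q
      = φ q ^ 2 * (-(1 - k) * ‖S 0‖ ^ 2) + -(x + k * (t - x)) * (2 * φ q * ∑ b, D b * S0 b)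
        - secondFFSq ι ν q * (x * (φ q ^ 2 * -(x + k * (t - x)))) := by
    rw [jacobiIntegrand, inner_single_one_left, ← hA0]
    simp_rw [hζ0]
    congr 1
    · rw [Finset.mul_sum, Finset.mul_sum, Finset.mul_sum, Finset.mul_sum, ← Finset.sum_add_distrib]
      refine Finset.sum_congr rfl fun b _ => ?_
      change (_ + _) * S0 b = _
      ring
    · ring
  have hJn : jacobiIntegrand ι ν (bvec (Fin.last n)) (fun z => φ z * φ z * -(ν z (Fin.last n))) q
      = φ q ^ 2 * (-‖S (Fin.last n)‖ ^ 2) + -y * (2 * φ q * ∑ b, D b * Sn b)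
        - secondFFSq ι ν q * (y * (φ q ^ 2 * -y)) := by
    rw [jacobiIntegrand, inner_single_one_left, ← hAn]
    simp_rw [hζn]
    congr 1
    · rw [← Finset.sum_neg_distrib, Finset.mul_sum, Finset.mul_sum, Finset.mul_sum,
        ← Finset.sum_add_distrib]
      refine Finset.sum_congr rfl fun b _ => ?_
      change (_ + _) * Sn b = _
      ring
    · ring
  have hbound : c * secondFFSq ι ν q ≤ (1 + k * t * (t - x)) * secondFFSq ι ν q
      - ‖S (Fin.last n)‖ ^ 2 - (1 - k) * ‖S 0‖ ^ 2
      - ‖(x + k * (t - x)) • S 0 + y • S (Fin.last n)‖ ^ 2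
        / (1 - N 0 ^ 2 - N (Fin.last n) ^ 2 + k * (t - N 0) ^ 2 + ε) := tilt_bound_at h hc hε hq
  rw [← tiltPoly_of_norm_eq_one hN1, ← hw2] at hbound
  have hb2 := mul_le_mul_of_nonneg_left hbound (sq_nonneg (φ q))
  -- The perturbation also adds `ε |A|² φ²`; it has the favourable sign and is dropped.
  have hεA : 0 ≤ ε * (secondFFSq ι ν q * φ q ^ 2) :=
    mul_nonneg hε.le (mul_nonneg (secondFFSq_nonneg ι ν q) (sq_nonneg _))
  rw [hgrad, hJ0, hJn, mul_pow, hw2]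
  rw [hw2] at hb2
  have hG : tiltPoly k t N = 1 - x ^ 2 - y ^ 2 + k * (t - x) ^ 2 := tiltPoly_of_norm_eq_one hN1
  -- The coefficients of `|A|²` add up to `G + x (x + k (t - x)) + y² = 1 + k t (t - x)`, apart from
  -- `ε`.
  have hlam : secondFFSq ι ν q * (φ q ^ 2 * (tiltPoly k t N + ε))
      - secondFFSq ι ν q * (x * (φ q ^ 2 * -(x + k * (t - x))))
      - secondFFSq ι ν q * (y * (φ q ^ 2 * -y))
      = φ q ^ 2 * ((1 + k * t * (t - x)) * secondFFSq ι ν q) + ε * (secondFFSq ι ν q * φ q ^ 2) := by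
    rw [hG]; ring
  clear_value w x y S0 Sn D S t
  linarith

end C1Inequality

/-! ### The integral estimate for continuously differentiable functions. -/

section C1Integral

variable {n : ℕ} [NeZero n] {M : Type*} [TopologicalSpace M] [T2Space M]
  [SecondCountableTopology M] [ChartedSpace (EuclideanHalfSpace n) M]
  [IsManifold (𝓡∂ n) 2 M] [MeasurableSpace M] [BorelSpace M] {U : Set (E (n + 1))}
  {ι ν : M → E (n + 1)} {θ : ℝ}

lemma CompactlySupportedIn.of_isCompact (h : IsProperTwoSidedImmersion U ι ν) {φ : M → ℝ}
    {C : Set M} (hC : IsCompact C) (hCU : C ⊆ ι ⁻¹' U) (h0 : ∀ z ∉ C, φ z = 0) :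
    CompactlySupportedIn ι U φ :=
  ⟨ι '' C, image_subset_iff.2 hCU, hC.image (continuous_immersion h), fun z hz =>
    mem_image_of_mem ι (by_contra fun hzC => hz (h0 z hzC))⟩

lemma CompactlySupportedIn.exists_isCompact (h : IsProperTwoSidedImmersion U ι ν) {φ : M → ℝ}
    (hφ : CompactlySupportedIn ι U φ) :
    ∃ C : Set M, IsCompact C ∧ C ⊆ ι ⁻¹' U ∧ ∀ z ∉ C, φ z = 0 := by
  obtain ⟨K, hKU, hK, hs⟩ := hφ
  exact ⟨ι ⁻¹' K, h.proper K hKU hK, preimage_mono hKU, fun z hz => by_contra fun hne => hz (hs hne)⟩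

lemma gradSq_eq_zero_of_notMem (ι : M → E (n + 1)) {φ : M → ℝ} {C : Set M} (hC : IsCompact C)
    (h0 : ∀ z ∉ C, φ z = 0) {q : M} (hq : q ∉ C) : gradSq ι φ q = 0 := by
  rw [gradSq_eq]
  exact Finset.sum_eq_zero fun b _ => by
    rw [tanDeriv_eq_zero_of_notMem ι hC h0 hq, zero_pow two_ne_zero]

/-- The boundary terms cancel up to a term of order `ε`. -/
lemma boundary_terms (h : IsCapillaryMinimal θ U ι ν) (hU : IsOpen (ι ⁻¹' U))
    (hs : 0 < Real.sin θ) (hn : 2 ≤ n) (k ε : ℝ) {q : M} (hq : q ∈ (𝓡∂ n).boundary M) (hqU : ι q ∈ U) (r : ℝ) :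
    Real.cot θ * (secondFF ι ν q (capillaryConormal θ ν q) (capillaryConormal θ ν q)
          * (r ^ 2 * (tiltPoly k (Real.cos θ) (ν q) + ε)))
        - r * r * -(ν q 0 + k * (Real.cos θ - ν q 0)) * secondFF ι ν q (bvec 0) (capillaryConormal θ ν q)
        - r * r * -(ν q (Fin.last n)) * secondFF ι ν q (bvec (Fin.last n)) (capillaryConormal θ ν q)
      = ε * (Real.cot θ * (-(Real.sin θ)⁻¹ * secondFF ι ν q (bvec 0) (capillaryConormal θ ν q) * r ^ 2))
      := by
  have hν0 := h.contact_angle q hq hqU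
  have h1 := secondFF_capillaryConormal h hU hs hq hqU
  have he : ∀ v, ⟪capillaryConormal θ ν q, v⟫_ℝ
      = -((Real.sin θ)⁻¹ * (⟪(bvec 0 : E (n + 1)), v⟫_ℝ - Real.cos θ * ⟪ν q, v⟫_ℝ)) := fun v => by
    rw [capillaryConormal, inner_neg_left, inner_smul_left, inner_sub_left, inner_smul_left]
    simp
  have hη0 : ⟪capillaryConormal θ ν q, bvec 0⟫_ℝ = -Real.sin θ := by
    rw [he, inner_bvec_right, inner_bvec_right, hν0]
    have h2 : (bvec 0 : E (n + 1)) 0 = 1 := by simp [bvec]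
    rw [h2, show (1 : ℝ) - Real.cos θ * Real.cos θ = Real.sin θ * Real.sin θ by
      nlinarith [Real.sin_sq_add_cos_sq θ], inv_mul_cancel_left₀ hs.ne']
  have hηn : ⟪capillaryConormal θ ν q, bvec (Fin.last n)⟫_ℝ
      = (Real.sin θ)⁻¹ * (Real.cos θ * ν q (Fin.last n)) := by
    rw [he, inner_bvec_right, inner_bvec_right]
    have h2 : (bvec 0 : E (n + 1)) (Fin.last n) = 0 := by
      have : (0 : Fin (n + 1)) ≠ Fin.last n := fun h => by
        have := congrArg Fin.val h
        simp at this
        omega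
      simp [bvec, this.symm]
    rw [h2]
    ring
  -- On the boundary `G = sin² θ - ν_{n+1}²`. In multiples of `A(η, η)` the three terms are `cot θ
  -- (sin² θ - ν_{n+1}²)`, `-cos θ sin θ` and `cot θ ν_{n+1}²`, with sum zero. The part with `ε` is
  -- written through `A(e₁, η) = -sin θ A(η, η)`.
  rw [h1 (bvec 0), h1 (bvec (Fin.last n)), hη0, hηn, tiltPoly_of_norm_eq_one (h.norm_normal q), hν0,
    Real.cot_eq_cos_div_sin]
  have h3 : 1 - Real.cos θ ^ 2 = Real.sin θ ^ 2 := by linarith [Real.sin_sq_add_cos_sq θ]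
  rw [h3]
  field_simp
  ring

/-- The estimate for `C¹` functions, up to an error of order `ε`. -/
lemma tilt_inequality_with_error (h : IsStableCapillaryMinimal θ U ι ν) (hU : IsOpen (ι ⁻¹' U))
    (hs : 0 < Real.sin θ) (hn : 2 ≤ n) {k c : ℝ} (hk0 : 0 ≤ k)
    (hc : IsTiltConstant n k (Real.cos θ) c) {φ : M → ℝ} (hφ : ContMDiff (𝓡∂ n) 𝓘(ℝ, ℝ) 1 φ)
    {C : Set M} (hC : IsCompact C) (hCU : C ⊆ ι ⁻¹' U) (h0 : ∀ z ∉ C, φ z = 0) {ε : ℝ}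
    (hε : 0 < ε) :
    c * ∫ q, secondFFSq ι ν q * φ q ^ 2 ∂(area ι)
      ≤ ∫ q, gradSq ι φ q * tiltPoly k (Real.cos θ) (ν q) ∂(area ι)
        + ε * (∫ q, gradSq ι φ q ∂(area ι) + ∫ q, Real.cot θ *
          (-(Real.sin θ)⁻¹ * secondFF ι ν q (bvec 0) (capillaryConormal θ ν q) * φ q ^ 2)
            ∂(boundaryArea ι)) := by
  have hcap := h.toIsCapillaryMinimal
  have hi := hcap.toIsProperTwoSidedImmersion
  set t := Real.cos θ with ht
  set G := fun z => tiltPoly k t (ν z) with hG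
  have hGc : Continuous G := (contDiff_tiltPoly k t).continuous.comp (continuous_normal hi)
  have hφ2 : ContMDiff (𝓡∂ n) 𝓘(ℝ, ℝ) 1 fun z => φ z * φ z := hφ.mul hφ
  set ψ := fun z => φ z * √(tiltPoly k t (ν z) + ε) with hψ
  have hψc : ContMDiff (𝓡∂ n) 𝓘(ℝ, ℝ) 1 ψ := hφ.mul (contMDiff_sqrt_tiltPoly hi hn hk0 t hε)
  have hψ0 : ∀ z ∉ C, ψ z = 0 := fun z hz => by simp [hψ, h0 z hz]
  set ζ₀ := fun z => φ z * φ z * -(ν z 0 + k * (t - ν z 0)) with hζ₀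
  have hζ₀c : ContMDiff (𝓡∂ n) 𝓘(ℝ, ℝ) 1 ζ₀ := hφ2.mul (contMDiff_neg_tilt_coord hi k t)
  have hζ₀0 : ∀ z ∉ C, ζ₀ z = 0 := fun z hz => by simp [hζ₀, h0 z hz]
  set ζₙ := fun z => φ z * φ z * -(ν z (Fin.last n)) with hζₙ
  have hζₙc : ContMDiff (𝓡∂ n) 𝓘(ℝ, ℝ) 1 ζₙ := hφ2.mul (contMDiff_neg_coord hi (Fin.last n))
  have hζₙ0 : ∀ z ∉ C, ζₙ z = 0 := fun z hz => by simp [hζₙ, h0 z hz]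
  have hJ₀ := integral_jacobi hcap hs hζ₀c hC hCU hζ₀0 (bvec 0)
  have hJₙ := integral_jacobi hcap hs hζₙc hC hCU hζₙ0 (bvec (Fin.last n))
  have hstab := h.stable ψ hψc (CompactlySupportedIn.of_isCompact hi hC hCU hψ0)
  have hφc := hφ.continuous
  have i1 : Integrable (fun q => secondFFSq ι ν q * φ q ^ 2) (area ι) :=
    integrable_area_of_continuous hi ((continuous_secondFFSq hi).mul (hφc.pow 2)) hC
      fun z hz => by rw [h0 z hz]; ring
  have i2 : Integrable (gradSq ι φ) (area ι) :=
    integrable_area_of_continuous hi (continuous_gradSq hi hφ) hC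
      fun z hz => gradSq_eq_zero_of_notMem ι hC h0 hz
  have i3 : Integrable (fun q => gradSq ι φ q * G q) (area ι) :=
    integrable_area_of_continuous hi ((continuous_gradSq hi hφ).mul hGc) hC
      fun z hz => by rw [gradSq_eq_zero_of_notMem ι hC h0 hz, zero_mul]
  have i4 : Integrable (fun q => secondFFSq ι ν q * ψ q ^ 2) (area ι) :=
    integrable_area_of_continuous hi ((continuous_secondFFSq hi).mul (hψc.continuous.pow 2)) hC
      fun z hz => by rw [hψ0 z hz]; ring
  have i5 : Integrable (gradSq ι ψ) (area ι) :=
    integrable_area_of_continuous hi (continuous_gradSq hi hψc) hC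
      fun z hz => gradSq_eq_zero_of_notMem ι hC hψ0 hz
  have i6 : Integrable (jacobiIntegrand ι ν (bvec 0) ζ₀) (area ι) :=
    integrable_area_of_continuous hi (continuous_jacobiIntegrand hi _ hζ₀c) hC
      fun z hz => jacobiIntegrand_eq_zero ι ν _ hC hζ₀0 hz
  have i7 : Integrable (jacobiIntegrand ι ν (bvec (Fin.last n)) ζₙ) (area ι) :=
    integrable_area_of_continuous hi (continuous_jacobiIntegrand hi _ hζₙc) hC
      fun z hz => jacobiIntegrand_eq_zero ι ν _ hC hζₙ0 hz
  -- Outside `C` both sides vanish; inside, this is the pointwise inequality.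
  have hpt : ∀ q, c * (secondFFSq ι ν q * φ q ^ 2) - (gradSq ι φ q * G q + ε * gradSq ι φ q)
      ≤ secondFFSq ι ν q * ψ q ^ 2 - gradSq ι ψ q + jacobiIntegrand ι ν (bvec 0) ζ₀ q
        + jacobiIntegrand ι ν (bvec (Fin.last n)) ζₙ q := by
    intro q
    by_cases hq : q ∈ C
    · have := pointwise_tilt_inequality hcap hn hk0 hc hφ hε (hCU hq)
      refine le_trans (le_of_eq ?_) this
      rw [hG]
      ring
    · rw [gradSq_eq_zero_of_notMem ι hC h0 hq, gradSq_eq_zero_of_notMem ι hC hψ0 hq, h0 q hq,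
        hψ0 q hq, jacobiIntegrand_eq_zero ι ν _ hC hζ₀0 hq, jacobiIntegrand_eq_zero ι ν _ hC hζₙ0 hq]
      simp
  have hint := integral_mono ((i1.const_mul c).sub (i3.add (i2.const_mul ε)))
    (((i4.sub i5).add i6).add i7) hpt
  rw [integral_sub' (i1.const_mul c) (i3.add (i2.const_mul ε)), integral_add' i3 (i2.const_mul ε),
    integral_const_mul, integral_const_mul, integral_add' ((i4.sub i5).add i6) i7,
    integral_add' (i4.sub i5) i6, integral_sub' i4 i5, hJ₀, hJₙ] at hint
  have hae := ae_boundaryArea_mem_boundary (n := n) ι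
  have hconf : ∀ v, Continuous fun q => secondFF ι ν q v (capillaryConormal θ ν q) :=
    continuous_secondFF_conormal hi
  -- The boundary measure is carried by the boundary, so the pointwise cancellation holds almost
  -- everywhere and only the term with `ε` and the two Jacobi boundary terms remain.
  have hbd : Real.cot θ * ∫ q, secondFF ι ν q (outerConormal ι q) (outerConormal ι q) * ψ q ^ 2
        ∂(boundaryArea ι)
      = ∫ q, (ε * (Real.cot θ * (-(Real.sin θ)⁻¹ * secondFF ι ν q (bvec 0) (capillaryConormal θ ν q)
          * φ q ^ 2)) + ζ₀ q * secondFF ι ν q (bvec 0) (capillaryConormal θ ν q))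
          + ζₙ q * secondFF ι ν q (bvec (Fin.last n)) (capillaryConormal θ ν q)
          ∂(boundaryArea ι) := by
    rw [← integral_const_mul]
    refine integral_congr_ae ?_
    filter_upwards [hae] with q hq
    by_cases hqC : q ∈ C
    · have hb := boundary_terms hcap hU hs hn k ε hq (hCU hqC) (φ q)
      have hpos : 0 ≤ tiltPoly k t (ν q) + ε := add_nonneg (tiltPoly_nonneg hn hk0 _) hε.le
      have hψ2 : ψ q ^ 2 = φ q ^ 2 * (tiltPoly k t (ν q) + ε) := by
        rw [hψ]
        change (φ q * √(tiltPoly k t (ν q) + ε)) ^ 2 = _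
        rw [mul_pow, Real.sq_sqrt hpos]
      rw [outerConormal_eq hcap hs hq (hCU hqC), hψ2, ← hb]
      ring
    · rw [hψ0 q hqC, h0 q hqC, hζ₀0 q hqC, hζₙ0 q hqC]
      simp
  have j1 : Integrable (fun q => Real.cot θ * (-(Real.sin θ)⁻¹
      * secondFF ι ν q (bvec 0) (capillaryConormal θ ν q) * φ q ^ 2)) (boundaryArea ι) :=
    integrable_boundaryArea_of_continuous hi
      (continuous_const.mul ((continuous_const.mul (hconf _)).mul (hφc.pow 2))) hC
      fun z hz => by rw [h0 z hz]; ring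
  have j2 : Integrable (fun q => ζ₀ q * secondFF ι ν q (bvec 0) (capillaryConormal θ ν q))
      (boundaryArea ι) :=
    integrable_boundaryArea_of_continuous hi (hζ₀c.continuous.mul (hconf _)) hC
      fun z hz => by rw [hζ₀0 z hz, zero_mul]
  have j3 : Integrable (fun q => ζₙ q * secondFF ι ν q (bvec (Fin.last n)) (capillaryConormal θ ν q))
      (boundaryArea ι) :=
    integrable_boundaryArea_of_continuous hi (hζₙc.continuous.mul (hconf _)) hC
      fun z hz => by rw [hζₙ0 z hz, zero_mul]
  have j12 : Integrable (fun q => ε * (Real.cot θ * (-(Real.sin θ)⁻¹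
      * secondFF ι ν q (bvec 0) (capillaryConormal θ ν q) * φ q ^ 2))
      + ζ₀ q * secondFF ι ν q (bvec 0) (capillaryConormal θ ν q)) (boundaryArea ι) :=
    (j1.const_mul ε).add j2
  rw [integral_add j12 j3, integral_add (j1.const_mul ε) j2, integral_const_mul ε] at hbd
  rw [hbd] at hstab
  linarith

/-- The curvature estimate for `C¹` functions. -/
lemma tilt_inequality_of_contMDiff (h : IsStableCapillaryMinimal θ U ι ν) (hU : IsOpen (ι ⁻¹' U))
    (hs : 0 < Real.sin θ) (hn : 2 ≤ n) {k c : ℝ} (hk0 : 0 ≤ k)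
    (hc : IsTiltConstant n k (Real.cos θ) c) {φ : M → ℝ} (hφ : ContMDiff (𝓡∂ n) 𝓘(ℝ, ℝ) 1 φ)
    {C : Set M} (hC : IsCompact C) (hCU : C ⊆ ι ⁻¹' U) (h0 : ∀ z ∉ C, φ z = 0) :
    c * ∫ q, secondFFSq ι ν q * φ q ^ 2 ∂(area ι)
      ≤ ∫ q, gradSq ι φ q * tiltPoly k (Real.cos θ) (ν q) ∂(area ι) := by
  have key := fun ε (hε : (0 : ℝ) < ε) =>
    tilt_inequality_with_error h hU hs hn hk0 hc hφ hC hCU h0 hε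
  set R := ∫ q, gradSq ι φ q ∂(area ι) + ∫ q, Real.cot θ *
    (-(Real.sin θ)⁻¹ * secondFF ι ν q (bvec 0) (capillaryConormal θ ν q) * φ q ^ 2) ∂(boundaryArea ι)
  refine le_of_forall_pos_le_add fun δ hδ => ?_
  have h1 : 0 < |R| + 1 := by positivity
  -- The factor `R` does not depend on `ε`; this choice makes the error at most `δ`.
  refine (key (δ / (|R| + 1)) (by positivity)).trans (add_le_add_right ?_ _)
  calc δ / (|R| + 1) * R ≤ δ / (|R| + 1) * (|R| + 1) := by
        gcongr
        linarith [le_abs_self R]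
    _ = δ := div_mul_cancel₀ _ h1.ne'

end C1Integral

/-! ### Approximation of Lipschitz functions on Euclidean space. -/

section Mollification

open scoped Convolution

variable {d : ℕ} {g : E d → ℝ} {L : NNReal}

lemma locallyIntegrable_fderiv_of_lipschitz (hg : LipschitzWith L g) :
    LocallyIntegrable (fderiv ℝ g) := by
  refine (locallyIntegrable_const (L : ℝ)).mono (measurable_fderiv ℝ g).aestronglyMeasurable ?_
  refine Filter.Eventually.of_forall fun x => ?_
  exact (norm_fderiv_le_of_lipschitz ℝ hg).trans (le_abs_self _)

/-- The derivative of a mollified Lipschitz function is the mollified derivative. -/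
lemma hasFDerivAt_mollified (hg : LipschitzWith L g) (ρ : ContDiffBump (0 : E d)) (x : E d) :
    HasFDerivAt (ρ.normed volume ⋆[ContinuousLinearMap.lsmul ℝ ℝ, volume] g)
      ((ρ.normed volume ⋆[ContinuousLinearMap.lsmul ℝ ℝ, volume] fderiv ℝ g) x) x := by
  have hρc : Continuous (ρ.normed (volume : Measure (E d))) := ρ.continuous_normed
  have hρs : HasCompactSupport (ρ.normed (volume : Measure (E d))) := ρ.hasCompactSupport_normed
  have hρi : Integrable (ρ.normed (volume : Measure (E d))) := ρ.integrable_normed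
  have hρ0 : ∀ t, 0 ≤ ρ.normed (volume : Measure (E d)) t := ρ.nonneg_normed
  have hmp : MeasurePreserving (fun t : E d => x - t) volume volume :=
    Measure.measurePreserving_sub_left volume x
  have hcont : ∀ y, Continuous fun t => ρ.normed (volume : Measure (E d)) t • g (y - t) := fun y =>
    hρc.smul (hg.continuous.comp (continuous_const.sub continuous_id))
  have h := hasFDerivAt_integral_of_dominated_loc_of_lip (μ := (volume : Measure (E d)))
    (F := fun y t => ρ.normed volume t • g (y - t))
    (F' := fun t => ρ.normed volume t • fderiv ℝ g (x - t))
    (bound := fun t => ρ.normed volume t * L) (s := univ) (x₀ := x) Filter.univ_mem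
    (Filter.Eventually.of_forall fun y => (hcont y).aestronglyMeasurable)
    ((hcont x).integrable_of_hasCompactSupport hρs.smul_right)
    (hρc.aestronglyMeasurable.smul
      ((measurable_fderiv ℝ g).comp (measurable_const.sub measurable_id)).aestronglyMeasurable)
    (Filter.Eventually.of_forall fun t => ?_) (hρi.mul_const _) ?_
  · exact h.2
  · refine LipschitzOnWith.of_dist_le_mul fun y _ z _ => ?_
    have hb : 0 ≤ ρ.normed volume t * (L : ℝ) := mul_nonneg (hρ0 t) L.2
    rw [Real.dist_eq, ← smul_sub, smul_eq_mul, abs_mul, abs_of_nonneg (hρ0 t), Real.coe_nnabs,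
      abs_of_nonneg hb, mul_assoc, ← Real.dist_eq]
    refine mul_le_mul_of_nonneg_left ?_ (hρ0 t)
    have := hg.dist_le_mul (y - t) (z - t)
    rwa [dist_sub_right] at this
  -- By Rademacher's theorem `g` is differentiable at `x - t` for almost every `t`, which permits
  -- differentiation under the integral.
  · have h1 := hmp.quasiMeasurePreserving.ae (hg.ae_differentiableAt (μ := (volume : Measure (E d))))
    filter_upwards [h1] with t ht
    have h2 : HasFDerivAt (fun y => g (y - t)) (fderiv ℝ g (x - t)) x := by
      have := ht.hasFDerivAt.comp x ((hasFDerivAt_id x).sub_const t)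
      rw [ContinuousLinearMap.comp_id] at this
      exact this
    exact h2.const_smul (ρ.normed volume t)

/-- Lipschitz functions are approximated by `C¹` functions together with their derivatives. -/
lemma exists_contDiff_approx (hg : LipschitzWith L g) :
    ∃ h : ℕ → E d → ℝ, (∀ j, ContDiff ℝ 1 (h j)) ∧ (∀ j x, |h j x - g x| ≤ L) ∧
      (∀ x, Filter.Tendsto (fun j => h j x) Filter.atTop (𝓝 (g x))) ∧
      (∀ j x, ‖fderiv ℝ (h j) x‖ ≤ L) ∧
      ∀ᵐ x : E d, DifferentiableAt ℝ g x ∧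
        Filter.Tendsto (fun j => fderiv ℝ (h j) x) Filter.atTop (𝓝 (fderiv ℝ g x)) := by
  have hpos : ∀ j : ℕ, (0 : ℝ) < 1 / ((j : ℝ) + 1) := fun j => by positivity
  -- The outer radius `1/(j + 1)` is at most `1`, so the error is at most the Lipschitz constant.
  -- The fixed ratio `2` of the radii is what the almost everywhere convergence of mollified locally
  -- integrable functions requires.
  set ρ : ℕ → ContDiffBump (0 : E d) := fun j =>
    ⟨1 / ((j : ℝ) + 1) / 2, 1 / ((j : ℝ) + 1), half_pos (hpos j), half_lt_self (hpos j)⟩ with hρ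
  have hout : Filter.Tendsto (fun j => (ρ j).rOut) Filter.atTop (𝓝 0) :=
    tendsto_one_div_add_atTop_nhds_zero_nat
  have hratio : ∀ᶠ j in Filter.atTop, (ρ j).rOut ≤ 2 * (ρ j).rIn :=
    Filter.Eventually.of_forall fun j => by
      change 1 / ((j : ℝ) + 1) ≤ 2 * (1 / ((j : ℝ) + 1) / 2)
      linarith
  have hder := fun j x => hasFDerivAt_mollified hg (ρ j) x
  refine ⟨fun j => (ρ j).normed volume ⋆[ContinuousLinearMap.lsmul ℝ ℝ, volume] g, fun j => ?_,
    fun j x => ?_, fun x => ?_, fun j x => ?_, ?_⟩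
  · exact (ρ j).hasCompactSupport_normed.contDiff_convolution_left (n := 1) _ (ρ j).contDiff_normed
      hg.continuous.locallyIntegrable
  · rw [← Real.dist_eq]
    refine (ρ j).dist_normed_convolution_le hg.continuous.aestronglyMeasurable fun y hy => ?_
    have h1 : dist y x ≤ 1 := by
      refine (Metric.mem_ball.1 hy).le.trans ?_
      change 1 / ((j : ℝ) + 1) ≤ 1
      rw [div_le_one (by positivity)]
      linarith [(Nat.cast_nonneg j : (0 : ℝ) ≤ j)]
    exact (hg.dist_le_mul y x).trans (mul_le_of_le_one_right L.2 h1)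
  · exact ContDiffBump.convolution_tendsto_right_of_continuous hout hg.continuous x
  · rw [(hder j x).fderiv]
    refine (norm_integral_le_of_norm_le ((ρ j).integrable_normed.mul_const (L : ℝ))
      (Filter.Eventually.of_forall fun t => ?_)).trans (le_of_eq ?_)
    · rw [ContinuousLinearMap.lsmul_apply, norm_smul, Real.norm_of_nonneg ((ρ j).nonneg_normed t)]
      exact mul_le_mul_of_nonneg_left (norm_fderiv_le_of_lipschitz ℝ hg) ((ρ j).nonneg_normed t)
    · rw [integral_mul_const, (ρ j).integral_normed, one_mul]
  · filter_upwards [hg.ae_differentiableAt (μ := (volume : Measure (E d))),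
      ContDiffBump.ae_convolution_tendsto_right_of_locallyIntegrable (μ := (volume : Measure (E d)))
        hout hratio (locallyIntegrable_fderiv_of_lipschitz hg)] with x hx hx2
    refine ⟨hx, hx2.congr fun j => ((hder j x).fderiv).symm⟩

end Mollification

/-! ### Approximation of Lipschitz functions supported in a chart. -/

section ChartApproximation

variable {n : ℕ} [NeZero n] {M : Type*} [TopologicalSpace M] [T2Space M]
  [ChartedSpace (EuclideanHalfSpace n) M]
  [IsManifold (𝓡∂ n) 2 M] [MeasurableSpace M] [BorelSpace M] {U : Set (E (n + 1))}
  {ι ν : M → E (n + 1)}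

/-- A sequence of `C¹` functions with supports in `K₁` that approximates `u` with first derivatives,
boundedly and almost everywhere. -/
structure IsC1Approx (ι : M → E (n + 1)) (w : ℕ → M → ℝ) (K₁ : Set M) (u : M → ℝ) : Prop where
  contMDiff : ∀ j, ContMDiff (𝓡∂ n) 𝓘(ℝ, ℝ) 1 (w j)
  eq_zero : ∀ j, ∀ z ∉ K₁, w j z = 0
  tendsto : ∀ z, Filter.Tendsto (fun j => w j z) Filter.atTop (𝓝 (u z))
  bound : ∃ R : ℝ, ∀ j z, |w j z| ≤ R ∧ ∀ b, |tanDeriv ι (w j) z (bvec b)| ≤ R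
  ae_tendsto : ∀ᵐ z ∂(area ι), MDifferentiableAt (𝓡∂ n) 𝓘(ℝ, ℝ) u z ∧
    ∀ b, Filter.Tendsto (fun j => tanDeriv ι (w j) z (bvec b)) Filter.atTop
      (𝓝 (tanDeriv ι u z (bvec b)))

lemma tanDeriv_of_chart (h : IsProperTwoSidedImmersion U ι ν) {f : M → ℝ} {p : M} {x : E n}
    (hx : x ∈ (chart n p).target) {f' : E n →L[ℝ] ℝ}
    (hf : HasFDerivWithinAt (f ∘ (chart n p).symm) f' (modelHalf n) x) (v : E (n + 1)) :
    tanDeriv ι f ((chart n p).symm x) v = f' (leftInv (chartDeriv ι p x) v) := by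
  rw [tanDeriv_symm_eq h f hx, hf.fderivWithin (uniqueDiffOn_modelHalf x (chart_target_subset p hx))]

lemma contMDiff_mul_comp_chart {χ : M → ℝ} (hχ : ContMDiff (𝓡∂ n) 𝓘(ℝ, ℝ) 1 χ) {p : M} {K : Set M}
    (hK : IsCompact K) (hKs : K ⊆ (chart n p).source) (h0 : ∀ z ∉ K, χ z = 0) {f : E n → ℝ}
    (hf : ContDiff ℝ 1 f) : ContMDiff (𝓡∂ n) 𝓘(ℝ, ℝ) 1 fun z => χ z * f (chart n p z) := by
  intro z
  by_cases hzs : z ∈ (chart n p).source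
  · exact (hχ z).mul (hf.contMDiff.contMDiffAt.comp z
      ((contMDiffAt_extChartAt' (n := 2) (by rwa [extChartAt_source] at hzs)).of_le (by norm_num)))
  · refine contMDiffAt_const (c := (0 : ℝ)).congr_of_eventuallyEq ?_
    filter_upwards [hK.isClosed.isOpen_compl.mem_nhds fun hz => hzs (hKs hz)] with y hy
    rw [h0 y hy, zero_mul]

lemma tanDeriv_mul_comp_chart (h : IsProperTwoSidedImmersion U ι ν) {χ : M → ℝ}
    (hχ : ContMDiff (𝓡∂ n) 𝓘(ℝ, ℝ) 1 χ) {p : M} {f : E n → ℝ} (hf : ContDiff ℝ 1 f) {x : E n}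
    (hx : x ∈ (chart n p).target) (v : E (n + 1)) :
    tanDeriv ι (fun z => χ z * f (chart n p z)) ((chart n p).symm x) v
      = χ ((chart n p).symm x) * fderiv ℝ f x (leftInv (chartDeriv ι p x) v)
        + f x * tanDeriv ι χ ((chart n p).symm x) v := by
  have h1 := ((contDiffWithinAt_comp_chart_symm (by norm_num) hχ hx).differentiableWithinAt
    (by norm_num)).hasFDerivWithinAt
  have h2 : HasFDerivWithinAt f (fderiv ℝ f x) (modelHalf n) x :=
    ((hf.differentiable (by norm_num)) x).hasFDerivAt.hasFDerivWithinAt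
  have h3 : ((fun z => χ z * f (chart n p z)) ∘ (chart n p).symm)
      =ᶠ[𝓝[modelHalf n] x] fun y => (χ ∘ (chart n p).symm) y * f y := by
    filter_upwards [chart_target_mem_nhdsWithin hx] with y hy
    simp only [Function.comp]
    rw [(chart n p).right_inv hy]
  have h4 := (h1.mul h2).congr_of_eventuallyEq h3 (h3.self_of_nhdsWithin (chart_target_subset p hx))
  rw [tanDeriv_of_chart h hx h4, tanDeriv_of_chart h hx h1]
  rfl

/-- The function is read in the chart, extended to a Lipschitz function on all of Euclidean space,
mollified there, and cut off again by `χ`. The extension past the boundary of the half-space allows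
mollification across it. -/
lemma exists_isC1Approx_of_chart (h : IsProperTwoSidedImmersion U ι ν) {p : M} {u : M → ℝ}
    (hu : LocallyLipschitzOn (chart n p).target (u ∘ (chart n p).symm)) {K V : Set M}
    (hK : IsCompact K) (hKs : K ⊆ (chart n p).source) (hV : IsOpen V) (hKV : K ⊆ V)
    (h0 : ∀ z ∉ K, u z = 0) :
    ∃ (w : ℕ → M → ℝ) (K₁ : Set M), IsCompact K₁ ∧ K₁ ⊆ V ∧ IsC1Approx ι w K₁ u := by
  obtain ⟨χ, K₁, hχ, hK₁, hK₁s, hK₁V, hχ0, hχ1⟩ := exists_chart_cutoff hK hKs hV hKV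
  have hXc : IsCompact (chart n p '' K₁) := isCompact_chart_image hK₁s hK₁
  have hXt : chart n p '' K₁ ⊆ (chart n p).target := by
    rintro _ ⟨z, hz, rfl⟩; exact (chart n p).map_source (hK₁s hz)
  obtain ⟨L, hL⟩ := (hu.mono hXt).exists_lipschitzOnWith_of_compact hXc
  obtain ⟨g, hg, hgeq⟩ := hL.extend_real
  have hgu : ∀ z ∈ K₁, g (chart n p z) = u z := fun z hz => by
    rw [← hgeq (mem_image_of_mem _ hz), Function.comp_apply, (chart n p).left_inv (hK₁s hz)]
  obtain ⟨f, hf, hfg, hft, hfL, hfae⟩ := exists_contDiff_approx hg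
  have hKK₁ : K ⊆ K₁ := fun z hz => by
    by_contra hzK
    have := (hχ1 z hz).self_of_nhds
    rw [hχ0 z hzK] at this
    exact zero_ne_one this
  have hw0 : ∀ j, ∀ z ∉ K₁, χ z * f j (chart n p z) = 0 := fun j z hz => by rw [hχ0 z hz, zero_mul]
  have hχd0 : ∀ z ∉ K₁, ∀ v, tanDeriv ι χ z v = 0 := fun z hz v =>
    tanDeriv_eq_zero_of_eventuallyEq ι
      (Filter.mem_of_superset (hK₁.isClosed.isOpen_compl.mem_nhds hz) hχ0) v
  have hwd0 : ∀ j, ∀ z ∉ K₁, ∀ v, tanDeriv ι (fun z => χ z * f j (chart n p z)) z v = 0 :=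
    fun j z hz v => tanDeriv_eq_zero_of_eventuallyEq ι
      (Filter.mem_of_superset (hK₁.isClosed.isOpen_compl.mem_nhds hz) (hw0 j)) v
  have hu0 : ∀ z ∉ K, ∀ᶠ y in 𝓝 z, u y = 0 := fun z hz =>
    Filter.mem_of_superset (hK.isClosed.isOpen_compl.mem_nhds hz) h0
  have hud0 : ∀ z ∉ K, ∀ v, tanDeriv ι u z v = 0 := fun z hz v =>
    tanDeriv_eq_zero_of_eventuallyEq ι (hu0 z hz) v
  have hum0 : ∀ z ∉ K, MDifferentiableAt (𝓡∂ n) 𝓘(ℝ, ℝ) u z := fun z hz =>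
    mdifferentiableAt_const (c := (0 : ℝ)).congr_of_eventuallyEq (hu0 z hz)
  refine ⟨fun j z => χ z * f j (chart n p z), K₁, hK₁, hK₁V,
    fun j => contMDiff_mul_comp_chart hχ hK₁ hK₁s hχ0 (hf j), hw0, fun z => ?_, ?_, ?_⟩
  · by_cases hz : z ∈ K₁
    · have h1 := (hft (chart n p z)).const_mul (χ z)
      rw [hgu z hz] at h1
      have h2 : χ z * u z = u z := by
        by_cases hzK : z ∈ K
        · rw [(hχ1 z hzK).self_of_nhds, one_mul]
        · rw [h0 z hzK, mul_zero]
      rwa [h2] at h1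
    · rw [h0 z fun hzK => hz (hKK₁ hzK)]
      simp_rw [fun j => hw0 j z hz]
      exact tendsto_const_nhds
  · have hψ : ContinuousOn (chart n p) K₁ := (continuousOn_extChartAt p).mono hK₁s
    have hmaps : MapsTo (chart n p) K₁ (chart n p).target := fun z hz =>
      (chart n p).map_source (hK₁s hz)
    obtain ⟨R₁, hR₁⟩ := hK₁.exists_bound_of_continuousOn hχ.continuous.continuousOn
    obtain ⟨R₂, hR₂⟩ := hK₁.exists_bound_of_continuousOn (hg.continuous.comp_continuousOn hψ)
    have hℓ : ∀ b, ContinuousOn (fun z => ‖leftInv (chartDeriv ι p (chart n p z)) (bvec b)‖) K₁ :=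
      fun b => by
        have h1 : ContinuousOn (fun x => leftInv (chartDeriv ι p x) (bvec b)) (chart n p).target :=
          fun x hx => ((contDiffWithinAt_leftInv_chartDeriv h hx).continuousWithinAt.mono
            (chart_target_subset p)).clm_apply continuousWithinAt_const
        exact (h1.comp hψ hmaps).norm
    obtain ⟨R₃, hR₃⟩ := hK₁.exists_bound_of_continuousOn (continuousOn_finsetSum Finset.univ
      fun b _ => hℓ b)
    obtain ⟨R₄, hR₄⟩ := hK₁.exists_bound_of_continuousOn (continuous_finsetSum Finset.univ
      fun b _ => (continuous_tanDeriv h hχ (bvec b)).norm).continuousOn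
    have hfb : ∀ j, ∀ z ∈ K₁, |f j (chart n p z)| ≤ |R₂| + L := fun j z hz => by
      have h1 := hfg j (chart n p z)
      have h2 : |g (chart n p z)| ≤ |R₂| := (hR₂ z hz).trans (le_abs_self _)
      have h3 : f j (chart n p z) = (f j (chart n p z) - g (chart n p z)) + g (chart n p z) := by ring
      rw [h3]
      exact (abs_add_le _ _).trans (by linarith)
    refine ⟨|R₁| * (|R₂| + L) + (|R₁| * (L * |R₃|) + (|R₂| + L) * |R₄|), fun j z => ?_⟩
    have hL0 : (0 : ℝ) ≤ L := L.2
    by_cases hz : z ∈ K₁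
    · have hχb : |χ z| ≤ |R₁| := (hR₁ z hz).trans (le_abs_self _)
      have hA : |χ z * f j (chart n p z)| ≤ |R₁| * (|R₂| + L) := by
        rw [abs_mul]
        exact mul_le_mul hχb (hfb j z hz) (abs_nonneg _) (abs_nonneg _)
      refine ⟨hA.trans (le_add_of_nonneg_right (by positivity)), fun b => ?_⟩
      have hzs := hK₁s hz
      have h1 := tanDeriv_mul_comp_chart h hχ (hf j) (hmaps hz) (bvec b)
      rw [(chart n p).left_inv hzs] at h1
      rw [h1]
      have h3 : ‖leftInv (chartDeriv ι p (chart n p z)) (bvec b)‖ ≤ |R₃| := by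
        refine le_trans ?_ ((hR₃ z hz).trans (le_abs_self _))
        refine le_trans ?_ (le_abs_self _)
        exact Finset.single_le_sum (f := fun b => ‖leftInv (chartDeriv ι p (chart n p z)) (bvec b)‖)
          (fun _ _ => norm_nonneg _) (Finset.mem_univ b)
      have h4 : |tanDeriv ι χ z (bvec b)| ≤ |R₄| := by
        refine le_trans ?_ ((hR₄ z hz).trans (le_abs_self _))
        refine le_trans ?_ (le_abs_self _)
        exact Finset.single_le_sum (f := fun b => ‖tanDeriv ι χ z (bvec b)‖)
          (fun _ _ => norm_nonneg _) (Finset.mem_univ b)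
      have h5 : |fderiv ℝ (f j) (chart n p z) (leftInv (chartDeriv ι p (chart n p z)) (bvec b))|
          ≤ L * |R₃| :=
        ((fderiv ℝ (f j) (chart n p z)).le_opNorm _).trans
          (mul_le_mul (hfL j _) h3 (norm_nonneg _) hL0)
      refine (abs_add_le _ _).trans ?_
      rw [abs_mul, abs_mul]
      have h6 := mul_le_mul hχb h5 (abs_nonneg _) (abs_nonneg R₁)
      have h7 := mul_le_mul (hfb j z hz) h4 (abs_nonneg _) (by positivity)
      have h8 : 0 ≤ |R₁| * (|R₂| + L) := by positivity
      linarith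
    · have hnn : 0 ≤ |R₁| * (|R₂| + L) + (|R₁| * (L * |R₃|) + (|R₂| + L) * |R₄|) := by positivity
      refine ⟨by rw [hw0 j z hz, abs_zero]; exact hnn, fun b => ?_⟩
      rw [hwd0 j z hz, abs_zero]
      exact hnn
  · have hsrc := ae_area_of_ae_chart ι p (P := fun z => MDifferentiableAt (𝓡∂ n) 𝓘(ℝ, ℝ) u z ∧
      ∀ b, Filter.Tendsto (fun j => tanDeriv ι (fun z => χ z * f j (chart n p z)) z (bvec b))
        Filter.atTop (𝓝 (tanDeriv ι u z (bvec b)))) (by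
      filter_upwards [hfae] with x hx hxt
      set z := (chart n p).symm x with hz
      have hzs : z ∈ (chart n p).source := (chart n p).map_target hxt
      have hψz : chart n p z = x := (chart n p).right_inv hxt
      -- Where `χ ≠ 0` the point and its neighbours lie in `K₁`, where `u` agrees with `g` read in
      -- the chart, so `u` inherits the derivative of `g`.
      have hgder : χ z ≠ 0 →
          HasFDerivWithinAt (u ∘ (chart n p).symm) (fderiv ℝ g x) (modelHalf n) x := by
        intro hχz
        have hev := eventually_mem_target p hxt (V := {y | χ y ≠ 0})
          (isOpen_ne_fun hχ.continuous continuous_const) hχz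
        have hev2 : (u ∘ (chart n p).symm) =ᶠ[𝓝[modelHalf n] x] g := by
          filter_upwards [hev] with y hy
          have hyK : (chart n p).symm y ∈ K₁ := by_contra fun hn => hy.2 (hχ0 _ hn)
          have := hgu _ hyK
          rw [(chart n p).right_inv hy.1] at this
          exact this.symm
        exact hx.1.hasFDerivAt.hasFDerivWithinAt.congr_of_eventuallyEq hev2
          (hev2.self_of_nhdsWithin (chart_target_subset p hxt))
      refine ⟨?_, fun b => ?_⟩
      · by_cases hzK : z ∈ K
        · refine mdifferentiableAt_of_comp_chart_symm hzs ?_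
          rw [hψz]
          exact (hgder (by rw [(hχ1 z hzK).self_of_nhds]; exact one_ne_zero)).differentiableWithinAt
        · exact hum0 z hzK
      · have hlim : Filter.Tendsto (fun j => χ z * fderiv ℝ (f j) x
            (leftInv (chartDeriv ι p x) (bvec b)) + f j x * tanDeriv ι χ z (bvec b)) Filter.atTop
            (𝓝 (χ z * fderiv ℝ g x (leftInv (chartDeriv ι p x) (bvec b))
              + g x * tanDeriv ι χ z (bvec b))) :=
          ((((ContinuousLinearMap.apply ℝ ℝ (leftInv (chartDeriv ι p x) (bvec b))).continuous.tendsto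
            _).comp hx.2).const_mul _).add ((hft x).mul_const _)
        -- The limit is the derivative of `χ u`. On `K` the cutoff is locally `1`; off `K` the
        -- function `u` vanishes locally, and each of the two terms is zero.
        have hval : χ z * fderiv ℝ g x (leftInv (chartDeriv ι p x) (bvec b))
              + g x * tanDeriv ι χ z (bvec b) = tanDeriv ι u z (bvec b) := by
          by_cases hzK : z ∈ K
          · have hone := hχ1 z hzK
            have h1 : tanDeriv ι χ z (bvec b) = 0 := by
              have h2 : χ =ᶠ[𝓝 z] fun _ => (1 : ℝ) := hone
              rw [tanDeriv, h2.mfderiv_eq, mfderiv_const]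
              rfl
            have h3 : χ z = 1 := hone.self_of_nhds
            rw [h1, h3, one_mul, mul_zero, add_zero,
              tanDeriv_of_chart h hxt (hgder (by rw [h3]; exact one_ne_zero))]
          · have h1 : g x * tanDeriv ι χ z (bvec b) = 0 := by
              by_cases hzK₁ : z ∈ K₁
              · rw [← hψz, hgu z hzK₁, h0 z hzK, zero_mul]
              · rw [hχd0 z hzK₁, mul_zero]
            have h2 : χ z * fderiv ℝ g x (leftInv (chartDeriv ι p x) (bvec b)) = 0 := by
              by_cases hχz : χ z = 0
              · rw [hχz, zero_mul]
              · rw [← tanDeriv_of_chart h hxt (hgder hχz), ← hz, hud0 z hzK, mul_zero]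
            rw [h1, h2, hud0 z hzK, add_zero]
        rw [hval] at hlim
        refine hlim.congr fun j => ?_
        exact (tanDeriv_mul_comp_chart h hχ (hf j) hxt (bvec b)).symm)
    filter_upwards [hsrc] with z hz
    by_cases hzs : z ∈ (chart n p).source
    · exact hz hzs
    · have hzK₁ : z ∉ K₁ := fun hn => hzs (hK₁s hn)
      have hzK : z ∉ K := fun hn => hzK₁ (hKK₁ hn)
      refine ⟨hum0 z hzK, fun b => ?_⟩
      simp_rw [fun j => hwd0 j z hzK₁ (bvec b)]
      rw [hud0 z hzK]
      exact tendsto_const_nhds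

end ChartApproximation

/-! ### Local Lipschitz continuity in charts. -/

section LipschitzInCharts

lemma locallyLipschitzOn_real_mul {X : Type*} [PseudoMetricSpace X] {s : Set X} {f g : X → ℝ}
    (hf : LocallyLipschitzOn s f) (hg : LocallyLipschitzOn s g) :
    LocallyLipschitzOn s fun x => f x * g x := by
  intro x hx
  obtain ⟨K, t, ht, hK⟩ := hf hx
  obtain ⟨L, t', ht', hL⟩ := hg hx
  have hfb : ∀ᶠ y in 𝓝[s] x, |f y| < |f x| + 1 :=
    (hf.continuousOn x hx).abs.eventually_lt continuousWithinAt_const (lt_add_one _)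
  have hgb : ∀ᶠ y in 𝓝[s] x, |g y| < |g x| + 1 :=
    (hg.continuousOn x hx).abs.eventually_lt continuousWithinAt_const (lt_add_one _)
  have hpos : 0 ≤ (|f x| + 1) * L + (|g x| + 1) * K := by positivity
  refine ⟨⟨_, hpos⟩, (t ∩ t') ∩ ({y | |f y| < |f x| + 1} ∩ {y | |g y| < |g x| + 1}),
    Filter.inter_mem (Filter.inter_mem ht ht') (Filter.inter_mem hfb hgb),
    LipschitzOnWith.of_dist_le_mul fun y hy z hz => ?_⟩
  have h1 := hK.dist_le_mul y hy.1.1 z hz.1.1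
  have h2 := hL.dist_le_mul y hy.1.2 z hz.1.2
  rw [Real.dist_eq] at h1 h2 ⊢
  have h3 : f y * g y - f z * g z = f y * (g y - g z) + g z * (f y - f z) := by ring
  rw [h3]
  refine (abs_add_le _ _).trans ?_
  rw [abs_mul, abs_mul]
  have h4 := mul_le_mul (le_of_lt hy.2.1) h2 (abs_nonneg _) (by positivity)
  have h5 := mul_le_mul (le_of_lt hz.2.2) h1 (abs_nonneg _) (by positivity)
  refine (add_le_add h4 h5).trans (le_of_eq ?_)
  change _ = ((|f x| + 1) * L + (|g x| + 1) * K) * dist y z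
  ring

variable {n : ℕ} [NeZero n] {M : Type*} [TopologicalSpace M]
  [ChartedSpace (EuclideanHalfSpace n) M] [IsManifold (𝓡∂ n) 2 M] {U : Set (E (n + 1))}
  {ι ν : M → E (n + 1)}

lemma nhdsWithin_chart_target {p : M} {x : E n} (hx : x ∈ (chart n p).target) :
    𝓝[(chart n p).target] x = 𝓝[modelHalf n] x :=
  le_antisymm (nhdsWithin_mono x (chart_target_subset p))
    (nhdsWithin_le_iff.2 (chart_target_mem_nhdsWithin hx))

lemma locallyLipschitzOn_chart_of_contMDiff {F : Type*} [NormedAddCommGroup F] [NormedSpace ℝ F]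
    {f : M → F} (hf : ContMDiff (𝓡∂ n) 𝓘(ℝ, F) 1 f) (p : M) :
    LocallyLipschitzOn (chart n p).target (f ∘ (chart n p).symm) := fun x hx => by
  obtain ⟨K, t, ht, hK⟩ := (contDiffWithinAt_comp_chart_symm (by norm_num) hf
    hx).exists_lipschitzOnWith convex_modelHalf
  exact ⟨K, t, by rwa [nhdsWithin_chart_target hx], hK⟩

lemma LocallyLipschitzOnImmersed.locallyLipschitzOn_chart (h : IsProperTwoSidedImmersion U ι ν)
    {φ : M → ℝ} (hφ : LocallyLipschitzOnImmersed ι φ) (p : M) :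
    LocallyLipschitzOn (chart n p).target (φ ∘ (chart n p).symm) := fun x hx => by
  obtain ⟨L, t, ht, hL⟩ :=
    locallyLipschitzOn_chart_of_contMDiff (h.contMDiff.of_le (by norm_num)) p hx
  obtain ⟨K, V, hV, hK⟩ := hφ ((chart n p).symm x)
  refine ⟨K.toNNReal * L, t ∩ (chart n p).symm ⁻¹' V,
    Filter.inter_mem ht (continuousOn_chart_symm p x hx hV),
    LipschitzOnWith.of_dist_le_mul fun y hy z hz => ?_⟩
  have h1 := hL.dist_le_mul y hy.1 z hz.1
  rw [dist_eq_norm] at h1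
  rw [Real.dist_eq, NNReal.coe_mul, mul_assoc]
  refine (hK _ hy.2 _ hz.2).trans ?_
  exact mul_le_mul (Real.le_coe_toNNReal K) h1 (norm_nonneg _) (NNReal.coe_nonneg _)

end LipschitzInCharts

/-! ### The estimate for locally Lipschitz functions. -/

section GlobalApproximation

variable {n : ℕ} [NeZero n] {M : Type*} [TopologicalSpace M] [T2Space M]
  [SecondCountableTopology M] [ChartedSpace (EuclideanHalfSpace n) M]
  [IsManifold (𝓡∂ n) 2 M] [MeasurableSpace M] [BorelSpace M] {U : Set (E (n + 1))}
  {ι ν : M → E (n + 1)} {θ : ℝ}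

lemma mdifferentiableAt_finsetSum {J : Type*} (T : Finset J) {f : J → M → ℝ} {z : M}
    (hf : ∀ k ∈ T, MDifferentiableAt (𝓡∂ n) 𝓘(ℝ, ℝ) (f k) z) :
    MDifferentiableAt (𝓡∂ n) 𝓘(ℝ, ℝ) (fun y => ∑ k ∈ T, f k y) z := by
  classical
  induction T using Finset.induction_on with
  | empty => simpa using mdifferentiableAt_const (c := (0 : ℝ))
  | insert k S hk ih =>
    simp only [Finset.sum_insert hk]
    exact (hf k (Finset.mem_insert_self k S)).add
      (ih fun i hi => hf i (Finset.mem_insert_of_mem hi))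

/-- The almost everywhere differentiability recorded in `IsC1Approx` is used here: without it the
derivative of the limit need not be additive. -/
lemma IsC1Approx.finsetSum {J : Type*} (T : Finset J) {w : J → ℕ → M → ℝ} {K : J → Set M}
    {u : J → M → ℝ} (hw : ∀ k ∈ T, IsC1Approx ι (w k) (K k) (u k)) :
    IsC1Approx ι (fun j z => ∑ k ∈ T, w k j z) (⋃ k ∈ T, K k) fun z => ∑ k ∈ T, u k z := by
  have hd : ∀ j z v, tanDeriv ι (fun z => ∑ k ∈ T, w k j z) z v
      = ∑ k ∈ T, tanDeriv ι (w k j) z v := fun j z v =>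
    tanDeriv_sum ι T (fun k hk => ((hw k hk).contMDiff j z).mdifferentiableAt (by norm_num)) v
  refine ⟨fun j => contMDiff_finsetSum fun k hk => (hw k hk).contMDiff j, fun j z hz =>
    Finset.sum_eq_zero fun k hk => (hw k hk).eq_zero j z fun hzk => hz (mem_biUnion hk hzk),
    fun z => tendsto_finsetSum _ fun k hk => (hw k hk).tendsto z, ?_, ?_⟩
  · have hb : ∀ k, ∃ R : ℝ, k ∈ T → ∀ j z, |w k j z| ≤ R ∧
        ∀ b, |tanDeriv ι (w k j) z (bvec b)| ≤ R := fun k => by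
      by_cases hk : k ∈ T
      · exact (hw k hk).bound.imp fun R hR _ => hR
      · exact ⟨0, fun hk' => absurd hk' hk⟩
    choose R hR using hb
    refine ⟨∑ k ∈ T, R k, fun j z => ⟨?_, fun b => ?_⟩⟩
    · exact (Finset.abs_sum_le_sum_abs _ _).trans (Finset.sum_le_sum fun k hk => (hR k hk j z).1)
    · rw [hd]
      exact (Finset.abs_sum_le_sum_abs _ _).trans (Finset.sum_le_sum fun k hk => (hR k hk j z).2 b)
  · have hae : ∀ᵐ z ∂(area ι), ∀ k ∈ T, MDifferentiableAt (𝓡∂ n) 𝓘(ℝ, ℝ) (u k) z ∧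
        ∀ b, Filter.Tendsto (fun j => tanDeriv ι (w k j) z (bvec b)) Filter.atTop
          (𝓝 (tanDeriv ι (u k) z (bvec b))) :=
      (Filter.eventually_all_finset T).2 fun k hk => (hw k hk).ae_tendsto
    filter_upwards [hae] with z hz
    refine ⟨?_, fun b => ?_⟩
    · exact mdifferentiableAt_finsetSum T fun k hk => (hz k hk).1
    · rw [tanDeriv_sum ι T fun k hk => (hz k hk).1]
      simp_rw [hd]
      exact tendsto_finsetSum _ fun k hk => (hz k hk).2 b

lemma exists_isC1Approx (h : IsProperTwoSidedImmersion U ι ν) {φ : M → ℝ}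
    (hφ : LocallyLipschitzOnImmersed ι φ) {C V : Set M} (hC : IsCompact C) (hV : IsOpen V)
    (hCV : C ⊆ V) (h0 : ∀ z ∉ C, φ z = 0) :
    ∃ (w : ℕ → M → ℝ) (K₁ : Set M), IsCompact K₁ ∧ K₁ ⊆ V ∧ IsC1Approx ι w K₁ φ := by
  obtain ⟨T, χ, hχ, hχ0, hχ1⟩ := exists_chart_partition (n := n) hC
  have hpiece : ∀ k, ∃ (w : ℕ → M → ℝ) (K₁ : Set M), IsCompact K₁ ∧ K₁ ⊆ V ∧
      IsC1Approx ι w K₁ fun z => χ k z * φ z := fun k => by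
    obtain ⟨K, hKs, hK, hK0⟩ := hχ0 k
    refine exists_isC1Approx_of_chart h (p := k) (u := fun z => χ k z * φ z) (K := K ∩ C) (locallyLipschitzOn_real_mul
      (locallyLipschitzOn_chart_of_contMDiff (hχ k) k) (hφ.locallyLipschitzOn_chart h k))
      (hK.inter hC) (inter_subset_left.trans hKs) hV (inter_subset_right.trans hCV) fun z hz => ?_
    by_cases hzK : z ∈ K
    · rw [h0 z fun hzC => hz ⟨hzK, hzC⟩, mul_zero]
    · rw [hK0 z hzK, zero_mul]
  choose w K₁ hK₁ hK₁V hw using hpiece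
  have hsum : (fun z => ∑ k ∈ T, χ k z * φ z) = φ := funext fun z => by
    rw [← Finset.sum_mul]
    by_cases hz : z ∈ C
    · rw [hχ1 z hz, one_mul]
    · rw [h0 z hz, mul_zero]
  refine ⟨fun j z => ∑ k ∈ T, w k j z, ⋃ k ∈ T, K₁ k, T.isCompact_biUnion fun k _ => hK₁ k,
    iUnion₂_subset fun k _ => hK₁V k, ?_⟩
  have := IsC1Approx.finsetSum T fun k _ => hw k
  rwa [hsum] at this

/-- Dominated convergence on a compact set. The limit is measurable because it is an almost
everywhere limit of continuous functions; this covers `|∇φ|²` for a Lipschitz `φ`. -/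
lemma integrable_and_tendsto_integral_area (h : IsProperTwoSidedImmersion U ι ν)
    {F : ℕ → M → ℝ} {f : M → ℝ} (hF : ∀ j, Continuous (F j)) {C : Set M} (hC : IsCompact C)
    (h0 : ∀ j, ∀ z ∉ C, F j z = 0) {R : ℝ} (hR : ∀ j, ∀ z ∈ C, |F j z| ≤ R)
    (hlim : ∀ᵐ z ∂(area ι), Filter.Tendsto (fun j => F j z) Filter.atTop (𝓝 (f z))) :
    Integrable f (area ι) ∧ Filter.Tendsto (fun j => ∫ z, F j z ∂(area ι)) Filter.atTop
      (𝓝 (∫ z, f z ∂(area ι))) := by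
  have := isLocallyFiniteMeasure_area h
  have hint : Integrable (C.indicator fun _ => R) (area ι) :=
    (integrable_indicator_iff hC.measurableSet).2
      (integrableOn_const hC.measure_lt_top.ne)
  have hb : ∀ j z, ‖F j z‖ ≤ C.indicator (fun _ => R) z := fun j z => by
    by_cases hz : z ∈ C
    · rw [indicator_of_mem hz]
      exact hR j z hz
    · rw [indicator_of_notMem hz, h0 j z hz, norm_zero]
  have hm : ∀ j, AEStronglyMeasurable (F j) (area ι) := fun j =>
    (integrable_area_of_continuous h (hF j) hC (h0 j)).aestronglyMeasurable
  refine ⟨hint.mono' (aestronglyMeasurable_of_tendsto_ae _ hm hlim) ?_,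
    tendsto_integral_of_dominated_convergence _ hm hint
      (fun j => Filter.Eventually.of_forall (hb j)) hlim⟩
  filter_upwards [hlim] with z hz
  exact le_of_tendsto hz.norm (Filter.Eventually.of_forall fun j => hb j z)

/-- The curvature estimate for locally Lipschitz functions. -/
lemma tilt_inequality_of_locallyLipschitz (h : IsStableCapillaryMinimal θ U ι ν)
    (hU : IsOpen (ι ⁻¹' U)) (hs : 0 < Real.sin θ) (hn : 2 ≤ n) {k c : ℝ} (hk0 : 0 ≤ k)
    (hc : IsTiltConstant n k (Real.cos θ) c) {φ : M → ℝ} (hφ : LocallyLipschitzOnImmersed ι φ)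
    (hφU : CompactlySupportedIn ι U φ) :
    Integrable (fun q => secondFFSq ι ν q * φ q ^ 2) (area ι) ∧
      Integrable (fun q => gradSq ι φ q * tiltPoly k (Real.cos θ) (ν q)) (area ι) ∧
      c * ∫ q, secondFFSq ι ν q * φ q ^ 2 ∂(area ι)
        ≤ ∫ q, gradSq ι φ q * tiltPoly k (Real.cos θ) (ν q) ∂(area ι) := by
  have hi := h.toIsCapillaryMinimal.toIsProperTwoSidedImmersion
  obtain ⟨C, hC, hCU, h0⟩ := hφU.exists_isCompact hi
  obtain ⟨w, K, hK, hKU, hw⟩ := exists_isC1Approx hi hφ hC hU hCU h0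
  obtain ⟨R, hR⟩ := hw.bound
  have hGc : Continuous fun z => tiltPoly k (Real.cos θ) (ν z) :=
    (contDiff_tiltPoly k _).continuous.comp (continuous_normal hi)
  obtain ⟨R₁, hR₁⟩ := hK.exists_bound_of_continuousOn (continuous_secondFFSq hi).continuousOn
  obtain ⟨R₂, hR₂⟩ := hK.exists_bound_of_continuousOn hGc.continuousOn
  have hsq : ∀ a : ℝ, |a| ≤ R → a ^ 2 ≤ R ^ 2 := fun a ha =>
    sq_le_sq.2 (ha.trans (le_abs_self R))
  have hA := integrable_and_tendsto_integral_area hi (F := fun j q => secondFFSq ι ν q * w j q ^ 2)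
    (f := fun q => secondFFSq ι ν q * φ q ^ 2) (R := R₁ * R ^ 2)
    (fun j => (continuous_secondFFSq hi).mul ((hw.contMDiff j).continuous.pow 2)) hK
    (fun j z hz => by rw [hw.eq_zero j z hz]; ring)
    (fun j z hz => by
      rw [abs_mul, abs_of_nonneg (sq_nonneg (w j z))]
      exact mul_le_mul (hR₁ z hz) (hsq _ (hR j z).1) (sq_nonneg _)
        ((norm_nonneg _).trans (hR₁ z hz)))
    (Filter.Eventually.of_forall fun z => ((hw.tendsto z).pow 2).const_mul _)
  have hB := integrable_and_tendsto_integral_area hi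
    (F := fun j q => gradSq ι (w j) q * tiltPoly k (Real.cos θ) (ν q))
    (f := fun q => gradSq ι φ q * tiltPoly k (Real.cos θ) (ν q))
    (R := (∑ _b : Fin (n + 1), R ^ 2) * R₂)
    (fun j => (continuous_gradSq hi (hw.contMDiff j)).mul hGc) hK
    (fun j z hz => by rw [gradSq_eq_zero_of_notMem ι hK (hw.eq_zero j) hz, zero_mul])
    (fun j z hz => by
      rw [abs_mul, gradSq_eq, abs_of_nonneg (Finset.sum_nonneg fun b _ => sq_nonneg _)]
      exact mul_le_mul (Finset.sum_le_sum fun b _ => hsq _ ((hR j z).2 b)) (hR₂ z hz)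
        (abs_nonneg _) (Finset.sum_nonneg fun b _ => sq_nonneg _))
    (by
      filter_upwards [hw.ae_tendsto] with z hz
      exact (tendsto_finsetSum _ fun b _ => (hz.2 b).pow 2).mul_const _)
  exact ⟨hA.1, hB.1, le_of_tendsto_of_tendsto' (hA.2.const_mul c) hB.2 fun j =>
    tilt_inequality_of_contMDiff h hU hs hn hk0 hc (hw.contMDiff j) hK hKU (hw.eq_zero j)⟩

lemma tiltFun_sq {k : ℝ} (hn : 2 ≤ n) (hk : 0 ≤ k) {q : M} (hν : ‖ν q‖ = 1) :
    tiltFun θ k ν q ^ 2 = tiltPoly k (Real.cos θ) (ν q) := by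
  rw [tiltFun, ← tiltPoly_of_norm_eq_one hν, Real.sq_sqrt (tiltPoly_nonneg hn hk _)]

end GlobalApproximation

end Capillary

end

/-! ### The theorem. -/

theorem mainTheorem5 (n : ℕ) [NeZero n] (hn : 2 ≤ n) (θ : ℝ)
    (hθ : θ ∈ Set.Ico (Real.pi / 2) Real.pi) :
    ∃ C : ℝ, 0 < C ∧
      ∀ (M : Type*) [TopologicalSpace M] [T2Space M] [SecondCountableTopology M]
        [ChartedSpace (EuclideanHalfSpace n) M] [IsManifold (𝓡∂ n) 2 M]
        [MeasurableSpace M] [BorelSpace M]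
        (U : Set (Capillary.E (n + 1))) (ι ν : M → Capillary.E (n + 1)),
        (∃ O, IsOpen O ∧ U = O ∩ Capillary.closedHalfSpace n) →
        Capillary.IsStableCapillaryMinimal θ U ι ν →
        ∀ φ : M → ℝ, Capillary.LocallyLipschitzOnImmersed ι φ →
          Capillary.CompactlySupportedIn ι U φ →
          Integrable (fun p => Capillary.secondFFSq ι ν p * φ p ^ 2) (Capillary.area ι) ∧
          Integrable (fun p => Capillary.gradSq ι φ p * Capillary.capillaryTilt θ ν p ^ 2)
            (Capillary.area ι) ∧
          ∫ p, Capillary.secondFFSq ι ν p * φ p ^ 2 ∂(Capillary.area ι) ≤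
            C * ∫ p, Capillary.gradSq ι φ p * Capillary.capillaryTilt θ ν p ^ 2
              ∂(Capillary.area ι) := by
  have hs : 0 < Real.sin θ :=
    Real.sin_pos_of_pos_of_lt_pi (lt_of_lt_of_le (by positivity) hθ.1) hθ.2
  have ht0 : Real.cos θ ≤ 0 :=
    Real.cos_nonpos_of_pi_div_two_le_of_le hθ.1 (by linarith [hθ.2, Real.pi_pos])
  have ht : -1 < Real.cos θ := by
    -- Since `sin θ > 0`, one has `cos² θ < 1`.
    nlinarith [Real.sin_sq_add_cos_sq θ, mul_pos hs hs]
  have hk : (0 : ℝ) ≤ if n = 2 then 1 else 1 / ((n : ℝ) - 2) := by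
    have h2 : (2 : ℝ) ≤ n := by exact_mod_cast hn
    split_ifs
    · exact zero_le_one
    · exact one_div_nonneg.2 (by linarith)
  obtain ⟨c, hc, hB⟩ := Capillary.exists_tilt_bound hn rfl ht ht0
  -- The constant `c` comes from linear algebra alone, before any hypersurface is chosen, so it
  -- depends on `n` and `θ` only.
  refine ⟨c⁻¹, inv_pos.2 hc, ?_⟩
  intro M _ _ _ _ _ _ _ U ι ν hU h φ hφ hφU
  have hi := h.toIsCapillaryMinimal.toIsProperTwoSidedImmersion
  have key := Capillary.tilt_inequality_of_locallyLipschitz h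
    (Capillary.isOpen_preimage_of_relOpen hi hU) hs hn hk hB hφ hφU
  have hg : ∀ p, Capillary.capillaryTilt θ ν p ^ 2
      = Capillary.tiltPoly (if n = 2 then 1 else 1 / ((n : ℝ) - 2)) (Real.cos θ) (ν p) := fun p =>
    Capillary.tiltFun_sq hn hk (hi.norm_normal p)
  simp_rw [hg]
  refine ⟨key.1, key.2.1, ?_⟩
  rw [inv_mul_eq_div, le_div_iff₀' hc]
  exact key.2.2
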